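/- Let $k$ be a field, let $D=\mathrm{Ch}(k\text{-mod})$ be the category of ($\mathbb Z$-graded, possibly unbounded) cochain complexes of $k$-modules, and let $\mathcal C$ be a (small) site with a terminal object $X$ and with enough points: there is a set $S$ of points $x=(x^*,x_*)$ of $\mathcal C$ such that a morphism $f$ of sheaves of sets is an isomorphism as soon as $x^*f$ is bijective for all $x\in S$. For a sheaf $\mathcal F$ with values in $D$ let $\mathcal F_x=x^*\mathcal F$ be its stalks, let $G=p_*p^*$ with $p^*\mathcal F=(\mathcal F_x)_{x\in S}$ and $p_*(E_x)_x=\prod_{x\in S}x_*E_x$ be the Godement monad, and let $G^\bullet\mathcal F$ be the cosimplicial sheaf $n\mapsto G^{n+1}\mathcal F$, with the coaugmentation $\mathcal F\to G\mathcal F$. Let $NG^\bullet(\mathcal F)$ be the presheaf of complexes whose value at $U$ is the normalized (product) total complex of $G^\bullet\mathcal F(U)$: in degree $n$ it is $\prod_{p+q=n}N^p(G^\bullet\mathcal F(U)^q)$, where $N^p$ is the intersection of the kernels of the codegeneracies in cosimplicial degree $p$, and its differential on bidegree $(p,q)$ is $\sum_i(-1)^i\delta^i+(-1)^p d$. Let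 $\mathcal Z$ be the Eilenberg–Zilber operad over $k$: $\mathcal Z(n)^r$ is the module of natural transformations of degree $r$ $$N(A_1)\otimes\dots\otimes N(A_n)\to N(A_1\otimes\dots\otimes A_n)$$ of functors of cosimplicial $k$-modules $A_1,\dots,A_n$, with the differential of the Hom complexes, composition of operations, and the symmetric group actions by permuting the $A_i$. Let $\mathcal F$ be a sheaf of $\mathrm{Comm}$-algebras in $D$, i.e. a sheaf of commutative differential graded $k$-algebras. Then: 1. $G^\bullet\mathcal F$ is a cosimplicial presheaf of commutative differential graded $k$-algebras, for the structures induced by $\mathcal F$: on each iterate of $G$ the multiplication is the one for which all maps $\mathcal P(V)\to\mathcal P_x$ to stalks and all projections $(G\mathcal P)(U)\to\mathcal P_x$ are algebra morphisms. 2. $NG^\bullet(\mathcal F)$ is a presheaf of $\mathcal Z$-algebras: each $NG^\bullet(\mathcal F)(U)$ is a $\mathcal Z$-algebra and the restriction maps are morphisms of $\mathcal Z$-algebras. The action is the following one. For $z\in\mathcal Z(n)^r$ and elements $a_i\in N^{p_i}(K^{\bullet,q_i})$, where $K=G^\bullet\mathcal F(U)$, the element $z(a_1,\dots,a_n)$ is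 $$(-1)^{\sum_{i<j}q_ip_j}\,N(\mu)\bigl(z_{K^{\bullet,q_1},\dots,K^{\bullet,q_n}}(a_1,\dots,a_n)\bigr),$$ where $\mu\colon K^{\bullet,q_1}\otimes\dots\otimes K^{\bullet,q_n}\to K^{\bullet,q_1+\dots+q_n}$ is the multiplication. Morphisms of sheaves of commutative differential graded algebras induce morphisms of $\mathcal Z$-algebras. 3. In particular $R\Gamma(\mathcal C,\mathcal F)$ is, naturally in $\mathcal F$, a $\mathcal Z$-algebra if $\mathcal F$ is bounded below: on bounded below sheaves of complexes $\mathcal F$ there is an isomorphism of functors $NG^\bullet(\mathcal F)(X)\cong R\Gamma(\mathcal C,\mathcal F)$ to the derived category of $k$-modules, where $R\Gamma(\mathcal C,-)$ is the right derived functor of the global sections functor. Under it, the coaugmentation $\Gamma(\mathcal C,\mathcal F)=\mathcal F(X)\to NG^\bullet(\mathcal F)(X)$ corresponds to the canonical map $\Gamma(\mathcal C,\mathcal F)\to R\Gamma(\mathcal C,\mathcal F)$. -/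

import Mathlib

open CategoryTheory Limits Opposite

universe w v u

noncomputable section

namespace GodementEZ

section MonadResolution

variable {E : Type u} [Category.{v} E] (T : Monad E)

/-- The iterates `T^n` of (the underlying functor of) a monad. -/
def monadIter : ℕ → (E ⥤ E)
  | 0 => 𝟭 E
  | n + 1 => monadIter n ⋙ T.toFunctor

/-- `T f : T^{m+1} X ⟶ T^{n+1} X` for `f : T^m X ⟶ T^n X`. -/
def upMap {X Y : E} {m n : ℕ} (f : (monadIter T m).obj X ⟶ (monadIter T n).obj Y) :
    (monadIter T (m + 1)).obj X ⟶ (monadIter T (n + 1)).obj Y :=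
  T.map f

/-- The unit `T^n X ⟶ T (T^n X)`. -/
def etaAt (X : E) (n : ℕ) : (monadIter T n).obj X ⟶ (monadIter T (n + 1)).obj X :=
  T.η.app ((monadIter T n).obj X)

/-- The multiplication `T (T (T^n X)) ⟶ T (T^n X)`. -/
def muAt (X : E) (n : ℕ) : (monadIter T (n + 2)).obj X ⟶ (monadIter T (n + 1)).obj X :=
  T.μ.app ((monadIter T n).obj X)

lemma upMap_id (X : E) (n : ℕ) : upMap T (𝟙 ((monadIter T n).obj X)) = 𝟙 _ :=
  T.map_id _

lemma upMap_comp {X Y Z : E} {m n p : ℕ} (f : (monadIter T m).obj X ⟶ (monadIter T n).obj Y)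
    (g : (monadIter T n).obj Y ⟶ (monadIter T p).obj Z) :
    upMap T (f ≫ g) = upMap T f ≫ upMap T g :=
  T.map_comp f g

lemma etaAt_naturality {X Y : E} {m n : ℕ} (f : (monadIter T m).obj X ⟶ (monadIter T n).obj Y) :
    etaAt T X m ≫ upMap T f = f ≫ etaAt T Y n :=
  (T.η.naturality f).symm

lemma etaAt_naturality_assoc {X Y : E} {m n : ℕ} (f : (monadIter T m).obj X ⟶ (monadIter T n).obj Y)
    {Z : E} (h : (monadIter T (n + 1)).obj Y ⟶ Z) :
    etaAt T X m ≫ upMap T f ≫ h = f ≫ etaAt T Y n ≫ h := by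
  rw [← Category.assoc, etaAt_naturality, Category.assoc]

lemma muAt_naturality {X Y : E} {m n : ℕ} (f : (monadIter T m).obj X ⟶ (monadIter T n).obj Y) :
    upMap T (upMap T f) ≫ muAt T Y n = muAt T X m ≫ upMap T f :=
  T.μ.naturality f

lemma muAt_naturality_assoc {X Y : E} {m n : ℕ} (f : (monadIter T m).obj X ⟶ (monadIter T n).obj Y)
    {Z : E} (h : (monadIter T (n + 1)).obj Y ⟶ Z) :
    upMap T (upMap T f) ≫ muAt T Y n ≫ h = muAt T X m ≫ upMap T f ≫ h := by
  rw [← Category.assoc, muAt_naturality, Category.assoc]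

lemma muAt_assoc (X : E) (n : ℕ) :
    upMap T (muAt T X n) ≫ muAt T X n = muAt T X (n + 1) ≫ muAt T X n :=
  T.assoc ((monadIter T n).obj X)

lemma etaAt_muAt (X : E) (n : ℕ) : etaAt T X (n + 1) ≫ muAt T X n = 𝟙 _ :=
  T.left_unit ((monadIter T n).obj X)

lemma upMap_etaAt_muAt (X : E) (n : ℕ) : upMap T (etaAt T X n) ≫ muAt T X n = 𝟙 _ :=
  T.right_unit ((monadIter T n).obj X)

/-- Restriction of a monotone map to the complement of the first element. -/
def tailHom {m n : ℕ} (f : Fin (m + 1) →o Fin n) : Fin m →o Fin n :=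
  ⟨fun i => f i.succ, fun _ _ h => f.monotone (Fin.succ_le_succ_iff.2 h)⟩

/-- A monotone map which misses the first element, as a map to the complement of that element. -/
def predHom {m n : ℕ} (f : Fin (m + 1) →o Fin (n + 1)) (h : f 0 ≠ 0) : Fin (m + 1) →o Fin n :=
  ⟨fun i => (f i).pred
      (fun h0 => h (le_antisymm (h0 ▸ f.monotone (Fin.zero_le i)) (Fin.zero_le _))),
    fun _ _ hij => Fin.pred_le_pred_iff.2 (f.monotone hij)⟩

lemma succ_predHom {m n : ℕ} (f : Fin (m + 1) →o Fin (n + 1)) (h : f 0 ≠ 0) (i : Fin (m + 1)) :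
    (predHom f h i).succ = f i :=
  Fin.succ_pred (f i) (fun h0 => h (le_antisymm (h0 ▸ f.monotone (Fin.zero_le i)) (Fin.zero_le _)))

/-- The map from the empty order. -/
def emptyHom (n : ℕ) : Fin 0 →o Fin n := ⟨fun i => i.elim0, fun i => i.elim0⟩

lemma orderHom_fin_zero_ext {n : ℕ} (f g : Fin 0 →o Fin n) : f = g := by
  ext i; exact i.elim0

/-- The map `T^m X ⟶ T^n X` attached to a monotone map `f` from an `m`-element order to an
`n`-element order: the tensor factor `j` of the target receives the multiplication
`T^{r} ⟶ T` of the factors in the fibre of `f` over `j` (`r` being the cardinality of the fibre;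
this is the unit if `r = 0` and the identity if `r = 1`). -/
def monadMap (X : E) :
    ∀ (m n : ℕ) (_ : Fin m →o Fin n), (monadIter T m).obj X ⟶ (monadIter T n).obj X
  | 0, 0, _ => 𝟙 _
  | 0, n + 1, _ => monadMap X 0 n (emptyHom n) ≫ etaAt T X n
  | _ + 1, 0, f => (f 0).elim0
  | m + 1, n + 1, f =>
      if h : f 0 = 0 then upMap T (monadMap X m (n + 1) (tailHom f)) ≫ muAt T X n
      else monadMap X (m + 1) n (predHom f h) ≫ etaAt T X n
termination_by m n => m + n

lemma monadMap_comp (X : E) : ∀ (m n p : ℕ) (f : Fin m →o Fin n) (g : Fin n →o Fin p),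
    monadMap T X m p (g.comp f) = monadMap T X m n f ≫ monadMap T X n p g
  | 0, 0, p, f, g => by
    rw [monadMap.eq_1 T X f, orderHom_fin_zero_ext (g.comp f) g, Category.id_comp]
  | 0, n + 1, 0, f, g => (g 0).elim0
  | 0, n + 1, p + 1, f, g => by
    rw [monadMap.eq_2 T X n f, monadMap.eq_4 T X n p g]
    split_ifs with h
    · rw [Category.assoc, etaAt_naturality_assoc, etaAt_muAt, Category.comp_id,
        ← monadMap_comp X 0 n (p + 1) (emptyHom n) (tailHom g)]
      congr 1; exact orderHom_fin_zero_ext _ _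
    · rw [monadMap.eq_2 T X p,
        orderHom_fin_zero_ext (emptyHom p) ((predHom g h).comp (emptyHom (n + 1))),
        monadMap_comp X 0 (n + 1) p (emptyHom _) (predHom g h), monadMap.eq_2 T X n]
      simp only [Category.assoc]
  | m + 1, 0, p, f, g => (f 0).elim0
  | m + 1, n + 1, 0, f, g => (g 0).elim0
  | m + 1, n + 1, p + 1, f, g => by
    rw [monadMap.eq_4 T X n p g]
    by_cases hg : g 0 = 0
    · rw [dif_pos hg]
      by_cases hf : f 0 = 0
      · have hgf : g.comp f 0 = 0 := by simp [hf, hg]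
        have e : tailHom (g.comp f) = g.comp (tailHom f) := rfl
        rw [monadMap.eq_4 T X m p, dif_pos hgf, monadMap.eq_4 T X m n, dif_pos hf, e,
          monadMap_comp X m (n + 1) (p + 1) (tailHom f) g, monadMap.eq_4 T X n p g, dif_pos hg]
        simp only [upMap_comp, Category.assoc, muAt_assoc, muAt_naturality_assoc]
      · have e : g.comp f = (tailHom g).comp (predHom f hf) := by
          ext i
          exact congrArg (fun x => (g x).val) (succ_predHom f hf i).symm
        rw [monadMap.eq_4 T X m n, dif_neg hf, e,
          monadMap_comp X (m + 1) n (p + 1) (predHom f hf) (tailHom g), Category.assoc,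
          etaAt_naturality_assoc, etaAt_muAt, Category.comp_id]
    · rw [dif_neg hg]
      have hgf : g.comp f 0 ≠ 0 := fun h0 =>
        hg (le_antisymm (h0 ▸ g.monotone (Fin.zero_le _)) (Fin.zero_le _))
      have e : predHom (g.comp f) hgf = (predHom g hg).comp f := rfl
      rw [monadMap.eq_4 T X m p, dif_neg hgf, e,
        monadMap_comp X (m + 1) (n + 1) p f (predHom g hg), Category.assoc]

lemma monadMap_id (X : E) : ∀ n : ℕ, monadMap T X n n OrderHom.id = 𝟙 _
  | 0 => monadMap.eq_1 T X _
  | 1 => by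
    rw [monadMap.eq_4, dif_pos (by rfl), monadMap.eq_2, monadMap.eq_1, Category.id_comp,
      upMap_etaAt_muAt]
  | n + 2 => by
    have h : (tailHom (OrderHom.id (α := Fin (n + 2)))) 0 ≠ 0 :=
      Fin.succ_ne_zero (0 : Fin (n + 1))
    have e : predHom (tailHom (OrderHom.id (α := Fin (n + 2)))) h = OrderHom.id := by
      ext i
      exact congrArg Fin.val (Fin.succ_injective _ (succ_predHom _ h i))
    rw [monadMap.eq_4, dif_pos (by rfl), monadMap.eq_4, dif_neg h, e, monadMap_id X (n + 1),
      Category.id_comp, upMap_etaAt_muAt]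

lemma monadMap_naturality {X Y : E} (g : X ⟶ Y) : ∀ (m n : ℕ) (f : Fin m →o Fin n),
    (monadIter T m).map g ≫ monadMap T Y m n f = monadMap T X m n f ≫ (monadIter T n).map g
  | 0, 0, f => by
    rw [monadMap.eq_1, monadMap.eq_1, Category.comp_id, Category.id_comp]
  | 0, n + 1, f => by
    have e : (monadIter T (n + 1)).map g = upMap T ((monadIter T n).map g) := rfl
    rw [monadMap.eq_2, monadMap.eq_2, ← Category.assoc,
      monadMap_naturality g 0 n (emptyHom n), e, Category.assoc, Category.assoc, etaAt_naturality]
  | m + 1, 0, f => (f 0).elim0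
  | m + 1, n + 1, f => by
    have e : ∀ l, (monadIter T (l + 1)).map g = upMap T ((monadIter T l).map g) := fun _ => rfl
    rw [monadMap.eq_4, monadMap.eq_4]
    split_ifs with hf
    · rw [e m, ← Category.assoc, ← upMap_comp, monadMap_naturality g m (n + 1) (tailHom f),
        upMap_comp, Category.assoc, Category.assoc, e n, muAt_naturality]
    · rw [← Category.assoc, monadMap_naturality g (m + 1) n (predHom f hf), e n, Category.assoc,
        Category.assoc, etaAt_naturality]
termination_by m n => m + n

/-- The cosimplicial object `n ↦ T^{n+1} X` of a monad `T` (the cosimplicial standard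
construction), functorial in `X`. -/
def monadCosimplicial : E ⥤ CosimplicialObject E where
  obj X :=
    { obj := fun n => (monadIter T (n.len + 1)).obj X
      map := fun f => monadMap T X _ _ f.toOrderHom
      map_id := fun _ => monadMap_id T X _
      map_comp := fun f g => monadMap_comp T X _ _ _ f.toOrderHom g.toOrderHom }
  map g :=
    { app := fun n => (monadIter T (n.len + 1)).map g
      naturality := fun _ _ f => (monadMap_naturality T g _ _ f.toOrderHom).symm }
  map_id X := by
    apply NatTrans.ext; funext n; exact (monadIter T (n.len + 1)).map_id X
  map_comp f g := by
    apply NatTrans.ext; funext n; exact (monadIter T (n.len + 1)).map_comp f g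
end MonadResolution

section Norm
variable {k : Type w} [Field k]

/-- The normalization of a cosimplicial `k`-module in degree `p`: the intersection of the kernels of
all codegeneracies. -/
def normSub (A : CosimplicialObject (ModuleCat.{w} k)) :
    (p : ℕ) → Submodule k (A.obj (SimplexCategory.mk p))
  | 0 => ⊤
  | p + 1 => ⨅ j : Fin (p + 1), LinearMap.ker (A.σ j).hom

lemma mem_normSub_succ {A : CosimplicialObject (ModuleCat.{w} k)} {p : ℕ}
    {a : A.obj (SimplexCategory.mk (p + 1))} :
    a ∈ normSub A (p + 1) ↔ ∀ j : Fin (p + 1), (A.σ j).hom a = 0 := by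
  simp [normSub]

lemma normSub_map {A B : CosimplicialObject (ModuleCat.{w} k)} (f : A ⟶ B) :
    (p : ℕ) → (a : A.obj (SimplexCategory.mk p)) → a ∈ normSub A p →
      (f.app (SimplexCategory.mk p)).hom a ∈ normSub B p
  | 0, _, _ => Submodule.mem_top
  | p + 1, a, ha => by
    rw [mem_normSub_succ] at ha ⊢
    intro j
    have h := ConcreteCategory.congr_hom (f.naturality (SimplexCategory.σ j)) a
    have h2 : (f.app _).hom ((A.σ j).hom a) = 0 := by rw [ha j, map_zero]
    exact h.symm.trans h2

/-- The map induced by `f` on normalizations. -/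
def normMap {A B : CosimplicialObject (ModuleCat.{w} k)} (f : A ⟶ B) (p : ℕ) :
    normSub A p →ₗ[k] normSub B p :=
  (f.app (SimplexCategory.mk p)).hom.restrict (normSub_map f p)

/-- The alternating sum of the cofaces. -/
def altCoface (A : CosimplicialObject (ModuleCat.{w} k)) (p : ℕ) :
    A.obj (SimplexCategory.mk p) →ₗ[k] A.obj (SimplexCategory.mk (p + 1)) :=
  ∑ i : Fin (p + 2), (-1 : k) ^ (i : ℕ) • (A.δ i).hom

lemma coface_codeg_eq_zero {A : CosimplicialObject (ModuleCat.{w} k)} {p : ℕ}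
    {a : A.obj (SimplexCategory.mk p)}
    (ha : a ∈ normSub A p) (i : Fin (p + 2)) (j : Fin (p + 1)) (h1 : i ≠ j.castSucc)
    (h2 : i ≠ j.succ) : (A.σ j).hom ((A.δ i).hom a) = 0 := by
  cases p with
  | zero =>
    exfalso
    fin_cases j
    fin_cases i
    · exact h1 rfl
    · exact h2 rfl
  | succ p =>
    rw [mem_normSub_succ] at ha
    rcases lt_or_gt_of_ne h1 with h | h
    · obtain ⟨i', rfl⟩ : ∃ i' : Fin (p + 2), i = i'.castSucc :=
        ⟨i.castPred (ne_of_lt (lt_of_lt_of_le h (Fin.le_last _))), by simp⟩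
      obtain ⟨j', rfl⟩ : ∃ j' : Fin (p + 1), j = j'.succ :=
        ⟨j.pred (by rintro rfl; simp at h), by simp⟩
      have hle : i' ≤ j'.castSucc := by
        simp only [Fin.lt_def, Fin.le_def, Fin.val_castSucc, Fin.val_succ] at h ⊢; omega
      have h3 := ConcreteCategory.congr_hom (A.δ_comp_σ_of_le hle) a
      refine h3.trans ?_
      have h4 : (A.δ i').hom ((A.σ j').hom a) = 0 := by rw [ha, map_zero]
      exact h4
    · obtain ⟨i', rfl⟩ : ∃ i' : Fin (p + 2), i = i'.succ :=
        ⟨i.pred (by rintro rfl; simp at h), by simp⟩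
      obtain ⟨j', rfl⟩ : ∃ j' : Fin (p + 1), j = j'.castSucc :=
        ⟨⟨j, by
          have := i'.isLt
          simp only [Fin.lt_def, Fin.val_castSucc, Fin.val_succ, ne_eq,
            Fin.ext_iff] at h h2
          omega⟩, by ext; simp⟩
      have hlt : j'.castSucc < i' := by
        simp only [Fin.lt_def, Fin.val_castSucc, Fin.val_succ, ne_eq,
          Fin.ext_iff] at h h2 ⊢
        omega
      have h3 := ConcreteCategory.congr_hom (A.δ_comp_σ_of_gt hlt) a
      refine h3.trans ?_
      have h4 : (A.δ i').hom ((A.σ j').hom a) = 0 := by rw [ha, map_zero]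
      exact h4

lemma altCoface_mem {A : CosimplicialObject (ModuleCat.{w} k)} (p : ℕ)
    (a : A.obj (SimplexCategory.mk p)) (ha : a ∈ normSub A p) :
    altCoface A p a ∈ normSub A (p + 1) := by
  rw [mem_normSub_succ]
  intro j
  simp only [altCoface, LinearMap.sum_apply, LinearMap.smul_apply, map_sum, map_smul]
  have h1 : (A.σ j).hom ((A.δ j.castSucc).hom a) = a :=
    ConcreteCategory.congr_hom (A.δ_comp_σ_self (i := j)) a
  have h2 : (A.σ j).hom ((A.δ j.succ).hom a) = a :=
    ConcreteCategory.congr_hom (A.δ_comp_σ_succ (i := j)) a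
  rw [Finset.sum_eq_add j.castSucc j.succ (ne_of_lt (Fin.castSucc_lt_succ))]
  · rw [h1, h2]
    simp [pow_succ]
  · rintro i - ⟨hi1, hi2⟩
    rw [coface_codeg_eq_zero ha i j hi1 hi2, smul_zero]
  · simp
  · simp

/-- The differential of the normalized complex. -/
def normD (A : CosimplicialObject (ModuleCat.{w} k)) (p : ℕ) :
    normSub A p →ₗ[k] normSub A (p + 1) :=
  (altCoface A p).restrict (altCoface_mem p)

lemma normD_normD (A : CosimplicialObject (ModuleCat.{w} k)) (p : ℕ) (a : normSub A p) :
    normD A (p + 1) (normD A p a) = 0 := by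
  have key : ∀ q x, altCoface A q x =
      (AlgebraicTopology.AlternatingCofaceMapComplex.objD A q).hom x := by
    intro q x
    simp only [altCoface, AlgebraicTopology.AlternatingCofaceMapComplex.objD, LinearMap.sum_apply,
      LinearMap.smul_apply, ModuleCat.hom_sum, ModuleCat.hom_zsmul]
    refine Finset.sum_congr rfl fun i _ => ?_
    rcases neg_one_pow_eq_or k (i : ℕ) with h | h <;>
    rcases Nat.even_or_odd (i : ℕ) with h' | h' <;>
    simp [h'.neg_one_pow]
  have h := ConcreteCategory.congr_hom (AlgebraicTopology.AlternatingCofaceMapComplex.d_squared A p)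
    a.1
  apply Subtype.ext
  change altCoface A (p + 1) (altCoface A p a.1) = 0
  rw [key, key]
  exact h

lemma normMap_normD {A B : CosimplicialObject (ModuleCat.{w} k)} (f : A ⟶ B) (p : ℕ)
    (a : normSub A p) : normMap f (p + 1) (normD A p a) = normD B p (normMap f p a) := by
  apply Subtype.ext
  change (f.app _).hom (altCoface A p a.1) = altCoface B p ((f.app _).hom a.1)
  simp only [altCoface, LinearMap.sum_apply, LinearMap.smul_apply, map_sum, map_smul]
  refine Finset.sum_congr rfl fun i _ => ?_
  congr 1
  exact ConcreteCategory.congr_hom (f.naturality (SimplexCategory.δ i)) a.1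

lemma normMap_id (A : CosimplicialObject (ModuleCat.{w} k)) (p : ℕ) :
    normMap (𝟙 A) p = LinearMap.id := rfl

lemma normMap_comp {A B C : CosimplicialObject (ModuleCat.{w} k)} (f : A ⟶ B) (g : B ⟶ C) (p : ℕ) :
    normMap (f ≫ g) p = normMap g p ∘ₗ normMap f p := rfl
end Norm

section Tot
variable (k : Type w) [Field k]

/-- Cochain complexes of `k`-modules. -/
abbrev Dg := CochainComplex (ModuleCat.{w} k) ℤ

variable {k}

/-- The map `normD` as a map from degree `p` to degree `q`, which is zero unless `q = p + 1`. -/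
def normDD (A : CosimplicialObject (ModuleCat.{w} k)) (p q : ℕ) :
    normSub A p →ₗ[k] normSub A q :=
  if h : p + 1 = q then h ▸ normD A p else 0

lemma normDD_succ (A : CosimplicialObject (ModuleCat.{w} k)) (p : ℕ) :
    normDD A p (p + 1) = normD A p := by simp [normDD]

lemma normDD_of_ne (A : CosimplicialObject (ModuleCat.{w} k)) {p q : ℕ} (h : p + 1 ≠ q) :
    normDD A p q = 0 := by simp [normDD, h]

lemma normMap_normDD {A B : CosimplicialObject (ModuleCat.{w} k)} (f : A ⟶ B) (p q : ℕ)
    (a : normSub A p) : normMap f q (normDD A p q a) = normDD B p q (normMap f p a) := by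
  by_cases h : p + 1 = q
  · subst h
    rw [normDD_succ, normDD_succ, normMap_normD]
  · rw [normDD_of_ne _ h, normDD_of_ne _ h]; simp

/-- The graded pieces of the normalized complex, in all integral degrees. -/
def normX (A : CosimplicialObject (ModuleCat.{w} k)) : ℤ → ModuleCat.{w} k
  | Int.ofNat p => ModuleCat.of k (normSub A p)
  | Int.negSucc _ => ModuleCat.of k PUnit

/-- The differential of the normalized complex, in all integral degrees. -/
def normXd (A : CosimplicialObject (ModuleCat.{w} k)) : (i j : ℤ) → (normX A i ⟶ normX A j)
  | Int.ofNat p, Int.ofNat q => ModuleCat.ofHom (normDD A p q)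
  | Int.ofNat _, Int.negSucc _ => 0
  | Int.negSucc _, _ => 0

/-- The effect of a morphism on the pieces of the normalized complexes. -/
def normXmap {A B : CosimplicialObject (ModuleCat.{w} k)} (f : A ⟶ B) :
    (i : ℤ) → (normX A i ⟶ normX B i)
  | Int.ofNat p => ModuleCat.ofHom (normMap f p)
  | Int.negSucc _ => 0

/-- The normalized cochain complex `N(A)` of a cosimplicial `k`-module `A`. -/
def normCplx : CosimplicialObject (ModuleCat.{w} k) ⥤ Dg k where
  obj A :=
    { X := normX A
      d := normXd A
      shape := by
        rintro (p | p) (q | q) h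
        · have h' : p + 1 ≠ q := fun e => h (by subst e; rfl)
          change ModuleCat.ofHom (normDD A p q) = 0
          rw [normDD_of_ne _ h']
          rfl
        all_goals rfl
      d_comp_d' := by
        rintro (p | p) (q | q) (r | r) h1 h2
        · have h1' : p + 1 = q := by
            have : (p : ℤ) + 1 = q := h1
            omega
          have h2' : q + 1 = r := by
            have : (q : ℤ) + 1 = r := h2
            omega
          subst h1' h2'
          change ModuleCat.ofHom (normDD A _ _) ≫ ModuleCat.ofHom (normDD A _ _) = 0
          rw [normDD_succ, normDD_succ]
          ext a
          exact congrArg Subtype.val (normD_normD A p a)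
        all_goals first | exact comp_zero | exact zero_comp }
  map f :=
    { f := normXmap f
      comm' := by
        rintro (p | p) (q | q) h
        · change ModuleCat.ofHom _ ≫ ModuleCat.ofHom (normDD _ _ _) =
            ModuleCat.ofHom (normDD _ _ _) ≫ ModuleCat.ofHom _
          ext a
          exact congrArg Subtype.val (normMap_normDD f p q a).symm
        all_goals exact (comp_zero.trans zero_comp.symm) }
  map_id A := by
    ext (p | p) a
    · rfl
    · rfl
  map_comp f g := by
    ext (p | p) a
    · rfl
    · rfl

/-- The cosimplicial module of elements of vertical degree `q` of a cosimplicial complex. -/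
abbrev row (K : CosimplicialObject (Dg k)) (q : ℤ) : CosimplicialObject (ModuleCat.{w} k) :=
  K ⋙ HomologicalComplex.eval _ _ q

/-- The map between rows induced by the differentials of the complexes. -/
abbrev rowD (K : CosimplicialObject (Dg k)) (q q' : ℤ) : row K q ⟶ row K q' :=
  Functor.whiskerLeft K (HomologicalComplex.dNatTrans _ _ q q')

/-- The map between rows induced by a map of cosimplicial complexes. -/
abbrev rowMap {K L : CosimplicialObject (Dg k)} (f : K ⟶ L) (q : ℤ) : row K q ⟶ row L q :=
  Functor.whiskerRight f _

/-- The bidegrees `(p, q)` of total degree `n`. -/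
abbrev Bideg (n : ℤ) := {s : ℕ × ℤ // (s.1 : ℤ) + s.2 = n}

/-- The degree `n` part of the total complex: the product of all pieces of bidegrees `(p, q)`
with `p + q = n`. -/
abbrev TotX (K : CosimplicialObject (Dg k)) (n : ℤ) : Type w :=
  (s : Bideg n) → normSub (row K s.1.2) s.1.1

/-- The horizontal part of the total differential. -/
def totH (K : CosimplicialObject (Dg k)) (n n' : ℤ) (h : n + 1 = n') (a : TotX K n) :
    (s : Bideg n') → normSub (row K s.1.2) s.1.1
  | ⟨(0, _), _⟩ => 0
  | ⟨(p + 1, q), hs⟩ => normD (row K q) p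
      (a ⟨(p, q), by subst h; simp only [Nat.cast_add, Nat.cast_one] at hs ⊢; omega⟩)

/-- The vertical part of the total differential (without sign). -/
def totV (K : CosimplicialObject (Dg k)) (n n' : ℤ) (h : n + 1 = n') (a : TotX K n) :
    (s : Bideg n') → normSub (row K s.1.2) s.1.1 :=
  fun s => normMap (rowD K (s.1.2 - 1) s.1.2) s.1.1
    (a ⟨(s.1.1, s.1.2 - 1), by have := s.2; simp only; omega⟩)

/-- The total differential: on elements of bidegree `(p, q)` it is the sum of the horizontal
differential and of `(-1)^p` times the vertical differential. -/
def totD (K : CosimplicialObject (Dg k)) (n n' : ℤ) (h : n + 1 = n') : TotX K n →ₗ[k] TotX K n' where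
  toFun a := fun s => totH K n n' h a s + (-1 : k) ^ s.1.1 • totV K n n' h a s
  map_add' a b := by
    funext s
    obtain ⟨⟨_ | p, q⟩, hs⟩ := s <;> simp [totH, totV] <;> module
  map_smul' c a := by
    funext s
    obtain ⟨⟨_ | p, q⟩, hs⟩ := s <;> simp [totH, totV] <;> module

/-- The map on the pieces of the total complex. -/
def totMap {K L : CosimplicialObject (Dg k)} (f : K ⟶ L) (n : ℤ) : TotX K n →ₗ[k] TotX L n where
  toFun a := fun s => normMap (rowMap f s.1.2) s.1.1 (a s)
  map_add' a b := by funext s; simp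
  map_smul' c a := by funext s; simp

lemma totD_totD (K : CosimplicialObject (Dg k)) (n n' n'' : ℤ) (h : n + 1 = n') (h' : n' + 1 = n'')
    (a : TotX K n) : totD K n' n'' h' (totD K n n' h a) = 0 := by
  have vv : ∀ q q' q'' p (x : normSub (row K q) p),
      normMap (rowD K q' q'') p (normMap (rowD K q q') p x) = 0 := by
    intro q q' q'' p x
    apply Subtype.ext
    change ((K.obj _).d q' q'').hom (((K.obj _).d q q').hom x.1) = 0
    exact ConcreteCategory.congr_hom ((K.obj _).d_comp_d q q' q'') x.1
  funext s
  obtain ⟨⟨_ | _ | p, q⟩, hs⟩ := s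
  · simp [totD, totH, totV, vv]
  · simp [totD, totH, totV, vv, normMap_normD]
  · simp [totD, totH, totV, vv, normMap_normD, normD_normD, pow_succ]

lemma totMap_totD {K L : CosimplicialObject (Dg k)} (f : K ⟶ L) (n n' : ℤ) (h : n + 1 = n')
    (a : TotX K n) : totMap f n' (totD K n n' h a) = totD L n n' h (totMap f n a) := by
  have e : ∀ q q' p (x : normSub (row K q) p), normMap (rowMap f q') p (normMap (rowD K q q') p x) =
      normMap (rowD L q q') p (normMap (rowMap f q) p x) := by
    intro q q' p x
    apply Subtype.ext
    exact ConcreteCategory.congr_hom ((f.app _).comm q q').symm x.1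
  funext s
  obtain ⟨⟨_ | p, q⟩, hs⟩ := s
  · simp [totD, totH, totV, totMap, e]
  · simp [totD, totH, totV, totMap, e, normMap_normD]

/-- The normalized (product) total complex `N(K)` of a cosimplicial complex `K`. -/
def totN : CosimplicialObject (Dg k) ⥤ Dg k where
  obj K :=
    { X := fun n => ModuleCat.of k (TotX K n)
      d := fun n n' => if h : n + 1 = n' then ModuleCat.ofHom (totD K n n' h) else 0
      shape := fun n n' h => dif_neg h
      d_comp_d' := by
        intro n n' n'' h h'
        simp only [ComplexShape.up_Rel] at h h'
        rw [dif_pos h, dif_pos h']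
        ext a : 2
        exact totD_totD K n n' n'' h h' a }
  map f :=
    { f := fun n => ModuleCat.ofHom (totMap f n)
      comm' := by
        intro n n' h
        simp only [ComplexShape.up_Rel] at h
        dsimp only
        rw [dif_pos h, dif_pos h]
        ext a : 2
        exact (totMap_totD f n n' h a).symm }
  map_id K := rfl
  map_comp f g := rfl

end Tot

section Godement
variable (k : Type w) [Field k] {C : Type w} [SmallCategory C] {J : GrothendieckTopology C}
  {S : Type w} (pt : S → GrothendieckTopology.Point.{w} J)

/-- The functor `p^*` sending a sheaf `F` of complexes to the family of its stalks. -/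
def stalks : Sheaf J (Dg k) ⥤ (S → Dg k) :=
  Functor.pi' fun s => (pt s).sheafFiber

/-- The functor `p_*` sending a family of complexes to the product of the skyscraper sheaves. -/
def skyscrapers : (S → Dg k) ⥤ Sheaf J (Dg k) where
  obj E := ∏ᶜ fun s => (pt s).skyscraperSheafFunctor.obj (E s)
  map f := Limits.Pi.map fun s => (pt s).skyscraperSheafFunctor.map (f s)
  map_id E := by
    refine Limits.Pi.hom_ext _ _ fun s => ?_
    rw [Limits.Pi.map_π, Category.id_comp]
    exact (congrArg (_ ≫ ·) ((pt s).skyscraperSheafFunctor.map_id _)).trans (Category.comp_id _)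
  map_comp f g := by
    refine Limits.Pi.hom_ext _ _ fun s => ?_
    rw [Limits.Pi.map_π, Category.assoc, Limits.Pi.map_π, ← Category.assoc, Limits.Pi.map_π,
      Category.assoc]
    exact congrArg (_ ≫ ·) ((pt s).skyscraperSheafFunctor.map_comp _ _)

/-- The projection from the product of the skyscraper sheaves. -/
def skyscrapersπ (E : S → Dg k) (s : S) :
    (skyscrapers k pt).obj E ⟶ (pt s).skyscraperSheafFunctor.obj (E s) :=
  Limits.Pi.π (fun s => (pt s).skyscraperSheafFunctor.obj (E s)) s

lemma skyscrapers_map_π {E E' : S → Dg k} (f : E ⟶ E') (s : S) :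
    (skyscrapers k pt).map f ≫ skyscrapersπ k pt E' s =
      skyscrapersπ k pt E s ≫ (pt s).skyscraperSheafFunctor.map (f s) :=
  Limits.Pi.map_π (fun s => (pt s).skyscraperSheafFunctor.map (f s)) s

/-- The map to a product of skyscraper sheaves with prescribed components. -/
def skyscrapersLift {F : Sheaf J (Dg k)} {E : S → Dg k}
    (f : (s : S) → (F ⟶ (pt s).skyscraperSheafFunctor.obj (E s))) : F ⟶ (skyscrapers k pt).obj E :=
  Limits.Pi.lift f

lemma skyscrapersLift_π {F : Sheaf J (Dg k)} {E : S → Dg k}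
    (f : (s : S) → (F ⟶ (pt s).skyscraperSheafFunctor.obj (E s))) (s : S) :
    skyscrapersLift k pt f ≫ skyscrapersπ k pt E s = f s :=
  Limits.Pi.lift_π f s

lemma skyscrapers_hom_ext {F : Sheaf J (Dg k)} {E : S → Dg k}
    {f g : F ⟶ (skyscrapers k pt).obj E}
    (h : ∀ s, f ≫ skyscrapersπ k pt E s = g ≫ skyscrapersπ k pt E s) : f = g :=
  Limits.Pi.hom_ext _ _ h

/-- The adjunction between `p^*` and `p_*`. -/
def stalksAdj : stalks k pt ⊣ skyscrapers k pt :=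
  Adjunction.mkOfHomEquiv
    { homEquiv := fun F E =>
        { toFun := fun f => skyscrapersLift k pt fun s =>
            (pt s).skyscraperSheafAdjunction.homEquiv F (E s) (f s)
          invFun := fun g => fun s =>
            ((pt s).skyscraperSheafAdjunction.homEquiv F (E s)).symm (g ≫ skyscrapersπ k pt E s)
          left_inv := fun f => by
            funext s
            exact (congrArg ((pt s).skyscraperSheafAdjunction.homEquiv F (E s)).symm
              (skyscrapersLift_π k pt _ s)).trans (Equiv.symm_apply_apply _ _)
          right_inv := fun g => by
            refine skyscrapers_hom_ext k pt fun s => ?_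
            refine (skyscrapersLift_π k pt _ s).trans ?_
            exact Equiv.apply_symm_apply _ _ }
      homEquiv_naturality_left_symm := fun {F F' E} f g => by
        funext s
        have h := (pt s).skyscraperSheafAdjunction.homEquiv_naturality_left_symm f
          (g ≫ skyscrapersπ k pt E s)
        rw [← Category.assoc] at h
        exact h
      homEquiv_naturality_right := fun {F E E'} f g => by
        refine skyscrapers_hom_ext k pt fun s => ?_
        refine (skyscrapersLift_π k pt _ s).trans ?_
        refine ((pt s).skyscraperSheafAdjunction.homEquiv_naturality_right (f s) (g s)).trans ?_
        refine Eq.trans ?_ (Category.assoc _ _ _).symm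
        rw [skyscrapers_map_π, ← Category.assoc]
        exact congrArg (· ≫ (pt s).skyscraperSheafFunctor.map (g s))
          (skyscrapersLift_π k pt
            (fun s => (pt s).skyscraperSheafAdjunction.homEquiv F (E s) (f s)) s).symm }

/-- The Godement functor `G = p_* p^*`, with its monad structure. -/
def godement : Monad (Sheaf J (Dg k)) := (stalksAdj k pt).toMonad

/-- The cosimplicial Godement functor. -/
def godementCos : Sheaf J (Dg k) ⥤ CosimplicialObject (Sheaf J (Dg k)) :=
  monadCosimplicial (godement k pt)

/-- The normalized Godement resolution, as a functor to presheaves: objectwise, it is the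
normalized complex of the cosimplicial Godement resolution. -/
def NG : Sheaf J (Dg k) ⥤ (Cᵒᵖ ⥤ Dg k) :=
  godementCos k pt ⋙ (CosimplicialObject.whiskering _ _).obj (sheafToPresheaf J (Dg k)) ⋙
    flipFunctor _ _ _ ⋙ (Functor.whiskeringRight Cᵒᵖ _ _).obj totN

/-- The cosimplicial complex of sections over `U` of the cosimplicial Godement resolution. -/
def godementSections (F : Sheaf J (Dg k)) (U : Cᵒᵖ) : CosimplicialObject (Dg k) :=
  (((CosimplicialObject.whiskering _ _).obj (sheafToPresheaf J (Dg k))).obj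
    ((godementCos k pt).obj F)).flip.obj U


end Godement

section RGamma
variable (k : Type w) [Field k] {C : Type w} [SmallCategory C] (J : GrothendieckTopology C)

/-- A sheaf of complexes, viewed as a complex of sheaves. -/
def sheafComplex : Sheaf J (Dg k) ⥤ CochainComplex (Sheaf J (ModuleCat.{w} k)) ℤ where
  obj F :=
    { X := fun n => (sheafCompose J (HomologicalComplex.eval _ _ n)).obj F
      d := fun m n => ⟨Functor.whiskerLeft F.obj (HomologicalComplex.dNatTrans _ _ m n)⟩
      shape := fun m n h => by
        apply ObjectProperty.hom_ext
        ext U : 2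
        exact (F.obj.obj U).shape m n h
      d_comp_d' := fun m n p _ _ => by
        apply ObjectProperty.hom_ext
        ext U : 2
        exact (F.obj.obj U).d_comp_d m n p }
  map f :=
    { f := fun n => (sheafCompose J (HomologicalComplex.eval _ _ n)).map f
      comm' := fun m n _ => by
        apply ObjectProperty.hom_ext
        ext U : 2
        exact (f.hom.app U).comm m n }
  map_id F := by
    ext n : 1
    exact (sheafCompose J (HomologicalComplex.eval _ _ n)).map_id F
  map_comp f g := by
    ext n : 1
    exact (sheafCompose J (HomologicalComplex.eval _ _ n)).map_comp f g

/-- The sheaves of complexes which are bounded below. -/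
def bddBelow : ObjectProperty (Sheaf J (Dg k)) :=
  (CochainComplex.plus _).inverseImage (sheafComplex k J)

/-- Bounded below sheaves of complexes, as bounded below complexes of sheaves. -/
def bddSheafComplex : (bddBelow k J).FullSubcategory ⥤
    CochainComplex.Plus (Sheaf J (ModuleCat.{w} k)) :=
  ObjectProperty.lift _ ((bddBelow k J).ι ⋙ sheafComplex k J) (fun F => F.property)

instance : (Sheaf.Γ J (ModuleCat.{w} k)).Additive :=
  (constantSheafΓAdj J (ModuleCat.{w} k)).right_adjoint_additive

instance (U : Cᵒᵖ) : ((sheafSections J (ModuleCat.{w} k)).obj U).Additive where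
  map_add := rfl

/-- The complex of global sections of a sheaf of complexes. -/
def globalComplex : Sheaf J (Dg k) ⥤ Dg k :=
  sheafComplex k J ⋙ (Sheaf.Γ J (ModuleCat.{w} k)).mapHomologicalComplex _

/-- The restriction of global sections to sections over `U`. -/
def globalRes (U : Cᵒᵖ) (F : Sheaf J (Dg k)) : (globalComplex k J).obj F ⟶ F.obj.obj U :=
  (NatTrans.mapHomologicalComplex (Sheaf.natTransΓRes J (ModuleCat.{w} k) U) _).app
    ((sheafComplex k J).obj F)

variable [HasDerivedCategory.{v} (Sheaf J (ModuleCat.{w} k))]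
  [HasDerivedCategory.{u} (ModuleCat.{w} k)]

/-- The derived global sections `RΓ(C, F)` of bounded below sheaves of complexes `F`, as an object
of the derived category of `k`-modules: the value of the right derived functor of the
global sections functor. -/
def derivedGlobal : (bddBelow k J).FullSubcategory ⥤ DerivedCategory (ModuleCat.{w} k) :=
  bddSheafComplex k J ⋙ HomotopyCategory.Plus.quotient _ ⋙ DerivedCategory.Plus.Qh ⋙
    (Sheaf.Γ J (ModuleCat.{w} k)).rightDerivedFunctorPlus ⋙ DerivedCategory.Plus.ι

/-- The canonical map from global sections to derived global sections. -/
def toDerivedGlobal (F : (bddBelow k J).FullSubcategory) :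
    DerivedCategory.Q.obj ((globalComplex k J).obj F.obj) ⟶ (derivedGlobal k J).obj F :=
  ((DerivedCategory.quotientCompQhIso _).inv.app ((globalComplex k J).obj F.obj) : _) ≫
    DerivedCategory.Plus.ι.map ((Sheaf.Γ J (ModuleCat.{w} k)).rightDerivedFunctorPlusUnit.app
      ((HomotopyCategory.Plus.quotient _).obj ((bddSheafComplex k J).obj F)))

end RGamma

section Aug
variable {k : Type w} [Field k]

/-- The identity `M^p → M^q` if `p = q`, and zero otherwise. -/
def idMap (M : Dg k) (p q : ℤ) : M.X p →ₗ[k] M.X q :=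
  if h : p = q then (M.XIsoOfEq h).hom.hom else 0

lemma idMap_self (M : Dg k) (p : ℤ) (x : M.X p) : idMap M p p x = x := by simp [idMap]

/-- The degreewise map underlying `totAug`. -/
def totAugX {M : Dg k} {K : CosimplicialObject (Dg k)}
    (f : M ⟶ K.obj (SimplexCategory.mk 0)) (n : ℤ) (a : M.X n) :
    (s : Bideg n) → normSub (row K s.1.2) s.1.1
  | ⟨(0, q), _⟩ => ⟨(f.f q).hom (idMap M n q a), Submodule.mem_top⟩
  | ⟨(_ + 1, _), _⟩ => 0

lemma altCoface_zero_apply (A : CosimplicialObject (ModuleCat.{w} k))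
    (x : A.obj (SimplexCategory.mk 0)) :
    altCoface A 0 x = (A.δ (0 : Fin 2)).hom x - (A.δ (1 : Fin 2)).hom x := by
  simp [altCoface, Fin.sum_univ_two, sub_eq_add_neg]

/-- The map `M → N(K)` induced by a coaugmentation `f : M → K^0` of a cosimplicial complex. -/
def totAug {M : Dg k} {K : CosimplicialObject (Dg k)} (f : M ⟶ K.obj (SimplexCategory.mk 0))
    (hf : f ≫ K.δ (0 : Fin 2) = f ≫ K.δ 1) : M ⟶ totN.obj K where
  f n := ModuleCat.ofHom
    { toFun := totAugX f n
      map_add' := fun a b => by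
        funext s
        obtain ⟨⟨_ | p, q⟩, hs⟩ := s
        · simp [totAugX]; rfl
        · simp [totAugX]
      map_smul' := fun c a => by
        funext s
        obtain ⟨⟨_ | p, q⟩, hs⟩ := s
        · simp [totAugX]; rfl
        · simp [totAugX] }
  comm' := by
    intro n n' h
    simp only [ComplexShape.up_Rel] at h
    subst h
    have e : (totN.obj K).d n (n + 1) = ModuleCat.ofHom (totD K n (n + 1) rfl) := dif_pos rfl
    rw [e]
    ext a : 2
    change totD K n (n + 1) rfl (totAugX f n a) = totAugX f (n + 1) ((M.d n (n + 1)).hom a)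
    funext s
    obtain ⟨⟨_ | _ | p, q⟩, hs⟩ := s
    · obtain rfl : q = n + 1 := by simpa using hs
      have h1 : (M.XIsoOfEq (show n = n + 1 - 1 by omega)).hom ≫ M.d (n + 1 - 1) (n + 1) =
          M.d n (n + 1) := M.XIsoOfEq_hom_comp_d _ _
      have h2 : idMap M n (n + 1 - 1) a =
          (M.XIsoOfEq (show n = n + 1 - 1 by omega)).hom.hom a := by
        rw [idMap, dif_pos]
      have h3 : totV K n (n + 1) rfl (totAugX f n a) ⟨(0, n + 1), hs⟩ =
          totAugX f (n + 1) ((M.d n (n + 1)).hom a) ⟨(0, n + 1), hs⟩ := by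
        apply Subtype.ext
        change ((K.obj _).d (n + 1 - 1) (n + 1)).hom ((f.f (n + 1 - 1)).hom
          (idMap M n (n + 1 - 1) a)) =
            (f.f (n + 1)).hom (idMap M (n + 1) (n + 1) ((M.d n (n + 1)).hom a))
        rw [idMap_self, h2]
        refine (ConcreteCategory.congr_hom (f.comm (n + 1 - 1) (n + 1)) _).trans ?_
        exact congrArg (f.f (n + 1)).hom (ConcreteCategory.congr_hom h1 a)
      refine Eq.trans ?_ h3
      have h6 : ∀ y : normSub (row K (n + 1)) 0, 0 + (-1 : k) ^ 0 • y = y := fun y => by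
        rw [pow_zero, one_smul, zero_add]
      exact h6 _
    · have h3 : ∀ y, altCoface (row K q) 0 ((f.f q).hom y) = 0 := by
        intro y
        refine (altCoface_zero_apply (row K q) _).trans (sub_eq_zero.2 ?_)
        exact ConcreteCategory.congr_hom (HomologicalComplex.congr_hom hf q) y
      have h4 : totH K n (n + 1) rfl (totAugX f n a) ⟨(0 + 1, q), hs⟩ = 0 :=
        Subtype.ext (h3 _)
      have h5 : totV K n (n + 1) rfl (totAugX f n a) ⟨(0 + 1, q), hs⟩ = 0 :=
        map_zero (normMap (rowD K (q - 1) q) 1)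
      change _ + _ • totV K n (n + 1) rfl (totAugX f n a) ⟨(0 + 1, q), hs⟩ = 0
      rw [h4, h5, smul_zero, add_zero]
    · simp [totD, totH, totV, totAugX]
end Aug

section AugNG
variable (k : Type w) [Field k] {C : Type w} [SmallCategory C] {J : GrothendieckTopology C}
  {S : Type w} (pt : S → GrothendieckTopology.Point.{w} J)

/-- The coaugmentation `F ⟶ G F = G^0 F`. -/
def godementUnit (F : Sheaf J (Dg k)) :
    F ⟶ ((godementCos k pt).obj F).obj (SimplexCategory.mk 0) :=
  (godement k pt).η.app F

lemma godementUnit_coface (F : Sheaf J (Dg k)) (i : Fin 2) :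
    godementUnit k pt F ≫ ((godementCos k pt).obj F).δ i =
      monadMap (godement k pt) F 0 2 (emptyHom 2) := by
  have h : godementUnit k pt F = monadMap (godement k pt) F 0 1 (emptyHom 1) := by
    rw [monadMap.eq_2, monadMap.eq_1, Category.id_comp]
    rfl
  rw [h]
  refine (monadMap_comp (godement k pt) F 0 1 2 (emptyHom 1) (SimplexCategory.δ i).toOrderHom).symm.trans ?_
  exact congrArg _ (orderHom_fin_zero_ext _ _)

/-- The canonical map from a sheaf of complexes to its normalized Godement resolution, on sections over `U`. -/
def toNG (F : Sheaf J (Dg k)) (U : Cᵒᵖ) : F.obj.obj U ⟶ ((NG k pt).obj F).obj U :=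
  totAug (K := godementSections k pt F U) ((godementUnit k pt F).hom.app U) (by
    have h := (godementUnit_coface k pt F 0).trans (godementUnit_coface k pt F 1).symm
    exact congrArg (fun g => g.hom.app U) h)
end AugNG

section CDGA
variable {k : Type w} [Field k]

/-- The structure of a commutative differential graded algebra on a cochain complex `K`
(equivalently, of an algebra over the commutative operad). -/
structure CDGA (K : Dg k) where
  /-- the multiplication `K^p × K^q → K^r` for `p + q = r` -/
  mul : {p q r : ℤ} → p + q = r → (K.X p →ₗ[k] K.X q →ₗ[k] K.X r)
  /-- the unit -/
  one : K.X 0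
  mul_assoc : ∀ {p q r s t n : ℤ} (h₁ : p + q = s) (h₂ : s + r = n) (h₃ : q + r = t)
    (h₄ : p + t = n) (a : K.X p) (b : K.X q) (c : K.X r),
    mul h₂ (mul h₁ a b) c = mul h₄ a (mul h₃ b c)
  one_mul : ∀ {p : ℤ} (a : K.X p), mul (zero_add p) one a = a
  mul_comm : ∀ {p q r : ℤ} (h : p + q = r) (h' : q + p = r) (a : K.X p) (b : K.X q),
    mul h a b = (p * q).negOnePow • mul h' b a
  d_one : (K.d 0 1).hom one = 0
  d_mul : ∀ {p q p' q' r s : ℤ} (h : p + q = r) (_ : p + 1 = p') (_ : q + 1 = q')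
    (h₁ : p' + q = s) (h₂ : p + q' = s) (a : K.X p) (b : K.X q),
    (K.d r s).hom (mul h a b) =
      mul h₁ ((K.d p p').hom a) b + p.negOnePow • mul h₂ a ((K.d q q').hom b)

/-- Morphisms of commutative differential graded algebras. -/
structure IsCDGAHom {K L : Dg k} (A : CDGA K) (B : CDGA L) (f : K ⟶ L) : Prop where
  map_one : (f.f 0).hom A.one = B.one
  map_mul : ∀ {p q r : ℤ} (h : p + q = r) (a : K.X p) (b : K.X q),
    (f.f r).hom (A.mul h a b) = B.mul h ((f.f p).hom a) ((f.f q).hom b)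

/-- A structure of presheaf of commutative differential graded algebras on a presheaf of complexes. -/
structure PreCDGA {C : Type w} [SmallCategory C] (P : Cᵒᵖ ⥤ Dg k) where
  /-- the algebra structure on sections -/
  alg : (U : Cᵒᵖ) → CDGA (P.obj U)
  map_isHom : ∀ {U V : Cᵒᵖ} (f : U ⟶ V), IsCDGAHom (alg U) (alg V) (P.map f)

/-- A sheaf of commutative differential graded `k`-algebras. -/
structure CDGASheaf (k : Type w) [Field k] {C : Type w} [SmallCategory C]
    (J : GrothendieckTopology C) where
  /-- the underlying sheaf of complexes -/
  sheaf : Sheaf J (Dg k)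
  /-- the algebra structure -/
  alg : PreCDGA sheaf.obj

/-- Morphisms of sheaves of commutative differential graded algebras. -/
def IsCDGASheafHom {C : Type w} [SmallCategory C] {J : GrothendieckTopology C}
    (F F' : CDGASheaf k J) (g : F.sheaf ⟶ F'.sheaf) : Prop :=
  ∀ U, IsCDGAHom (F.alg.alg U) (F'.alg.alg U) (g.hom.app U)

/-- A structure of cosimplicial commutative differential graded algebra on a cosimplicial complex. -/
structure CosCDGA (K : CosimplicialObject (Dg k)) where
  /-- the algebra structure in each cosimplicial degree -/
  alg : (n : SimplexCategory) → CDGA (K.obj n)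
  map_isHom : ∀ {m n : SimplexCategory} (f : m ⟶ n), IsCDGAHom (alg m) (alg n) (K.map f)

section
variable {C : Type w} [SmallCategory C] {J : GrothendieckTopology C}
  {S : Type w} (pt : S → GrothendieckTopology.Point.{w} J)

/-- The projection from the sections over `U` of `G F = ∏_s s_* F_s` to the stalk `F_s`, for every
element `u` of the fibre of the point `s` at `U`. -/
def godementProj (F : Sheaf J (Dg k)) (s : S) (U : C) (u : (pt s).fiber.obj U) :
    ((godement k pt).obj F).obj.obj (op U) ⟶ (pt s).presheafFiber.obj F.obj :=
  (skyscrapersπ k pt ((stalks k pt).obj F) s).hom.app (op U) ≫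
    Limits.Pi.π (fun _ : (pt s).fiber.obj U => (pt s).presheafFiber.obj F.obj) u

/-- `B` is the algebra structure on `G F` induced by the algebra structure `A` on `F`:
it is the product of skyscrapers of the algebra structures of the stalks of `F`, the latter being the
filtered colimits of the algebra structures of the sections of `F`. -/
def IsGodementAlg {F : Sheaf J (Dg k)} (A : PreCDGA F.obj)
    (B : PreCDGA ((godement k pt).obj F).obj) : Prop :=
  ∃ st : (s : S) → CDGA ((pt s).presheafFiber.obj F.obj),
    (∀ (s : S) (V : C) (v : (pt s).fiber.obj V),
      IsCDGAHom (A.alg (op V)) (st s) ((pt s).toPresheafFiber V v F.obj)) ∧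
    ∀ (s : S) (U : C) (u : (pt s).fiber.obj U),
      IsCDGAHom (B.alg (op U)) (st s) (godementProj pt F s U u)

/-- The structure of cosimplicial presheaf of commutative differential graded algebras on the
cosimplicial Godement resolution of `F` which is induced by the algebra structure of `F`. -/
structure GodementAlg (F : CDGASheaf k J) where
  /-- the algebra structures on the iterates `G^n F` -/
  iter : (n : ℕ) → PreCDGA ((monadIter (godement k pt) n).obj F.sheaf).obj
  iter_zero : iter 0 = F.alg
  iter_succ : ∀ n, IsGodementAlg pt (iter n) (iter (n + 1))
  map_isHom : ∀ {m n : SimplexCategory} (f : m ⟶ n) (U : Cᵒᵖ),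
    IsCDGAHom ((iter (m.len + 1)).alg U) ((iter (n.len + 1)).alg U)
      (((((godementCos k pt).obj F.sheaf).map f).hom.app U))

/-- The cosimplicial algebra of sections over `U`. -/
def GodementAlg.sections {F : CDGASheaf k J} (A : GodementAlg pt F) (U : Cᵒᵖ) :
    CosCDGA (godementSections k pt F.sheaf U) where
  alg n := (A.iter (n.len + 1)).alg U
  map_isHom f := A.map_isHom f U
end

end CDGA

section Flatten
variable {k : Type w} [Field k]

lemma exists_flatten {n : ℕ} {m : Fin n → ℕ} (M : Fin (∑ i, m i) → Type w)
    [∀ l, AddCommGroup (M l)] [∀ l, Module k (M l)] :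
    ∃ f : (PiTensorProduct k fun i => PiTensorProduct k fun j => M (finSigmaFinEquiv ⟨i, j⟩)) →ₗ[k]
        PiTensorProduct k M,
      ∀ x : (l : Fin (∑ i, m i)) → M l,
        f (PiTensorProduct.tprod k fun i => PiTensorProduct.tprod k fun j =>
          x (finSigmaFinEquiv ⟨i, j⟩)) = PiTensorProduct.tprod k x := by
  let _ : ∀ l, Module kᵐᵒᵖ (M l) := fun l => Module.compHom _ ((RingHom.id k).fromOpposite mul_comm)
  have : ∀ l, IsCentralScalar k (M l) := fun l => ⟨fun _ _ => rfl⟩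
  let g : (i : Fin n) → (PiTensorProduct k fun j => M (finSigmaFinEquiv ⟨i, j⟩)) →ₗ[k]
      PiTensorProduct k fun l => TrivSqZeroExt k (M l) := fun i =>
    PiTensorProduct.lift ((MultilinearMap.mkPiAlgebra k (Fin (m i)) _).compLinearMap fun j =>
      (PiTensorProduct.singleAlgHom (R := k) (A := fun l => TrivSqZeroExt k (M l))
        (finSigmaFinEquiv ⟨i, j⟩)).toLinearMap ∘ₗ TrivSqZeroExt.inrHom k (M (finSigmaFinEquiv ⟨i, j⟩)))
  refine ⟨PiTensorProduct.map (fun l => TrivSqZeroExt.sndHom k (M l)) ∘ₗ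
    PiTensorProduct.lift ((MultilinearMap.mkPiAlgebra k (Fin n) _).compLinearMap g), fun x => ?_⟩
  have h : ∏ i, ∏ j, PiTensorProduct.tprod k (Pi.mulSingle (finSigmaFinEquiv ⟨i, j⟩)
      (TrivSqZeroExt.inr (R := k) (x (finSigmaFinEquiv ⟨i, j⟩)))) =
      PiTensorProduct.tprod k (fun l => TrivSqZeroExt.inr (R := k) (x l)) := by
    rw [← Fintype.prod_sigma', Fintype.prod_equiv finSigmaFinEquiv _
      (fun l => PiTensorProduct.tprod k (Pi.mulSingle l (TrivSqZeroExt.inr (R := k) (x l))))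
      (fun _ => rfl), ← PiTensorProduct.tprod_prod, Finset.univ_prod_mulSingle]
  simp only [LinearMap.comp_apply, PiTensorProduct.lift.tprod, MultilinearMap.compLinearMap_apply,
    MultilinearMap.mkPiAlgebra_apply, g]
  refine (congrArg _ h).trans ?_
  simp

/-- The canonical map `⨂_i ⨂_j M_{ij} → ⨂_{(i,j)} M_{ij}`. -/
def flatten {n : ℕ} {m : Fin n → ℕ} (M : Fin (∑ i, m i) → Type w)
    [∀ l, AddCommGroup (M l)] [∀ l, Module k (M l)] :
    (PiTensorProduct k fun i => PiTensorProduct k fun j => M (finSigmaFinEquiv ⟨i, j⟩)) →ₗ[k]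
        PiTensorProduct k M :=
  (exists_flatten M).choose

lemma flatten_tprod {n : ℕ} {m : Fin n → ℕ} (M : Fin (∑ i, m i) → Type w)
    [∀ l, AddCommGroup (M l)] [∀ l, Module k (M l)] (x : (l : Fin (∑ i, m i)) → M l) :
    flatten (k := k) M (PiTensorProduct.tprod k fun i => PiTensorProduct.tprod k fun j =>
      x (finSigmaFinEquiv ⟨i, j⟩)) = PiTensorProduct.tprod k x :=
  (exists_flatten M).choose_spec x

lemma flatten_naturality {n : ℕ} {m : Fin n → ℕ} (M M' : Fin (∑ i, m i) → Type w)
    [∀ l, AddCommGroup (M l)] [∀ l, Module k (M l)]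
    [∀ l, AddCommGroup (M' l)] [∀ l, Module k (M' l)] (f : (l : Fin (∑ i, m i)) → M l →ₗ[k] M' l) :
    PiTensorProduct.map f ∘ₗ flatten M = flatten M' ∘ₗ
      PiTensorProduct.map (fun i => PiTensorProduct.map fun j => f (finSigmaFinEquiv ⟨i, j⟩)) := by
  refine PiTensorProduct.ext_of_span_eq_top
    (g := fun i (y : (j : Fin (m i)) → M (finSigmaFinEquiv ⟨i, j⟩)) => PiTensorProduct.tprod k y)
    (fun i => PiTensorProduct.span_tprod_eq_top) fun y => ?_
  obtain ⟨x, hx⟩ : ∃ x : (l : Fin (∑ i, m i)) → M l,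
      y = fun i j => x (finSigmaFinEquiv ⟨i, j⟩) :=
    ⟨finSigmaFinEquiv.piCongrLeft M (fun s => y s.1 s.2), by
      funext i j
      exact (Equiv.piCongrLeft_apply_apply M finSigmaFinEquiv (fun s => y s.1 s.2) ⟨i, j⟩).symm⟩
  subst hx
  simp only [LinearMap.comp_apply, PiTensorProduct.map_tprod]
  rw [flatten_tprod, PiTensorProduct.map_tprod]
  exact (flatten_tprod M' (fun l => f l (x l))).symm
end Flatten

section MultiOp
variable {k : Type w} [Field k]

/-- The homogeneous multilinear operations `K_1, …, K_n → L` of degree `r` between complexes, i.e.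
the degree `r` elements of the complex `Hom(K_1 ⊗ … ⊗ K_n, L)`. -/
abbrev MultiOp {n : ℕ} (K : Fin n → Dg k) (L : Dg k) (r : ℤ) : Type w :=
  (d : Fin n → ℤ) → (e : {e : ℤ // ∑ i, d i + r = e}) →
    MultilinearMap k (fun i => (K i).X (d i)) (L.X e.1)

namespace MultiOp

/-- Postcomposition with a morphism of complexes. -/
def post {n : ℕ} {K : Fin n → Dg k} {L L' : Dg k} {r : ℤ} (g : L ⟶ L') (φ : MultiOp K L r) :
    MultiOp K L' r :=
  fun d e => (g.f e.1).hom.compMultilinearMap (φ d e)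

/-- Precomposition with morphisms of complexes. -/
def pre {n : ℕ} {K K' : Fin n → Dg k} {L : Dg k} {r : ℤ} (φ : MultiOp K' L r)
    (f : (i : Fin n) → (K i ⟶ K' i)) : MultiOp K L r :=
  fun d e => (φ d e).compLinearMap fun i => ((f i).f (d i)).hom

/-- Increase the `i`-th degree by one. -/
def stepDeg {n : ℕ} (d : Fin n → ℤ) (i : Fin n) : Fin n → ℤ := d + Pi.single i 1

lemma sum_stepDeg {n : ℕ} (d : Fin n → ℤ) (i : Fin n) : ∑ l, stepDeg d i l = ∑ l, d l + 1 := by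
  simp [stepDeg, Finset.sum_add_distrib]

/-- The operation `(x_1, …, x_n) ↦ φ(…, d x_i, …)`. -/
def bdTerm {n : ℕ} {K : Fin n → Dg k} {L : Dg k} {r : ℤ} (φ : MultiOp K L r) (d : Fin n → ℤ)
    (e : {e : ℤ // ∑ i, d i + (r + 1) = e}) (i : Fin n) :
    MultilinearMap k (fun i => (K i).X (d i)) (L.X e.1) :=
  (φ (stepDeg d i) ⟨e.1, by rw [sum_stepDeg]; have := e.2; omega⟩).compLinearMap
    fun l => if l = i then ((K l).d (d l) (stepDeg d i l)).hom
      else idMap (K l) (d l) (stepDeg d i l)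

/-- The differential of the complex of multilinear operations:
`(∂φ)(x_1, …, x_n) = d(φ(x_1, …, x_n)) - (-1)^r ∑_i (-1)^(|x_1| + … + |x_{i-1}|) φ(…, d x_i, …)`. -/
def bd {n : ℕ} {K : Fin n → Dg k} {L : Dg k} {r : ℤ} (φ : MultiOp K L r) : MultiOp K L (r + 1) :=
  fun d e => (L.d (∑ i, d i + r) e.1).hom.compMultilinearMap (φ d ⟨_, rfl⟩) -
    r.negOnePow • ∑ i, (∑ l ∈ Finset.Iio i, d l).negOnePow • bdTerm φ d e i

/-- The sign obtained by permuting elements of degrees `d_i` by `σ`. -/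
def koszulSign {n : ℕ} (σ : Equiv.Perm (Fin n)) (d : Fin n → ℤ) : ℤˣ :=
  ∏ i, ∏ j ∈ Finset.Ioi i, if σ j < σ i then (d i * d j).negOnePow else 1

/-- The action of permutations on operations:
`(φσ)(x_1, …, x_n) = ± φ(x_{σ⁻¹(1)}, …, x_{σ⁻¹(n)})`, with the Koszul sign. -/
def perm {n : ℕ} {K : Fin n → Dg k} {L : Dg k} {r : ℤ} (σ : Equiv.Perm (Fin n))
    (φ : MultiOp (fun i => K (σ.symm i)) L r) : MultiOp K L r :=
  fun d e => koszulSign σ d •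
    (MultilinearMap.domDomCongrLinearEquiv' k k (fun i => (K i).X (d i)) (L.X e.1) σ).symm
      (φ (fun i => d (σ.symm i)) ⟨e.1, by rw [Equiv.sum_comp σ.symm d]; exact e.2⟩)

/-- The identity operation. -/
def one (K : Fin 1 → Dg k) : MultiOp K (K 0) 0 :=
  fun d e =>
    { toFun := fun x => idMap (K 0) (d 0) e.1 (x 0)
      map_update_add' := fun x i a b => by
        obtain rfl := Subsingleton.elim i 0
        simp
      map_update_smul' := fun x i c a => by
        obtain rfl := Subsingleton.elim i 0
        simp }

lemma sum_sigma {n : ℕ} {m : Fin n → ℕ} (d : Fin (∑ i, m i) → ℤ) :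
    ∑ i, ∑ j, d (finSigmaFinEquiv ⟨i, j⟩) = ∑ l, d l := by
  rw [← Fintype.sum_sigma', Fintype.sum_equiv finSigmaFinEquiv _ d (fun _ => rfl)]

/-- The composition of multilinear operations:
`γ(φ; ψ_1, …, ψ_n)(x_1, …, x_n) = ± φ(ψ_1(x_1), …, ψ_n(x_n))` for strings `x_i` of `m_i` elements,
with the sign obtained by moving `ψ_j` past the strings `x_i` for `i < j`. -/
def comp {n : ℕ} {m : Fin n → ℕ} {K : Fin (∑ i, m i) → Dg k} {L : Fin n → Dg k} {M : Dg k} {r : ℤ}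
    {s : Fin n → ℤ} (φ : MultiOp L M r)
    (ψ : (i : Fin n) → MultiOp (fun j => K (finSigmaFinEquiv ⟨i, j⟩)) (L i) (s i)) :
    MultiOp K M (r + ∑ i, s i) :=
  fun d e => (∑ j, ∑ i ∈ Finset.Iio j, s j * ∑ l, d (finSigmaFinEquiv ⟨i, l⟩)).negOnePow •
    (MultilinearMap.domDomCongrLinearEquiv' k k (fun l => (K l).X (d l)) (M.X e.1)
      finSigmaFinEquiv.symm).symm
      ((φ (fun i => ∑ j, d (finSigmaFinEquiv ⟨i, j⟩) + s i) ⟨e.1, by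
          rw [Finset.sum_add_distrib, sum_sigma]
          have := e.2
          omega⟩).compMultilinearMap
        fun i => ψ i (fun j => d (finSigmaFinEquiv ⟨i, j⟩)) ⟨_, rfl⟩)

lemma post_add {n : ℕ} {K : Fin n → Dg k} {L L' : Dg k} {r : ℤ} (g : L ⟶ L')
    (φ ψ : MultiOp K L r) : post g (φ + ψ) = post g φ + post g ψ := by
  funext d e; ext x; simp [post]

lemma post_smul {n : ℕ} {K : Fin n → Dg k} {L L' : Dg k} {r : ℤ} (g : L ⟶ L') (c : k)
    (φ : MultiOp K L r) : post g (c • φ) = c • post g φ := by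
  funext d e; ext x; simp [post]

lemma post_post {n : ℕ} {K : Fin n → Dg k} {L L' L'' : Dg k} {r : ℤ} (g : L ⟶ L') (g' : L' ⟶ L'')
    (φ : MultiOp K L r) : post g' (post g φ) = post (g ≫ g') φ := by
  funext d e; ext x; simp [post]

lemma post_pre {n : ℕ} {K K' : Fin n → Dg k} {L L' : Dg k} {r : ℤ} (g : L ⟶ L')
    (φ : MultiOp K' L r) (f : (i : Fin n) → (K i ⟶ K' i)) :
    post g (pre φ f) = pre (post g φ) f := rfl

lemma post_bd {n : ℕ} {K : Fin n → Dg k} {L L' : Dg k} {r : ℤ} (g : L ⟶ L')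
    (φ : MultiOp K L r) : post g (bd φ) = bd (post g φ) := by
  funext d e
  ext x
  have h : ∀ i j (y : L.X i), (g.f j).hom ((L.d i j).hom y) = (L'.d i j).hom ((g.f i).hom y) :=
    fun i j y => (ConcreteCategory.congr_hom (g.comm i j) y).symm
  have h' : ∀ i, (g.f e.1).hom (bdTerm φ d e i x) = bdTerm (post g φ) d e i x := fun i => rfl
  change (g.f e.1).hom (bd φ d e x) = bd (post g φ) d e x
  simp only [bd, Units.smul_def, sub_apply, smul_apply,
    sum_apply, map_sub, map_zsmul, map_sum, h', LinearMap.compMultilinearMap_apply,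
    h]
  rfl

lemma idMap_naturality {K K' : Dg k} (f : K ⟶ K') (p q : ℤ) (x : K.X p) :
    idMap K' p q ((f.f p).hom x) = (f.f q).hom (idMap K p q x) := by
  by_cases h : p = q
  · subst h; rw [idMap_self, idMap_self]
  · simp [idMap, h]

lemma pre_bd {n : ℕ} {K K' : Fin n → Dg k} {L : Dg k} {r : ℤ}
    (φ : MultiOp K' L r) (f : (i : Fin n) → (K i ⟶ K' i)) : pre (bd φ) f = bd (pre φ f) := by
  funext d e
  ext x
  have h : ∀ i, bdTerm φ d e i (fun l => ((f l).f (d l)).hom (x l)) = bdTerm (pre φ f) d e i x := by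
    intro i
    simp only [bdTerm, pre, MultilinearMap.compLinearMap_apply]
    refine congrArg _ (funext fun l => ?_)
    split_ifs
    · exact ConcreteCategory.congr_hom ((f l).comm _ _) (x l)
    · exact idMap_naturality _ _ _ _
  simp [pre, bd, Units.smul_def] at h ⊢
  simp [h]

lemma post_perm {n : ℕ} {K : Fin n → Dg k} {L L' : Dg k} {r : ℤ} (g : L ⟶ L')
    (σ : Equiv.Perm (Fin n)) (φ : MultiOp (fun i => K (σ.symm i)) L r) :
    post g (perm σ φ) = perm σ (post g φ) := by
  funext d e
  ext x
  simp [post, perm, Units.smul_def, MultilinearMap.domDomCongrLinearEquiv']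

lemma pre_perm {n : ℕ} {K K' : Fin n → Dg k} {L : Dg k} {r : ℤ} (σ : Equiv.Perm (Fin n))
    (φ : MultiOp (fun i => K' (σ.symm i)) L r) (f : (i : Fin n) → (K i ⟶ K' i)) :
    pre (perm σ φ) f = perm σ (pre φ (fun i => f (σ.symm i))) := rfl

lemma post_one (K K' : Fin 1 → Dg k) (f : (i : Fin 1) → (K i ⟶ K' i)) :
    post (f 0) (one K) = pre (one K') f := by
  funext d e
  ext x
  exact (idMap_naturality (f 0) _ _ _).symm

lemma post_comp {n : ℕ} {m : Fin n → ℕ} {K : Fin (∑ i, m i) → Dg k} {L : Fin n → Dg k}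
    {M M' : Dg k} {r : ℤ} {s : Fin n → ℤ} (g : M ⟶ M') (φ : MultiOp L M r)
    (ψ : (i : Fin n) → MultiOp (fun j => K (finSigmaFinEquiv ⟨i, j⟩)) (L i) (s i)) :
    post g (comp φ ψ) = comp (post g φ) ψ := by
  funext d e
  ext x
  simp [post, comp, Units.smul_def, MultilinearMap.domDomCongrLinearEquiv',
    MultilinearMap.compMultilinearMap]

lemma pre_comp {n : ℕ} {m : Fin n → ℕ} {K K' : Fin (∑ i, m i) → Dg k} {L : Fin n → Dg k}
    {M : Dg k} {r : ℤ} {s : Fin n → ℤ} (φ : MultiOp L M r)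
    (ψ : (i : Fin n) → MultiOp (fun j => K' (finSigmaFinEquiv ⟨i, j⟩)) (L i) (s i))
    (f : (l : Fin (∑ i, m i)) → (K l ⟶ K' l)) :
    pre (comp φ ψ) f = comp φ (fun i => pre (ψ i) (fun j => f (finSigmaFinEquiv ⟨i, j⟩))) := by
  rfl

lemma comp_pre {n : ℕ} {m : Fin n → ℕ} {K : Fin (∑ i, m i) → Dg k} {L L' : Fin n → Dg k}
    {M : Dg k} {r : ℤ} {s : Fin n → ℤ} (φ : MultiOp L' M r) (g : (i : Fin n) → (L i ⟶ L' i))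
    (ψ : (i : Fin n) → MultiOp (fun j => K (finSigmaFinEquiv ⟨i, j⟩)) (L i) (s i)) :
    comp (pre φ g) ψ = comp φ (fun i => post (g i) (ψ i)) := by
  rfl
end MultiOp

end MultiOp

section EZ
variable {k : Type w} [Field k]

/-- The tensor product of a finite family of modules. -/
abbrev tObj {n : ℕ} (M : Fin n → ModuleCat.{w} k) : ModuleCat.{w} k :=
  ModuleCat.of k (PiTensorProduct k fun i => M i)

/-- The functoriality of the tensor product. -/
def tMap {n : ℕ} {M N : Fin n → ModuleCat.{w} k} (f : (i : Fin n) → (M i ⟶ N i)) :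
    tObj M ⟶ tObj N :=
  ModuleCat.ofHom (PiTensorProduct.map fun i => (f i).hom)

lemma tObj_hom_ext {n : ℕ} {M : Fin n → ModuleCat.{w} k} {N : ModuleCat.{w} k} {f g : tObj M ⟶ N}
    (h : ∀ x : (i : Fin n) → M i,
      f.hom (PiTensorProduct.tprod k x) = g.hom (PiTensorProduct.tprod k x)) : f = g :=
  ModuleCat.hom_ext (PiTensorProduct.ext (MultilinearMap.ext h))

lemma tMap_tprod {n : ℕ} {M N : Fin n → ModuleCat.{w} k} (f : (i : Fin n) → (M i ⟶ N i))
    (x : (i : Fin n) → M i) :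
    (tMap f).hom (PiTensorProduct.tprod k x) = PiTensorProduct.tprod k fun i => (f i).hom (x i) :=
  PiTensorProduct.map_tprod _ _

lemma tMap_id {n : ℕ} (M : Fin n → ModuleCat.{w} k) : tMap (fun i => 𝟙 (M i)) = 𝟙 (tObj M) :=
  tObj_hom_ext fun x => tMap_tprod _ x

lemma tMap_comp {n : ℕ} {M N P : Fin n → ModuleCat.{w} k} (f : (i : Fin n) → (M i ⟶ N i))
    (g : (i : Fin n) → (N i ⟶ P i)) : tMap (fun i => f i ≫ g i) = tMap f ≫ tMap g :=
  tObj_hom_ext fun x => (tMap_tprod _ x).trans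
    ((congrArg (tMap g).hom (tMap_tprod f x)).trans (tMap_tprod g _)).symm

/-- The levelwise tensor product of cosimplicial modules. -/
def tensorCos {n : ℕ} (A : Fin n → CosimplicialObject (ModuleCat.{w} k)) :
    CosimplicialObject (ModuleCat.{w} k) where
  obj c := tObj fun i => (A i).obj c
  map f := tMap fun i => (A i).map f
  map_id c := by
    refine Eq.trans (congrArg tMap (funext fun i => ?_)) (tMap_id _)
    exact (A i).map_id c
  map_comp f g := by
    refine Eq.trans (congrArg tMap (funext fun i => ?_)) (tMap_comp _ _)
    exact (A i).map_comp f g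

/-- The functoriality of the levelwise tensor product. -/
def tensorCosMap {n : ℕ} {A B : Fin n → CosimplicialObject (ModuleCat.{w} k)}
    (f : (i : Fin n) → (A i ⟶ B i)) : tensorCos A ⟶ tensorCos B where
  app c := tMap fun i => (f i).app c
  naturality c c' g := by
    refine (tMap_comp _ _).symm.trans (Eq.trans ?_ (tMap_comp _ _))
    exact congrArg tMap (funext fun i => (f i).naturality g)

/-- The symmetry of the tensor product. -/
def tPerm {n : ℕ} (M : Fin n → ModuleCat.{w} k) (σ : Equiv.Perm (Fin n)) :
    tObj (fun i => M (σ.symm i)) ⟶ tObj M :=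
  ModuleCat.ofHom (PiTensorProduct.reindex k (fun i => M i) σ).symm.toLinearMap

lemma tPerm_naturality {n : ℕ} {M N : Fin n → ModuleCat.{w} k} (f : (i : Fin n) → (M i ⟶ N i))
    (σ : Equiv.Perm (Fin n)) : tMap (fun i => f (σ.symm i)) ≫ tPerm N σ = tPerm M σ ≫ tMap f :=
  ModuleCat.hom_ext (PiTensorProduct.map_comp_reindex_symm (fun i => (f i).hom) σ).symm

/-- The associativity of the tensor product. -/
def tFlatten {n : ℕ} {m : Fin n → ℕ} (M : Fin (∑ i, m i) → ModuleCat.{w} k) :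
    tObj (fun i => tObj fun j => M (finSigmaFinEquiv ⟨i, j⟩)) ⟶ tObj M :=
  ModuleCat.ofHom
    { toFun := flatten (k := k) fun l => M l
      map_add' := map_add (flatten (k := k) fun l => M l)
      map_smul' := map_smul (flatten (k := k) fun l => M l) }

lemma tFlatten_naturality {n : ℕ} {m : Fin n → ℕ} {M N : Fin (∑ i, m i) → ModuleCat.{w} k}
    (f : (l : Fin (∑ i, m i)) → (M l ⟶ N l)) :
    tMap (fun i => tMap fun j => f (finSigmaFinEquiv ⟨i, j⟩)) ≫ tFlatten N =
      tFlatten M ≫ tMap f :=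
  ModuleCat.hom_ext (LinearMap.ext fun x =>
    LinearMap.congr_fun (flatten_naturality _ _ fun l => (f l).hom).symm x)

/-- The identification of a module with the tensor product of a family with one member. -/
def tOne (M : Fin 1 → ModuleCat.{w} k) : M 0 ⟶ tObj M :=
  ModuleCat.ofHom (PiTensorProduct.subsingletonEquiv (R := k) (s := fun i => M i) 0).symm.toLinearMap

lemma tOne_naturality {M N : Fin 1 → ModuleCat.{w} k} (f : (i : Fin 1) → (M i ⟶ N i)) :
    f 0 ≫ tOne N = tOne M ≫ tMap f := by
  ext x
  change PiTensorProduct.tprod k _ = (tMap f).hom (PiTensorProduct.tprod k _)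
  rw [tMap_tprod]
  congr 1
  funext i
  obtain rfl := Subsingleton.elim i 0
  simp
  rfl

/-- The symmetry of the levelwise tensor product. -/
def tensorCosPerm {n : ℕ} (A : Fin n → CosimplicialObject (ModuleCat.{w} k))
    (σ : Equiv.Perm (Fin n)) : tensorCos (fun i => A (σ.symm i)) ⟶ tensorCos A where
  app c := tPerm (fun i => (A i).obj c) σ
  naturality _ _ g := tPerm_naturality (fun i => (A i).map g) σ

/-- The associativity of the levelwise tensor product. -/
def tensorCosFlatten {n : ℕ} {m : Fin n → ℕ}
    (A : Fin (∑ i, m i) → CosimplicialObject (ModuleCat.{w} k)) :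
    tensorCos (fun i => tensorCos fun j => A (finSigmaFinEquiv ⟨i, j⟩)) ⟶ tensorCos A where
  app c := tFlatten fun l => (A l).obj c
  naturality _ _ g := tFlatten_naturality fun l => (A l).map g

/-- The identification of a cosimplicial module with the tensor product of a family with one
member. -/
def tensorCosOne (A : Fin 1 → CosimplicialObject (ModuleCat.{w} k)) : A 0 ⟶ tensorCos A where
  app c := tOne fun i => (A i).obj c
  naturality _ _ g := tOne_naturality fun i => (A i).map g

variable (k) in
/-- The families of operations `N(A_1), …, N(A_n) → N(A_1 ⊗ … ⊗ A_n)` of degree `r`. -/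
abbrev EZFam (n : ℕ) (r : ℤ) : Type (w + 1) :=
  (A : Fin n → CosimplicialObject (ModuleCat.{w} k)) →
    MultiOp (fun i => normCplx.obj (A i)) (normCplx.obj (tensorCos A)) r

variable (k) in
/-- The degree `r` part of the `n`-th term of the Eilenberg–Zilber operad: the module of natural
transformations `N(A_1) ⊗ … ⊗ N(A_n) → N(A_1 ⊗ … ⊗ A_n)` of degree `r`
between functors of cosimplicial `k`-modules `A_1, …, A_n`. -/
def EZ (n : ℕ) (r : ℤ) : Submodule k (EZFam k n r) where
  carrier := {z | ∀ (A B : Fin n → CosimplicialObject (ModuleCat.{w} k))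
    (f : (i : Fin n) → (A i ⟶ B i)),
    MultiOp.post (normCplx.map (tensorCosMap f)) (z A) =
      MultiOp.pre (z B) (fun i => normCplx.map (f i))}
  add_mem' := by
    intro z z' hz hz' A B f
    change MultiOp.post _ (z A + z' A) = _
    rw [MultiOp.post_add, hz A B f, hz' A B f]
    rfl
  zero_mem' := by
    intro A B f
    funext d e
    ext x
    exact map_zero ((normCplx.map (tensorCosMap f)).f e.1).hom
  smul_mem' := by
    intro c z hz A B f
    change MultiOp.post _ (c • z A) = _
    rw [MultiOp.post_smul, hz A B f]
    rfl

namespace EZ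

/-- The differential of the Eilenberg–Zilber operad. -/
def bd {n : ℕ} {r : ℤ} (z : EZ k n r) : EZ k n (r + 1) :=
  ⟨fun A => MultiOp.bd (z.1 A), fun A B f => by
    rw [MultiOp.post_bd, z.2 A B f, MultiOp.pre_bd]⟩

/-- The action of the symmetric groups on the Eilenberg–Zilber operad. -/
def perm {n : ℕ} {r : ℤ} (σ : Equiv.Perm (Fin n)) (z : EZ k n r) : EZ k n r :=
  ⟨fun A => MultiOp.perm (K := fun i => normCplx.obj (A i)) σ
      (MultiOp.post (normCplx.map (tensorCosPerm A σ)) (z.1 fun i => A (σ.symm i))), fun A B f => by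
    have h : tensorCosPerm A σ ≫ tensorCosMap f =
        tensorCosMap (fun i => f (σ.symm i)) ≫ tensorCosPerm B σ := by
      apply NatTrans.ext; funext c
      exact (tPerm_naturality (fun i => (f i).app c) σ).symm
    rw [MultiOp.post_perm, MultiOp.post_post, ← Functor.map_comp, h, Functor.map_comp,
      ← MultiOp.post_post, z.2, MultiOp.pre_perm, MultiOp.post_pre]⟩

/-- The composition of the Eilenberg–Zilber operad. -/
def comp {n : ℕ} {m : Fin n → ℕ} {r : ℤ} {s : Fin n → ℤ} (z : EZ k n r)
    (y : (i : Fin n) → EZ k (m i) (s i)) : EZ k (∑ i, m i) (r + ∑ i, s i) :=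
  ⟨fun A => MultiOp.comp (K := fun l => normCplx.obj (A l))
      (MultiOp.post (normCplx.map (tensorCosFlatten A))
        (z.1 fun i => tensorCos fun j => A (finSigmaFinEquiv ⟨i, j⟩)))
      (fun i => (y i).1 fun j => A (finSigmaFinEquiv ⟨i, j⟩)), fun A B f => by
    have h : tensorCosFlatten A ≫ tensorCosMap f =
        tensorCosMap (fun i => tensorCosMap fun j => f (finSigmaFinEquiv ⟨i, j⟩)) ≫
          tensorCosFlatten B := by
      apply NatTrans.ext; funext c
      exact (tFlatten_naturality fun l => (f l).app c).symm
    rw [MultiOp.post_comp, MultiOp.post_post, ← Functor.map_comp, h, Functor.map_comp,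
      ← MultiOp.post_post, z.2, MultiOp.pre_comp, MultiOp.post_pre, MultiOp.comp_pre]
    congr 1
    funext i
    exact (y i).2 _ _ _⟩

variable (k) in
/-- The unit of the Eilenberg–Zilber operad. -/
def one : EZ k 1 0 :=
  ⟨fun A => MultiOp.post (normCplx.map (tensorCosOne A))
    (MultiOp.one (fun i => normCplx.obj (A i))), fun A B f => by
    have h : tensorCosOne A ≫ tensorCosMap f = f 0 ≫ tensorCosOne B := by
      apply NatTrans.ext; funext c
      exact (tOne_naturality fun i => (f i).app c).symm
    rw [MultiOp.post_post, ← Functor.map_comp, h, Functor.map_comp,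
      ← MultiOp.post_post]
    exact congrArg _ (MultiOp.post_one _ _ (fun i => normCplx.map (f i)))⟩

end EZ

/-- The family `act` of linear maps from the terms of the Eilenberg–Zilber operad to the multilinear
operations on the complex `M` is a morphism of operads to the endomorphism operad of `M`, i.e. it makes
`M` an algebra over the Eilenberg–Zilber operad. -/
structure IsEZAlgebra (M : Dg k)
    (act : (n : ℕ) → (r : ℤ) → (EZ k n r →ₗ[k] MultiOp (fun _ : Fin n => M) M r)) : Prop where
  act_bd : ∀ (n : ℕ) (r : ℤ) (z : EZ k n r), act n (r + 1) (EZ.bd z) = MultiOp.bd (act n r z)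
  act_perm : ∀ (n : ℕ) (r : ℤ) (σ : Equiv.Perm (Fin n)) (z : EZ k n r),
    act n r (EZ.perm σ z) = MultiOp.perm σ (act n r z)
  act_comp : ∀ (n : ℕ) (m : Fin n → ℕ) (r : ℤ) (s : Fin n → ℤ) (z : EZ k n r)
    (y : (i : Fin n) → EZ k (m i) (s i)),
    act (∑ i, m i) (r + ∑ i, s i) (EZ.comp z y) =
      MultiOp.comp (act n r z) (fun i => act (m i) (s i) (y i))
  act_one : act 1 0 (EZ.one k) = MultiOp.one _

end EZ

section HS
variable {k : Type w} [Field k]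

/-- Left multiplication, as a family of multilinear maps depending linearly on the left factor. -/
def consMul {n : ℕ} {M : Fin n → Type w} [∀ i, AddCommGroup (M i)] [∀ i, Module k (M i)]
    {U V W : Type w} [AddCommGroup U] [Module k U] [AddCommGroup V] [Module k V]
    [AddCommGroup W] [Module k W] (b : U →ₗ[k] V →ₗ[k] W) (φ : MultilinearMap k M V) :
    U →ₗ[k] MultilinearMap k M W where
  toFun x := (b x).compMultilinearMap φ
  map_add' x y := by ext; simp
  map_smul' c x := by ext; simp

/-- The iterated product `(x_1, …, x_n) ↦ x_1 ⋯ x_n` of elements of degrees `q_1, …, q_n`. -/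
def CDGA.prod {K : Dg k} (A : CDGA K) : (n : ℕ) → (q : Fin n → ℤ) → (Q : ℤ) → ∑ i, q i = Q →
    MultilinearMap k (fun i => K.X (q i)) (K.X Q)
  | 0, _, Q, _ => MultilinearMap.constOfIsEmpty k _ (idMap K 0 Q A.one)
  | n + 1, q, Q, h =>
    LinearMap.uncurryLeft
      (consMul (A.mul (by rw [← h, Fin.sum_univ_succ])) (A.prod n (fun i => q i.succ) _ rfl))

lemma IsCDGAHom.map_prod {K L : Dg k} {A : CDGA K} {B : CDGA L} {f : K ⟶ L}
    (hf : IsCDGAHom A B f) : ∀ (n : ℕ) (q : Fin n → ℤ) (Q : ℤ) (h : ∑ i, q i = Q)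
    (x : (i : Fin n) → K.X (q i)),
    (f.f Q).hom (A.prod n q Q h x) = B.prod n q Q h (fun i => (f.f (q i)).hom (x i))
  | 0, q, Q, h, x => by
    change (f.f Q).hom (idMap K 0 Q A.one) = idMap L 0 Q B.one
    rw [← MultiOp.idMap_naturality, hf.map_one]
  | n + 1, q, Q, h, x => by
    refine (hf.map_mul _ _ _).trans ?_
    exact congrArg _ (hf.map_prod n _ _ _ _)

/-- The iterated product of a cosimplicial commutative differential graded algebra `K`, as a
morphism of cosimplicial modules `K^{•,q_1} ⊗ … ⊗ K^{•,q_n} → K^{•,Q}` for `q_1 + … + q_n = Q`. -/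
def CosCDGA.prod {K : CosimplicialObject (Dg k)} (A : CosCDGA K) {n : ℕ} (q : Fin n → ℤ) (Q : ℤ)
    (h : ∑ i, q i = Q) : tensorCos (fun i => row K (q i)) ⟶ row K Q where
  app c := ModuleCat.ofHom (PiTensorProduct.lift ((A.alg c).prod n q Q h))
  naturality c c' f := by
    refine tObj_hom_ext fun x => ?_
    have h1 := (A.map_isHom f).map_prod n q Q h x
    refine (congrArg (PiTensorProduct.lift ((A.alg c').prod n q Q h)) (tMap_tprod _ x)).trans ?_
    refine (PiTensorProduct.lift.tprod _).trans ?_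
    refine h1.symm.trans ?_
    exact congrArg ((K.map f).f Q).hom (PiTensorProduct.lift.tprod _).symm

/-- The operation `N(K^{•,q_1})^{p_1}, …, N(K^{•,q_n})^{p_n} → N(K^{•,Q})^P` with `q_i = d_i - p_i`,
`Q = ∑ q_i` and `P = ∑ p_i + r` obtained by applying `z` and then the iterated product. -/
def ezPiece {K : CosimplicialObject (Dg k)} (A : CosCDGA K) {n : ℕ} {r : ℤ} (z : EZ k n r)
    (d : Fin n → ℤ) (e : {e : ℤ // ∑ i, d i + r = e}) (s : Bideg e.1) (p : Fin n → ℕ)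
    (h : ∑ i, (p i : ℤ) + r = s.1.1) :
    MultilinearMap k (fun i => normSub (row K (d i - p i)) (p i)) (normSub (row K s.1.2) s.1.1) :=
  ((normCplx.map (A.prod (fun i => d i - p i) s.1.2 (by
          rw [Finset.sum_sub_distrib]
          have := e.2
          have := s.2
          omega))).f ((s.1.1 : ℕ) : ℤ)).hom.compMultilinearMap
      (z.1 (fun i => row K (d i - p i)) (fun i => (p i : ℤ)) ⟨((s.1.1 : ℕ) : ℤ), h⟩)

/-- The summand of `ezOp` attached to the horizontal degrees `p_1, …, p_n`, which includes the sign
obtained by moving the vertical degree of the `i`-th argument past the horizontal degree of the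
`j`-th one for `i < j`. -/
def ezTerm {K : CosimplicialObject (Dg k)} (A : CosCDGA K) {n : ℕ} {r : ℤ} (z : EZ k n r)
    (d : Fin n → ℤ) (e : {e : ℤ // ∑ i, d i + r = e}) (s : Bideg e.1) (p : Fin n → ℕ)
    (h : ∑ i, (p i : ℤ) + r = s.1.1) :
    MultilinearMap k (fun i => TotX K (d i)) (normSub (row K s.1.2) s.1.1) :=
  (∑ j, ∑ i ∈ Finset.Iio j, (d i - p i) * p j).negOnePow •
    (ezPiece A z d e s p h).compLinearMap fun i =>
      LinearMap.proj (R := k) (φ := fun s : Bideg (d i) => normSub (row K s.1.2) s.1.1)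
        ⟨(p i, d i - p i), by simp⟩

/-- The operation of degree `r` on the normalized total complex `N(K)` of a cosimplicial
commutative differential graded algebra `K` attached to an element `z` of degree `r` of the
Eilenberg–Zilber operad. -/
def ezOp {K : CosimplicialObject (Dg k)} (A : CosCDGA K) {n : ℕ} {r : ℤ} (z : EZ k n r) :
    MultiOp (fun _ : Fin n => totN.obj K) (totN.obj K) r :=
  fun d e => MultilinearMap.pi fun s : Bideg e.1 =>
    ∑ p ∈ Fintype.piFinset fun _ : Fin n => Finset.range ((s.1.1 - r).toNat + 1),
      if h : ∑ i, (p i : ℤ) + r = s.1.1 then ezTerm A z d e s p h else 0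

lemma ezPiece_add {K : CosimplicialObject (Dg k)} (A : CosCDGA K) {n : ℕ} {r : ℤ} (z z' : EZ k n r)
    (d : Fin n → ℤ) (e : {e : ℤ // ∑ i, d i + r = e}) (s : Bideg e.1) (p : Fin n → ℕ)
    (h : ∑ i, (p i : ℤ) + r = s.1.1) :
    ezPiece A (z + z') d e s p h = ezPiece A z d e s p h + ezPiece A z' d e s p h := by
  ext x : 1
  exact map_add ((normCplx.map (A.prod (fun i => d i - p i) s.1.2 _)).f ((s.1.1 : ℕ) : ℤ)).hom _ _

lemma ezPiece_smul {K : CosimplicialObject (Dg k)} (A : CosCDGA K) {n : ℕ} {r : ℤ} (c : k)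
    (z : EZ k n r) (d : Fin n → ℤ) (e : {e : ℤ // ∑ i, d i + r = e}) (s : Bideg e.1)
    (p : Fin n → ℕ) (h : ∑ i, (p i : ℤ) + r = s.1.1) :
    ezPiece A (c • z) d e s p h = c • ezPiece A z d e s p h := by
  ext x : 1
  exact map_smul ((normCplx.map (A.prod (fun i => d i - p i) s.1.2 _)).f ((s.1.1 : ℕ) : ℤ)).hom _ _

lemma unit_smul_comp_add {n : ℕ} {M M' : Fin n → Type w} [∀ i, AddCommGroup (M i)]
    [∀ i, Module k (M i)] [∀ i, AddCommGroup (M' i)] [∀ i, Module k (M' i)] {V : Type w}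
    [AddCommGroup V] [Module k V] (ε : ℤˣ) (φ φ' : MultilinearMap k M' V)
    (f : (i : Fin n) → M i →ₗ[k] M' i) :
    ε • (φ + φ').compLinearMap f = ε • φ.compLinearMap f + ε • φ'.compLinearMap f :=
  smul_add ε (φ.compLinearMap f) (φ'.compLinearMap f)

lemma unit_smul_comp_smul {n : ℕ} {M M' : Fin n → Type w} [∀ i, AddCommGroup (M i)]
    [∀ i, Module k (M i)] [∀ i, AddCommGroup (M' i)] [∀ i, Module k (M' i)] {V : Type w}
    [AddCommGroup V] [Module k V] (ε : ℤˣ) (c : k) (φ : MultilinearMap k M' V)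
    (f : (i : Fin n) → M i →ₗ[k] M' i) :
    ε • (c • φ).compLinearMap f = c • ε • φ.compLinearMap f :=
  smul_comm ε c (φ.compLinearMap f)

lemma ezTerm_add {K : CosimplicialObject (Dg k)} (A : CosCDGA K) {n : ℕ} {r : ℤ} (z z' : EZ k n r)
    (d : Fin n → ℤ) (e : {e : ℤ // ∑ i, d i + r = e}) (s : Bideg e.1) (p : Fin n → ℕ)
    (h : ∑ i, (p i : ℤ) + r = s.1.1) :
    ezTerm A (z + z') d e s p h = ezTerm A z d e s p h + ezTerm A z' d e s p h := by
  rw [ezTerm, ezTerm, ezTerm, ezPiece_add]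
  exact unit_smul_comp_add _ _ _ _

lemma ezTerm_smul {K : CosimplicialObject (Dg k)} (A : CosCDGA K) {n : ℕ} {r : ℤ} (c : k)
    (z : EZ k n r) (d : Fin n → ℤ) (e : {e : ℤ // ∑ i, d i + r = e}) (s : Bideg e.1)
    (p : Fin n → ℕ) (h : ∑ i, (p i : ℤ) + r = s.1.1) :
    ezTerm A (c • z) d e s p h = c • ezTerm A z d e s p h := by
  rw [ezTerm, ezTerm, ezPiece_smul]
  exact unit_smul_comp_smul _ _ _ _

/-- The action of the Eilenberg–Zilber operad on the normalized total complex of a cosimplicial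
commutative differential graded algebra. -/
def ezAct {K : CosimplicialObject (Dg k)} (A : CosCDGA K) (n : ℕ) (r : ℤ) :
    EZ k n r →ₗ[k] MultiOp (fun _ : Fin n => totN.obj K) (totN.obj K) r where
  toFun z := ezOp A z
  map_add' z z' := by
    funext d e
    ext x
    funext s
    have h : ∀ p, (if h : ∑ i, (p i : ℤ) + r = s.1.1 then ezTerm A (z + z') d e s p h else 0) =
        (if h : ∑ i, (p i : ℤ) + r = s.1.1 then ezTerm A z d e s p h else 0) +
        (if h : ∑ i, (p i : ℤ) + r = s.1.1 then ezTerm A z' d e s p h else 0) := fun p => by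
      split_ifs
      · exact ezTerm_add ..
      · exact (add_zero 0).symm
    change (∑ p ∈ _, if h : ∑ i, (p i : ℤ) + r = s.1.1 then ezTerm A (z + z') d e s p h else 0) x =
      (∑ p ∈ _, if h : ∑ i, (p i : ℤ) + r = s.1.1 then ezTerm A z d e s p h else 0) x +
      (∑ p ∈ _, if h : ∑ i, (p i : ℤ) + r = s.1.1 then ezTerm A z' d e s p h else 0) x
    rw [Finset.sum_congr rfl fun p _ => h p, Finset.sum_add_distrib]
    rfl
  map_smul' c z := by
    funext d e
    ext x
    funext s
    have h : ∀ p, (if h : ∑ i, (p i : ℤ) + r = s.1.1 then ezTerm A (c • z) d e s p h else 0) =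
        c • (if h : ∑ i, (p i : ℤ) + r = s.1.1 then ezTerm A z d e s p h else 0) := fun p => by
      split_ifs
      · exact ezTerm_smul ..
      · exact (smul_zero c).symm
    change (∑ p ∈ _, if h : ∑ i, (p i : ℤ) + r = s.1.1 then ezTerm A (c • z) d e s p h else 0) x =
      c • (∑ p ∈ _, if h : ∑ i, (p i : ℤ) + r = s.1.1 then ezTerm A z d e s p h else 0) x
    rw [Finset.sum_congr rfl fun p _ => h p, ← Finset.smul_sum]
    rfl

/-- Morphisms of algebras over the Eilenberg–Zilber operad. -/
def IsEZHom {M M' : Dg k}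
    (act : (n : ℕ) → (r : ℤ) → (EZ k n r →ₗ[k] MultiOp (fun _ : Fin n => M) M r))
    (act' : (n : ℕ) → (r : ℤ) → (EZ k n r →ₗ[k] MultiOp (fun _ : Fin n => M') M' r))
    (f : M ⟶ M') : Prop :=
  ∀ (n : ℕ) (r : ℤ) (z : EZ k n r),
    MultiOp.post f (act n r z) = MultiOp.pre (act' n r z) (fun _ => f)

end HS

end GodementEZ

end

open GodementEZ

noncomputable section

/-! The action. An element `z` of the operad is natural in cosimplicial modules, and the iterated
product of a cosimplicial commutative differential graded algebra `K` is a map of cosimplicial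
modules out of a levelwise tensor product of rows of `K`. So `z` can be applied to the rows and
followed by the product. The operad axioms then result from the naturality of `z` and from three
properties of iterated products: graded commutativity (`tensorCosPerm_prod`), associativity
(`tensorCosFlatten_prod`) and the Leibniz rule (`prod_rowD`). What remains is bookkeeping of signs
(`shuffleSign_mul_koszulSign`, `shuffleSign_flatten`, `shuffleSign_stepDeg_left`,
`shuffleSign_stepDeg_right`). The total complex is a product and not a sum, but all operations
involved are finitary, so that identities between them may be tested on bihomogeneous elements
(`IsFinitary.ext`), where `ezOp_totHom` gives the formula of the theorem.

The algebra structure on the Godement resolution. A stalk is a filtered colimit of algebras, hence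
an algebra; the sections of `G F` are, degree by degree, a product of stalks, hence an algebra too.
The unit and the multiplication of the monad, and `G` of an algebra morphism, are algebra morphisms,
because this can be tested on the projections to stalks. All cosimplicial structure maps are
composed of these (`isPreHom_monadMap`).

Derived global sections. Over a field, a product of skyscraper sheaves is injective, and
normalization is a natural direct summand, so the normalized resolution consists of injective
sheaves (`injective_sheafNG`). For bounded below `F` it is a resolution (`quasiIso_toSheafNG`): on
stalks the products in the total complex are finite and commute with the filtered colimit
(`isIso_stalkTotMap`), and the counit of the adjunction is an extra codegeneracy
(`extraCodegeneracy`) which contracts the coaugmented stalk complex. Hence its global sections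
compute the derived functor, and a terminal object turns global sections into sections over `X`. -/

namespace GodementEZ

/-! ### The graded ring underlying a commutative differential graded algebra -/

section GradedRing
variable {k : Type w} [Field k] {K : Dg k}

namespace CDGA
variable (A : CDGA K)

lemma mul_one' {p : ℤ} (a : K.X p) : A.mul (add_zero p) a A.one = a := by
  rw [A.mul_comm (add_zero p) (zero_add p), A.one_mul]
  simp

/-- In the disjoint union of all degrees the name of the target degree is irrelevant. This turns the
axioms of `CDGA`, stated with freely chosen degrees, into strict identities of a graded monoid. -/
lemma mk_mul {p q r : ℤ} (h : p + q = r) (a : K.X p) (b : K.X q) :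
    (GradedMonoid.mk (p + q) (A.mul rfl a b) : GradedMonoid fun q : ℤ => K.X q) =
      GradedMonoid.mk r (A.mul h a b) := by
  subst h; rfl

/-- The graded multiplication of a commutative differential graded algebra. -/
@[reducible] def gMul : GradedMonoid.GMul (fun q : ℤ => K.X q) := ⟨fun a b => A.mul rfl a b⟩

/-- The graded unit of a commutative differential graded algebra. -/
@[reducible] def gOne : GradedMonoid.GOne (fun q : ℤ => K.X q) := ⟨A.one⟩

/-- The graded monoid underlying a commutative differential graded algebra. -/
@[reducible] def gMonoid : GradedMonoid.GMonoid (fun q : ℤ => K.X q) :=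
  letI := A.gMul
  letI := A.gOne
  { one_mul := fun ⟨p, a⟩ => (A.mk_mul (zero_add p) A.one a).trans
      (congrArg (GradedMonoid.mk p) (A.one_mul a))
    mul_one := fun ⟨p, a⟩ => (A.mk_mul (add_zero p) a A.one).trans
      (congrArg (GradedMonoid.mk p) (A.mul_one' a))
    mul_assoc := fun ⟨p, a⟩ ⟨q, b⟩ ⟨r, c⟩ =>
      (A.mk_mul (add_assoc p q r) (A.mul rfl a b) c).trans
        (congrArg (GradedMonoid.mk _) (A.mul_assoc rfl _ rfl rfl a b c)) }

/-- The graded ring structure underlying a commutative differential graded algebra. -/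
@[reducible] def gRing : DirectSum.GRing (fun q : ℤ => K.X q) where
  __ := A.gMonoid
  mul_zero a := map_zero (A.mul rfl a)
  zero_mul {i j} b := LinearMap.congr_fun (map_zero (A.mul (rfl : i + j = _))) b
  mul_add a b c := map_add (A.mul rfl a) b c
  add_mul {i j} a b c := LinearMap.congr_fun (map_add (A.mul (rfl : i + j = _)) a b) c
  natCast n := n • A.one
  natCast_zero := zero_smul _ _
  natCast_succ n := (add_smul n 1 A.one).trans (congrArg _ (one_smul _ _))
  intCast n := n • A.one
  intCast_ofNat n := by simp
  intCast_negSucc_ofNat n := by simp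

/-- The direct sum of the terms of a commutative differential graded algebra. -/
def Sum (_ : CDGA K) : Type w := DirectSum ℤ fun q => K.X q

instance : Ring A.Sum :=
  letI := A.gRing
  inferInstanceAs (Ring (DirectSum ℤ fun q => K.X q))

/-- The inclusion of a term of a commutative differential graded algebra in the direct sum. -/
def ι (q : ℤ) : K.X q →+ A.Sum := DirectSum.of (fun q : ℤ => K.X q) q

/-- Identities between elements whose degrees agree only propositionally are proved in the ring
`A.Sum`, where transports along equalities of degrees disappear; injectivity brings them back to
`K`. -/
lemma ι_injective (q : ℤ) : Function.Injective (A.ι q) := DirectSum.of_injective q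

lemma ι_mul {p q r : ℤ} (h : p + q = r) (a : K.X p) (b : K.X q) :
    A.ι p a * A.ι q b = A.ι r (A.mul h a b) := by
  subst h
  let _ := A.gRing
  exact DirectSum.of_mul_of (A := fun q : ℤ => K.X q) a b

lemma ι_one : A.ι 0 A.one = 1 := rfl

lemma ι_idMap {p q : ℤ} (h : p = q) (a : K.X p) : A.ι q (idMap K p q a) = A.ι p a := by
  subst h; rw [idMap_self]

lemma sum_induction {P : A.Sum → Prop} (x : A.Sum) (zero : P 0) (of : ∀ q a, P (A.ι q a))
    (add : ∀ x y, P x → P y → P (x + y)) : P x :=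
  DirectSum.induction_on x zero of add

lemma ι_comm {p q : ℤ} (a : K.X p) (b : K.X q) :
    A.ι p a * A.ι q b = (((p * q).negOnePow : ℤˣ) : ℤ) • (A.ι q b * A.ι p a) := by
  rw [A.ι_mul rfl, A.ι_mul (add_comm q p), A.mul_comm rfl (add_comm q p), Units.smul_def, map_zsmul]

end CDGA

/-- The ordered product of a finite family. -/
def ordProd {R : Type*} [Monoid R] {n : ℕ} (f : Fin n → R) : R := (List.ofFn f).prod

lemma ordProd_succ {R : Type*} [Monoid R] {n : ℕ} (f : Fin (n + 1) → R) :
    ordProd f = f 0 * ordProd fun i => f i.succ := by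
  simp [ordProd, List.ofFn_succ]

lemma ordProd_castSucc {R : Type*} [Monoid R] {n : ℕ} (f : Fin (n + 1) → R) :
    ordProd f = ordProd (fun i : Fin n => f i.castSucc) * f (Fin.last n) := by
  rw [ordProd, List.ofFn_succ', List.concat_eq_append, List.prod_append]; simp [ordProd]

/-- The factors are values of a function on `ℕ`, so the length of the product may be rewritten along
`∑ m i = (∑ of all but the last) + last` without transporting the family. The last block is then
split off by induction. -/
lemma ordProd_sigma_aux {R : Type*} [Monoid R] (g : ℕ → R) : ∀ {n : ℕ} (m : Fin n → ℕ),
    ordProd (fun l : Fin (∑ i, m i) => g l) =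
      ordProd fun i => ordProd fun j : Fin (m i) => g (finSigmaFinEquiv ⟨i, j⟩ : Fin _)
  | 0, m => by
    have h : ∀ N (hN : N = 0), ordProd (fun l : Fin N => g l) = 1 := by
      rintro _ rfl; simp [ordProd]
    rw [h _ (by simp)]
    simp [ordProd]
  | n + 1, m => by
    have h : ∀ a b N (hN : N = a + b), ordProd (fun l : Fin N => g l) =
        ordProd (fun l : Fin a => g l) * ordProd fun l : Fin b => g (a + l) := by
      rintro a b _ rfl
      simp [ordProd, List.ofFn_add]
    rw [h _ _ _ (Fin.sum_univ_castSucc m), ordProd_castSucc, ordProd_sigma_aux g fun i => m i.castSucc]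
    simp only [finSigmaFinEquiv_apply]
    rfl

lemma ordProd_sigma {R : Type*} [Monoid R] {n : ℕ} {m : Fin n → ℕ} (f : Fin (∑ i, m i) → R) :
    ordProd f = ordProd fun i => ordProd fun j => f (finSigmaFinEquiv ⟨i, j⟩) := by
  obtain ⟨g, hg⟩ : ∃ g : ℕ → R, ∀ l : Fin (∑ i, m i), g l = f l :=
    ⟨fun l => if h : l < ∑ i, m i then f ⟨l, h⟩ else 1, fun l => by simp⟩
  obtain rfl : (fun l : Fin (∑ i, m i) => g l) = f := funext hg
  exact ordProd_sigma_aux g m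

namespace CDGA
variable (A : CDGA K)

/-- In the ring the recursive product becomes an ordinary ordered product; permuting, grouping and
differentiating factors are then computations in a ring. -/
lemma ι_prod : ∀ {n : ℕ} (q : Fin n → ℤ) (Q : ℤ) (h : ∑ i, q i = Q) (x : (i : Fin n) → K.X (q i)),
    A.ι Q (A.prod n q Q h x) = ordProd fun i => A.ι (q i) (x i)
  | 0, q, Q, h, x => by
    have h' : 0 = Q := by simpa using h
    change A.ι Q (idMap K 0 Q A.one) = _
    rw [A.ι_idMap h', ι_one]
    simp [ordProd]
  | n + 1, q, Q, h, x => by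
    rw [ordProd_succ, ← ι_prod (fun i : Fin n => q i.succ) _ rfl fun i => x i.succ,
      A.ι_mul (h := (Fin.sum_univ_succ q).symm.trans h)]
    rfl

end CDGA
end GradedRing

/-! ### Koszul signs and shuffle signs -/

section Signs

/-- Reindexing of a product over pairs of a symmetric function. -/
lemma prod_lt_symm_comp {M : Type*} [CommMonoid M] {n : ℕ} (σ : Equiv.Perm (Fin n))
    (F : Fin n → Fin n → M) (hF : ∀ i j, F i j = F j i) :
    ∏ i, ∏ j ∈ Finset.Ioi i, F (σ i) (σ j) = ∏ i, ∏ j ∈ Finset.Ioi i, F i j := by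
  rw [Finset.prod_sigma', Finset.prod_sigma']
  -- A pair `i < j` is sent to the pair of its images, put back in increasing order. The same recipe
  -- for the inverse permutation undoes this, and the symmetry of `F` makes the reordering harmless.
  have key : ∀ τ : Equiv.Perm (Fin n), ∀ x : (_ : Fin n) × Fin n,
      x ∈ Finset.univ.sigma (fun i : Fin n => Finset.Ioi i) →
      (if τ x.1 < τ x.2 then (⟨τ x.1, τ x.2⟩ : (_ : Fin n) × Fin n) else ⟨τ x.2, τ x.1⟩) ∈
        Finset.univ.sigma (fun i : Fin n => Finset.Ioi i) := by
    rintro τ ⟨i, j⟩ h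
    simp only [Finset.mem_sigma, Finset.mem_univ, Finset.mem_Ioi, true_and] at h ⊢
    split_ifs with h1
    · exact h1
    · exact lt_of_le_of_ne (not_lt.1 h1) fun e => h.ne (τ.injective e).symm
  have key2 : ∀ τ : Equiv.Perm (Fin n), ∀ x : (_ : Fin n) × Fin n,
      x ∈ Finset.univ.sigma (fun i : Fin n => Finset.Ioi i) →
      (fun y : (_ : Fin n) × Fin n => if τ.symm y.1 < τ.symm y.2 then
        (⟨τ.symm y.1, τ.symm y.2⟩ : (_ : Fin n) × Fin n) else ⟨τ.symm y.2, τ.symm y.1⟩)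
        (if τ x.1 < τ x.2 then (⟨τ x.1, τ x.2⟩ : (_ : Fin n) × Fin n) else ⟨τ x.2, τ x.1⟩) = x := by
    rintro τ ⟨i, j⟩ h
    simp only [Finset.mem_sigma, Finset.mem_univ, Finset.mem_Ioi, true_and] at h
    split_ifs with h1
    · simp [h]
    · simp [h.not_gt]
  refine Finset.prod_bij' _ _ (key σ) (key σ.symm) (key2 σ) (key2 σ.symm) ?_
  rintro ⟨i, j⟩ -
  dsimp only
  split_ifs
  · rfl
  · exact hF _ _

variable {n : ℕ}

/-- The factor of a pair in the Koszul sign. -/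
lemma koszulSign_mul (σ τ : Equiv.Perm (Fin n)) (d : Fin n → ℤ) :
    MultiOp.koszulSign (σ * τ) d =
      MultiOp.koszulSign τ d * MultiOp.koszulSign σ (fun i => d (τ.symm i)) := by
  -- Reindexed by `τ`, the factor of a pair `i < j` is present exactly if `σ` reverses the order of
  -- `τ i` and `τ j`. The pair is an inversion of `σ * τ` if exactly one of the two steps reverses
  -- it; if both do, the factor occurs twice on the right and squares to one.
  have e : MultiOp.koszulSign σ (fun i => d (τ.symm i)) = ∏ i, ∏ j ∈ Finset.Ioi i,
      if (σ (τ j) < σ (τ i)) = (τ i < τ j) then (d i * d j).negOnePow else 1 := by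
    rw [← prod_lt_symm_comp τ.symm]
    · refine Finset.prod_congr rfl fun i _ => Finset.prod_congr rfl fun j hj => ?_
      simp only [Finset.mem_Ioi] at hj
      simp [hj]
    · intro i j
      by_cases hij : i = j
      · subst hij; rfl
      · have h1 : σ (τ i) ≠ σ (τ j) := by simpa using hij
        have h2 : τ i ≠ τ j := by simpa using hij
        rw [mul_comm (d i)]
        congr 1
        simp only [eq_iff_iff]
        rcases lt_or_gt_of_ne h1 with h | h <;> rcases lt_or_gt_of_ne h2 with h' | h' <;>
          simp [h, h', h.not_gt, h'.not_gt]
  rw [e, MultiOp.koszulSign, MultiOp.koszulSign, ← Finset.prod_mul_distrib]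
  refine Finset.prod_congr rfl fun i _ => ?_
  rw [← Finset.prod_mul_distrib]
  refine Finset.prod_congr rfl fun j hj => ?_
  simp only [Finset.mem_Ioi] at hj
  have h1 : σ (τ i) ≠ σ (τ j) := by simpa using hj.ne
  have h2 : τ i ≠ τ j := by simpa using hj.ne
  rcases lt_or_gt_of_ne h1 with h | h <;> rcases lt_or_gt_of_ne h2 with h' | h' <;>
    simp [h, h', h.not_gt, h'.not_gt]

lemma koszulSign_one (d : Fin n → ℤ) : MultiOp.koszulSign 1 d = 1 := by
  refine Finset.prod_eq_one fun i _ => Finset.prod_eq_one fun j hj => ?_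
  simp only [Finset.mem_Ioi] at hj
  simp [hj.not_gt]

/-- The transposed neighbours are the only inversion of an adjacent transposition. -/
lemma koszulSign_swap (i : Fin n) (d : Fin (n + 1) → ℤ) :
    MultiOp.koszulSign (Equiv.swap i.castSucc i.succ) d = (d i.castSucc * d i.succ).negOnePow := by
  rw [MultiOp.koszulSign, Finset.prod_sigma', Finset.prod_eq_single ⟨i.castSucc, i.succ⟩]
  · simp
  · rintro ⟨a, b⟩ h hne
    simp only [Finset.mem_sigma, Finset.mem_univ, Finset.mem_Ioi, true_and] at h
    rw [if_neg]
    simp only [Equiv.swap_apply_def]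
    simp only [ne_eq, Sigma.mk.injEq, heq_eq_eq, not_and] at hne
    simp only [Fin.ext_iff, Fin.lt_def, Fin.val_castSucc, Fin.val_succ] at h hne ⊢
    split_ifs <;> simp <;> omega
  · simp

/-- The sign obtained by moving elements of degrees `q_i` past elements of degrees `p_j` for
`i < j`. -/
def shuffleSign (p q : Fin n → ℤ) : ℤˣ := (∑ j, ∑ i ∈ Finset.Iio j, q i * p j).negOnePow

lemma negOnePow_sum {ι : Type*} (s : Finset ι) (f : ι → ℤ) :
    (∑ i ∈ s, f i).negOnePow = ∏ i ∈ s, (f i).negOnePow := by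
  classical
  induction s using Finset.induction_on with
  | empty => simp
  | insert a s ha ih => rw [Finset.sum_insert ha, Finset.prod_insert ha, Int.negOnePow_add, ih]

lemma shuffleSign_eq_prod (p q : Fin n → ℤ) :
    shuffleSign p q = ∏ i, ∏ j ∈ Finset.Ioi i, (q i * p j).negOnePow := by
  rw [shuffleSign, negOnePow_sum]
  simp only [negOnePow_sum]
  refine Finset.prod_comm' fun i j => ?_
  simp

/-- Both sides are the sign of rearranging `p_1 q_1 … p_n q_n` into the permuted `p`'s followed by
the permuted `q`'s. On the left the two kinds are separated and then permuted; on the right the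
blocks `p_i q_i` are permuted and then separated. The comparison is made pair by pair. -/
lemma shuffleSign_mul_koszulSign (σ : Equiv.Perm (Fin n)) (p q : Fin n → ℤ) :
    shuffleSign p q * (MultiOp.koszulSign σ p * MultiOp.koszulSign σ q) =
      MultiOp.koszulSign σ (fun i => p i + q i) *
        shuffleSign (fun i => p (σ.symm i)) (fun i => q (σ.symm i)) := by
  have e : shuffleSign (fun i => p (σ.symm i)) (fun i => q (σ.symm i)) =
      ∏ i, ∏ j ∈ Finset.Ioi i, if σ i < σ j then (q i * p j).negOnePow else
        (q j * p i).negOnePow := by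
    have hF : ∀ i j : Fin n, (if i = j then 1 else if σ i < σ j then (q i * p j).negOnePow else
        (q j * p i).negOnePow : ℤˣ) = if j = i then 1 else if σ j < σ i then (q j * p i).negOnePow
        else (q i * p j).negOnePow := by
      intro i j
      by_cases hij : i = j
      · simp [hij]
      · have h1 : σ i ≠ σ j := by simpa using hij
        rcases lt_or_gt_of_ne h1 with h | h <;> simp [hij, Ne.symm hij, h, h.not_gt]
    have h := prod_lt_symm_comp σ.symm _ hF
    rw [shuffleSign_eq_prod]
    refine Eq.trans (Finset.prod_congr rfl fun i _ => Finset.prod_congr rfl fun j hj => ?_)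
      (h.trans (Finset.prod_congr rfl fun i _ => Finset.prod_congr rfl fun j hj => ?_))
    · simp only [Finset.mem_Ioi] at hj
      simp [hj, hj.ne]
    · simp only [Finset.mem_Ioi] at hj
      simp [hj.ne]
  rw [e, shuffleSign_eq_prod, MultiOp.koszulSign, MultiOp.koszulSign, MultiOp.koszulSign]
  simp only [← Finset.prod_mul_distrib]
  refine Finset.prod_congr rfl fun i _ => Finset.prod_congr rfl fun j hj => ?_
  simp only [Finset.mem_Ioi] at hj
  have h1 : σ i ≠ σ j := by simpa using hj.ne
  rcases lt_or_gt_of_ne h1 with h | h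
  · simp [h, h.not_gt]
  · simp only [h, h.not_gt, if_true, if_false, ← Int.negOnePow_add]
    rw [Int.negOnePow_eq_iff]
    -- For an inverted pair, `p i * q j` occurs twice on the right: in the Koszul sign of the blocks
    -- and in the shuffle sign after the permutation.
    exact ⟨-(p i * q j), by ring⟩

end Signs

/-! ### Permutation, grouping and differentiation of iterated products -/

section ProdPerm
variable {k : Type w} [Field k] {K : Dg k} (A : CDGA K)

lemma ordProd_swap {R : Type*} [Ring R] : ∀ {n : ℕ} (i : Fin n) (f : Fin (n + 1) → R) (c : ℤ)
    (_ : f i.castSucc * f i.succ = c • (f i.succ * f i.castSucc)),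
    ordProd f = c • ordProd (fun l => f (Equiv.swap i.castSucc i.succ l))
  | n + 1, i, f, c, h => by
    induction i using Fin.cases with
    | zero =>
      rw [ordProd_succ, ordProd_succ, ordProd_succ, ordProd_succ, ← mul_assoc, ← mul_assoc]
      have h0 : Equiv.swap (0 : Fin (n + 2)) (Fin.succ 0) 0 = Fin.succ 0 := Equiv.swap_apply_left _ _
      have h1 : Equiv.swap (0 : Fin (n + 2)) (Fin.succ 0) (Fin.succ 0) = 0 :=
        Equiv.swap_apply_right _ _
      have h2 : ∀ l : Fin n, Equiv.swap (0 : Fin (n + 2)) (Fin.succ 0) l.succ.succ = l.succ.succ :=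
        fun l => Equiv.swap_apply_of_ne_of_ne (by simp [Fin.ext_iff]) (by simp [Fin.ext_iff])
      simp only [Fin.castSucc_zero, h0, h1, h2] at h ⊢
      rw [h, smul_mul_assoc]
    | succ i =>
      rw [ordProd_succ, ordProd_succ fun l => f (Equiv.swap i.succ.castSucc i.succ.succ l)]
      have h0 : Equiv.swap i.succ.castSucc i.succ.succ 0 = 0 :=
        Equiv.swap_apply_of_ne_of_ne (by simp [Fin.ext_iff]) (by simp [Fin.ext_iff])
      have h2 : ∀ l : Fin (n + 1), Equiv.swap i.succ.castSucc i.succ.succ l.succ =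
          (Equiv.swap i.castSucc i.succ l).succ := by
        intro l
        simp only [Equiv.swap_apply_def]
        simp only [Fin.ext_iff, Fin.val_castSucc, Fin.val_succ]
        split_ifs <;> simp_all
      rw [h0, ordProd_swap i (fun l => f l.succ) c h, mul_smul_comm]
      simp only [h2]

/-- Adjacent transpositions generate the symmetric group as a monoid, and `koszulSign_mul` composes
the signs, so it is enough to commute two neighbours. -/
lemma ordProd_ι_perm {n : ℕ} (σ : Equiv.Perm (Fin n)) : ∀ (q : Fin n → ℤ)
    (x : (i : Fin n) → K.X (q i)), ordProd (fun i => A.ι (q i) (x i)) =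
      (MultiOp.koszulSign σ q : ℤ) • ordProd (fun i => A.ι (q (σ.symm i)) (x (σ.symm i))) := by
  have hσ : σ ∈ (⊤ : Submonoid (Equiv.Perm (Fin n))) := trivial
  cases n with
  | zero =>
    intro q x
    simp [ordProd, MultiOp.koszulSign]
  | succ n =>
    rw [← Equiv.Perm.mclosure_swap_castSucc_succ] at hσ
    induction hσ using Submonoid.closure_induction with
    | mem τ hτ =>
      obtain ⟨i, rfl⟩ := hτ
      intro q x
      rw [koszulSign_swap]
      exact ordProd_swap i (fun i => A.ι (q i) (x i)) _ (A.ι_comm _ _)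
    | one =>
      intro q x
      rw [koszulSign_one]
      simp; rfl
    | mul σ τ _ _ hσ hτ =>
      intro q x
      rw [koszulSign_mul, hτ q x, hσ (fun i => q (τ.symm i)) fun i => x (τ.symm i), smul_smul]
      rfl

lemma CDGA.prod_perm {n : ℕ} (σ : Equiv.Perm (Fin n)) (q : Fin n → ℤ) (Q : ℤ) (h : ∑ i, q i = Q)
    (h' : ∑ i, q (σ.symm i) = Q) (x : (i : Fin n) → K.X (q i)) :
    A.prod n q Q h x = MultiOp.koszulSign σ q •
      A.prod n (fun i => q (σ.symm i)) Q h' fun i => x (σ.symm i) := by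
  apply A.ι_injective
  rw [Units.smul_def, map_zsmul, A.ι_prod, A.ι_prod, ordProd_ι_perm A σ]

lemma CDGA.prod_flatten {n : ℕ} {m : Fin n → ℕ} (q : Fin (∑ i, m i) → ℤ) (Q : ℤ)
    (h : ∑ i, q i = Q) (h' : ∑ i, ∑ j, q (finSigmaFinEquiv ⟨i, j⟩) = Q)
    (x : (i : Fin (∑ i, m i)) → K.X (q i)) :
    A.prod n (fun i => ∑ j, q (finSigmaFinEquiv ⟨i, j⟩)) Q h'
      (fun i => A.prod (m i) (fun j => q (finSigmaFinEquiv ⟨i, j⟩)) _ rfl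
        fun j => x (finSigmaFinEquiv ⟨i, j⟩)) = A.prod _ q Q h x := by
  apply A.ι_injective
  rw [A.ι_prod, A.ι_prod, ordProd_sigma]
  simp only [A.ι_prod]

/-- The differential on the direct sum. -/
def CDGA.sumD : A.Sum →+ A.Sum :=
  DirectSum.toAddMonoid fun q => (A.ι (q + 1)).comp (K.d q (q + 1)).hom.toAddMonoidHom

lemma CDGA.sumD_ι {q q' : ℤ} (h : q + 1 = q') (x : K.X q) :
    A.sumD (A.ι q x) = A.ι q' ((K.d q q').hom x) := by
  subst h
  exact DirectSum.toAddMonoid_of _ _ _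

lemma CDGA.sumD_one : A.sumD 1 = 0 := by
  rw [← A.ι_one, A.sumD_ι (zero_add 1), A.d_one, map_zero]

/-- Only the left factor has to be homogeneous for the sign to make sense. A general right factor is
what the induction of `sumD_ordProd` needs. -/
lemma CDGA.sumD_mul {q : ℤ} (x : K.X q) (y : A.Sum) :
    A.sumD (A.ι q x * y) = A.ι (q + 1) ((K.d q (q + 1)).hom x) * y +
      (q.negOnePow : ℤ) • (A.ι q x * A.sumD y) := by
  induction y using A.sum_induction with
  | zero => simp
  | of r y =>
    rw [A.ι_mul rfl, A.sumD_ι rfl, A.sumD_ι rfl, A.d_mul rfl rfl rfl (by ring : q + 1 + r = _)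
      (by ring : q + (r + 1) = _), A.ι_mul (by ring : q + 1 + r = q + r + 1),
      A.ι_mul (by ring : q + (r + 1) = q + r + 1), map_add, Units.smul_def, map_zsmul]
  | add y z hy hz =>
    rw [mul_add, map_add, hy, hz, map_add, mul_add, mul_add, smul_add]
    abel

lemma CDGA.sumD_ordProd : ∀ {n : ℕ} (q : Fin n → ℤ) (x : (i : Fin n) → K.X (q i)),
    A.sumD (ordProd fun i => A.ι (q i) (x i)) = ∑ i, ((∑ l ∈ Finset.Iio i, q l).negOnePow : ℤ) •
      ordProd fun l => if l = i then A.ι (q l + 1) ((K.d (q l) (q l + 1)).hom (x l)) else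
        A.ι (q l) (x l)
  | 0, q, x => by simp [ordProd, A.sumD_one]
  | n + 1, q, x => by
    -- Once the first factor has been peeled off, the sign at each later place acquires the
    -- contribution `q 0`, which is the sign in the Leibniz rule.
    have h : ∀ i : Fin n, ∑ l ∈ Finset.Iio i.succ, q l = q 0 + ∑ l ∈ Finset.Iio i, q l.succ := by
      intro i
      have e : Finset.Iio i.succ = insert 0 ((Finset.Iio i).map (Fin.succEmb n)) := by
        ext l
        induction l using Fin.cases with
        | zero => simp
        | succ l => simp
      rw [e, Finset.sum_insert (by simp), Finset.sum_map]
      rfl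
    have h0 : ∑ l ∈ Finset.Iio (0 : Fin (n + 1)), q l = 0 := Finset.sum_eq_zero fun l hl => by simp at hl
    rw [ordProd_succ, A.sumD_mul, sumD_ordProd (fun i => q i.succ) fun i => x i.succ,
      Fin.sum_univ_succ, h0]
    congr 1
    · simp [ordProd_succ]
    · rw [Finset.mul_sum, Finset.smul_sum]
      refine Finset.sum_congr rfl fun i _ => ?_
      rw [ordProd_succ, h, Int.negOnePow_add, Units.val_mul, mul_smul, mul_smul_comm,
        if_neg (Fin.succ_ne_zero i).symm]
      simp only [Fin.succ_inj]

/-- This is `sumD_ordProd` read in `K`. The maps `idMap` only rename the degrees of the factors that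
are not differentiated. -/
lemma CDGA.d_prod {n : ℕ} (q : Fin n → ℤ) (Q Q' : ℤ) (h : ∑ i, q i = Q) (hQ : Q + 1 = Q')
    (h' : ∀ i, ∑ l, MultiOp.stepDeg q i l = Q') (x : (i : Fin n) → K.X (q i)) :
    (K.d Q Q').hom (A.prod n q Q h x) = ∑ i, (∑ l ∈ Finset.Iio i, q l).negOnePow •
      A.prod n (MultiOp.stepDeg q i) Q' (h' i) fun l =>
        if l = i then (K.d (q l) (MultiOp.stepDeg q i l)).hom (x l) else
          idMap K (q l) (MultiOp.stepDeg q i l) (x l) := by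
  apply A.ι_injective
  rw [← A.sumD_ι hQ, A.ι_prod, A.sumD_ordProd, map_sum]
  refine Finset.sum_congr rfl fun i _ => ?_
  rw [Units.smul_def, map_zsmul, A.ι_prod]
  congr 2
  funext l
  by_cases hl : l = i
  · subst hl
    have e : q l + 1 = MultiOp.stepDeg q l l := by simp [MultiOp.stepDeg]
    rw [if_pos rfl, if_pos rfl, ← A.sumD_ι e, ← A.sumD_ι rfl]
  · have e : q l = MultiOp.stepDeg q i l := by simp [MultiOp.stepDeg, hl]
    rw [if_neg hl, if_neg hl, A.ι_idMap e]

lemma CDGA.prod_one (q : Fin 1 → ℤ) (Q : ℤ) (h : ∑ i, q i = Q) (x : (i : Fin 1) → K.X (q i)) :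
    A.prod 1 q Q h x = idMap K (q 0) Q (x 0) := by
  apply A.ι_injective
  rw [A.ι_prod, A.ι_idMap (by simpa using h)]
  simp [ordProd]

end ProdPerm

/-! ### Bihomogeneous elements and finitary operations on total complexes -/

section TotHom
variable {k : Type w} [Field k]

/-- The inclusion of the piece of bidegree `(P, Q)` in the total complex. -/
def totHom (K : CosimplicialObject (Dg k)) : (P Q n : ℤ) → P + Q = n →
    ((normCplx.obj (row K Q)).X P →ₗ[k] (totN.obj K).X n)
  | Int.ofNat p, Q, n, h => LinearMap.single k (fun s : Bideg n => normSub (row K s.1.2) s.1.1)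
      ⟨(p, Q), h⟩
  | Int.negSucc _, _, _, _ => 0

lemma totHom_apply_self (K : CosimplicialObject (Dg k)) (p : ℕ) (Q n : ℤ) (h : (p : ℤ) + Q = n)
    (a : normSub (row K Q) p) : (totHom K p Q n h a : TotX K n) ⟨(p, Q), h⟩ = a :=
  Pi.single_eq_same (M := fun s : Bideg n => normSub (row K s.1.2) s.1.1) ⟨(p, Q), h⟩ a

lemma totHom_apply_of_ne (K : CosimplicialObject (Dg k)) (P Q n : ℤ) (h : P + Q = n)
    (a : (normCplx.obj (row K Q)).X P) (s : Bideg n) (hs : (s.1.1 : ℤ) ≠ P) :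
    (totHom K P Q n h a : TotX K n) s = 0 := by
  cases P with
  | ofNat p =>
    exact Pi.single_eq_of_ne (M := fun s : Bideg n => normSub (row K s.1.2) s.1.1)
      (i := ⟨(p, Q), h⟩) (i' := s) (by rintro rfl; exact hs rfl) a
  | negSucc p => rfl

lemma totHom_of_neg (K : CosimplicialObject (Dg k)) (P Q n : ℤ) (h : P + Q = n)
    (hP : P < 0) (a : (normCplx.obj (row K Q)).X P) : totHom K P Q n h a = 0 := by
  cases P with
  | ofNat p => simp at hP; omega
  | negSucc p => rfl

lemma normCplx_subsingleton (A : CosimplicialObject (ModuleCat.{w} k)) {P : ℤ} (hP : P < 0) :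
    Subsingleton ((normCplx.obj A).X P) := by
  cases P with
  | ofNat p => simp at hP; omega
  | negSucc p => exact inferInstanceAs (Subsingleton PUnit)

lemma idMap_totHom (K : CosimplicialObject (Dg k)) (P Q n n' : ℤ) (h : P + Q = n) (hn : n = n')
    (a : (normCplx.obj (row K Q)).X P) :
    idMap (totN.obj K) n n' (totHom K P Q n h a) = totHom K P Q n' (h.trans hn) a := by
  subst hn
  rw [idMap_self]

/-- Two elements of the total complex agree in horizontal degrees at most `N`. -/
def Agree {K : CosimplicialObject (Dg k)} {n : ℤ} (N : ℕ) (x y : TotX K n) : Prop :=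
  ∀ t : Bideg n, t.1.1 ≤ N → x t = y t

/-- The total differential does not lower horizontal degrees: its component in horizontal degree `p
+ 1` involves only components in horizontal degrees `p` and `p + 1`. -/
lemma Agree.d {K : CosimplicialObject (Dg k)} {n n' : ℤ} {N : ℕ} {x y : TotX K n}
    (h : Agree N x y) : Agree N (K := K) (n := n') (((totN.obj K).d n n').hom x)
      (((totN.obj K).d n n').hom y) := by
  by_cases hn : n + 1 = n'
  · have e : (totN.obj K).d n n' = ModuleCat.ofHom (totD K n n' hn) := dif_pos hn
    rw [e]
    intro t ht
    change totH K n n' hn x t + (-1 : k) ^ t.1.1 • totV K n n' hn x t =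
      totH K n n' hn y t + (-1 : k) ^ t.1.1 • totV K n n' hn y t
    obtain ⟨⟨_ | p, q⟩, hs⟩ := t
    · simp only [totH, totV]
      rw [h _ (by simp)]
    · simp only [totH, totV]
      rw [h _ (by simp only at ht ⊢; omega), h _ (by simp only at ht ⊢; omega)]
  · have e : (totN.obj K).d n n' = 0 := dif_neg hn
    rw [e]
    intro t ht
    rfl

lemma Agree.idMap {K : CosimplicialObject (Dg k)} {n n' : ℤ} {N : ℕ} {x y : TotX K n}
    (h : Agree N x y) : Agree N (K := K) (n := n') (idMap (totN.obj K) n n' x)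
      (idMap (totN.obj K) n n' y) := by
  by_cases hn : n = n'
  · subst hn
    intro t ht
    refine (congrFun (idMap_self (totN.obj K) n x) t).trans (Eq.trans (h t ht) ?_)
    exact (congrFun (idMap_self (totN.obj K) n y) t).symm
  · have e : GodementEZ.idMap (totN.obj K) n n' = 0 := dif_neg hn
    rw [e]
    intro t ht
    rfl

/-- An operation on total complexes is finitary if every component of a value depends only on finitely
many components of the arguments. -/
def IsFinitary {K L : CosimplicialObject (Dg k)} {n : ℕ} {r : ℤ}
    (φ : MultiOp (fun _ : Fin n => totN.obj K) (totN.obj L) r) : Prop :=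
  ∀ (d : Fin n → ℤ) (e : {e : ℤ // ∑ i, d i + r = e}) (N : ℕ), ∃ M : ℕ, ∀ x y : (i : Fin n) → (totN.obj K).X (d i),
    (∀ i, Agree (K := K) (n := d i) M (x i) (y i)) → Agree N (K := L) (φ d e x) (φ d e y)

/-- In a given total degree there is one bidegree for each horizontal degree, so the bounds
belonging to horizontal degrees at most `N` have a maximum. -/
lemma isFinitary_of_component {K L : CosimplicialObject (Dg k)} {n : ℕ} {r : ℤ}
    (φ : MultiOp (fun _ : Fin n => totN.obj K) (totN.obj L) r)
    (h : ∀ (d : Fin n → ℤ) (e : {e : ℤ // ∑ i, d i + r = e}) (s : Bideg e.1), ∃ M : ℕ, ∀ x y : (i : Fin n) → (totN.obj K).X (d i),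
      (∀ i, Agree (K := K) (n := d i) M (x i) (y i)) → (φ d e x : TotX L e.1) s = (φ d e y : TotX L e.1) s) :
    IsFinitary φ := by
  intro d e N
  choose M hM using h d e
  refine ⟨(Finset.range (N + 1)).sup fun p => M ⟨(p, e.1 - p), by simp⟩, fun x y hxy t ht => ?_⟩
  obtain ⟨⟨p, q⟩, hs⟩ := t
  obtain rfl : q = e.1 - p := by simp only at hs; omega
  refine hM _ x y fun i t' ht' => hxy i t' (ht'.trans ?_)
  exact Finset.le_sup (f := fun p : ℕ => M ⟨(p, e.1 - p), by simp⟩)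
    (Finset.mem_range.2 (Nat.lt_succ_of_le ht))

lemma totX_eq_of_agree {K : CosimplicialObject (Dg k)} {n : ℤ} {x y : TotX K n}
    (h : ∀ N, Agree N x y) : x = y :=
  funext fun t => h t.1.1 t le_rfl

lemma agree_sum_totHom {K : CosimplicialObject (Dg k)} {n : ℤ} (N : ℕ) (x : TotX K n) :
    Agree N x (∑ p ∈ Finset.range (N + 1), totHom K p (n - p) n (by simp) (x ⟨(p, n - p), by simp⟩) :
      (totN.obj K).X n) := by
  intro t ht
  obtain ⟨⟨p, q⟩, hs⟩ := t
  obtain rfl : q = n - p := by simp only at hs; omega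
  have e : ∀ (S : Finset ℕ) (f : ℕ → TotX K n) (t : Bideg n), (∑ p ∈ S, f p) t = ∑ p ∈ S, f p t :=
    fun S f t => Finset.sum_apply t S f
  refine Eq.trans ?_ (e _ _ _).symm
  rw [Finset.sum_eq_single p]
  · exact (totHom_apply_self K p _ _ _ _).symm
  · intro p' _ hp'
    exact totHom_apply_of_ne _ _ _ _ _ _ _ (by simpa using hp'.symm)
  · intro h
    exact absurd (Finset.mem_range.2 (Nat.lt_succ_of_le ht)) h

/-- Elements of the product total complex need not be finite sums of bihomogeneous ones, but finite
sums are dense and finitary operations are continuous. To compare values up to horizontal degree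
`N`, the arguments may be truncated, and the truncations are expanded by multilinearity. -/
lemma IsFinitary.ext {K L : CosimplicialObject (Dg k)} {n : ℕ} {r : ℤ}
    {φ ψ : MultiOp (fun _ : Fin n => totN.obj K) (totN.obj L) r} (hφ : IsFinitary φ)
    (hψ : IsFinitary ψ) (h : ∀ (p q d : Fin n → ℤ) (hd : ∀ i, p i + q i = d i) e
      (a : (i : Fin n) → (normCplx.obj (row K (q i))).X (p i)),
      φ d e (fun i => totHom K (p i) (q i) (d i) (hd i) (a i)) =
        ψ d e (fun i => totHom K (p i) (q i) (d i) (hd i) (a i))) : φ = ψ := by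
  classical
  funext d e
  ext x
  refine totX_eq_of_agree fun N => ?_
  obtain ⟨M₁, h₁⟩ := hφ d e N
  obtain ⟨M₂, h₂⟩ := hψ d e N
  -- The truncation of `x` to the horizontal degrees on which the two values can depend up to
  -- horizontal degree `N`.
  let y : (i : Fin n) → TotX K (d i) := fun i =>
    (∑ p ∈ Finset.range (max M₁ M₂ + 1), totHom K p (d i - p) (d i) (by simp)
      ((x i : TotX K (d i)) ⟨(p, d i - p), by simp⟩) : (totN.obj K).X (d i))
  have hy : ∀ i, Agree (max M₁ M₂) (x i : TotX K (d i)) (y i) := fun i => agree_sum_totHom _ _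
  have e1 : φ d e y = ψ d e y := by
    refine ((φ d e).map_sum_finset _ _).trans (Eq.trans ?_ ((ψ d e).map_sum_finset _ _).symm)
    exact Finset.sum_congr rfl fun p _ => h (fun i => p i) (fun i => d i - p i) d _ e _
  intro t ht
  refine (h₁ x y (fun i t ht => hy i t (ht.trans (le_max_left _ _))) t ht).trans ?_
  refine Eq.trans ?_ (h₂ x y (fun i t ht => hy i t (ht.trans (le_max_right _ _))) t ht).symm
  rw [e1]

lemma IsFinitary.bd {K L : CosimplicialObject (Dg k)} {n : ℕ} {r : ℤ}
    {φ : MultiOp (fun _ : Fin n => totN.obj K) (totN.obj L) r} (hφ : IsFinitary φ) :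
    IsFinitary (MultiOp.bd φ) := by
  intro d e N
  obtain ⟨M₀, h₀⟩ := hφ d ⟨_, rfl⟩ N
  choose M hM using fun i => hφ (MultiOp.stepDeg d i)
    ⟨e.1, by rw [MultiOp.sum_stepDeg]; have := e.2; omega⟩ N
  refine ⟨max M₀ (Finset.univ.sup M), fun x y hxy t ht => ?_⟩
  have e0 := Agree.d (n' := e.1) (h₀ x y fun i t ht => hxy i t (ht.trans (le_max_left _ _))) t ht
  have e1 : ∀ i, (MultiOp.bdTerm φ d e i x : TotX L e.1) t =
      (MultiOp.bdTerm φ d e i y : TotX L e.1) t := by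
    intro i
    refine hM i _ _ (fun l => ?_) t ht
    have h1 : Agree (M i) (x l) (y l) := fun t ht => hxy l t (ht.trans ((Finset.le_sup
      (Finset.mem_univ i)).trans (le_max_right _ _)))
    dsimp only
    split_ifs
    · exact h1.d
    · exact h1.idMap
  have e2 : ∀ x, (MultiOp.bd φ d e x : TotX L e.1) t =
      (((totN.obj L).d (∑ i, d i + r) e.1).hom (φ d ⟨_, rfl⟩ x) : TotX L e.1) t -
        r.negOnePow • ∑ i, (∑ l ∈ Finset.Iio i, d l).negOnePow •
          (MultiOp.bdTerm φ d e i x : TotX L e.1) t := by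
    intro x
    have e3 : ∀ f : Fin n → TotX L e.1, (∑ i, f i) t = ∑ i, f i t :=
      fun f => Finset.sum_apply t _ f
    have e4 : MultiOp.bd φ d e x = ((totN.obj L).d (∑ i, d i + r) e.1).hom (φ d ⟨_, rfl⟩ x) -
        r.negOnePow • ∑ i, (∑ l ∈ Finset.Iio i, d l).negOnePow • MultiOp.bdTerm φ d e i x := by
      simp [MultiOp.bd, Units.smul_def]
    rw [e4]
    exact congrArg (fun z => _ - r.negOnePow • z) (e3 _)
  refine (e2 x).trans (Eq.trans ?_ (e2 y).symm)
  exact congrArg₂ (· - ·) e0 (congrArg (r.negOnePow • ·)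
    (Finset.sum_congr rfl fun i _ => congrArg (Int.negOnePow _ • ·) (e1 i)))

lemma IsFinitary.perm {K L : CosimplicialObject (Dg k)} {n : ℕ} {r : ℤ} (σ : Equiv.Perm (Fin n))
    {φ : MultiOp (fun _ : Fin n => totN.obj K) (totN.obj L) r} (hφ : IsFinitary φ) :
    IsFinitary (MultiOp.perm (K := fun _ => totN.obj K) σ φ) := by
  intro d e N
  obtain ⟨M, hM⟩ := hφ (fun i => d (σ.symm i))
    ⟨e.1, by rw [Equiv.sum_comp σ.symm d]; exact e.2⟩ N
  refine ⟨M, fun x y hxy t ht => ?_⟩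
  exact congrArg (MultiOp.koszulSign σ d • ·) (hM (fun i => x (σ.symm i)) (fun i => y (σ.symm i))
    (fun i => hxy _) t ht)

lemma IsFinitary.comp {K : CosimplicialObject (Dg k)} {n : ℕ} {m : Fin n → ℕ} {r : ℤ}
    {s : Fin n → ℤ} {φ : MultiOp (fun _ : Fin n => totN.obj K) (totN.obj K) r} (hφ : IsFinitary φ)
    {ψ : (i : Fin n) → MultiOp (fun _ : Fin (m i) => totN.obj K) (totN.obj K) (s i)}
    (hψ : ∀ i, IsFinitary (ψ i)) :
    IsFinitary (MultiOp.comp (K := fun _ => totN.obj K) φ ψ) := by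
  intro d e N
  obtain ⟨M, hM⟩ := hφ (fun i => ∑ j, d (finSigmaFinEquiv ⟨i, j⟩) + s i) ⟨e.1, by
    rw [Finset.sum_add_distrib, MultiOp.sum_sigma]
    have := e.2
    omega⟩ N
  choose M' hM' using fun i => hψ i (fun j => d (finSigmaFinEquiv ⟨i, j⟩)) ⟨_, rfl⟩ M
  refine ⟨Finset.univ.sup M', fun x y hxy t ht => ?_⟩
  refine congrArg (Int.negOnePow (∑ j, ∑ i ∈ Finset.Iio j,
    s j * ∑ l, d (finSigmaFinEquiv ⟨i, l⟩)) • ·) (hM _ _ (fun i => ?_) t ht)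
  exact hM' i (fun j => x (finSigmaFinEquiv ⟨i, j⟩)) (fun j => y (finSigmaFinEquiv ⟨i, j⟩))
    fun j t ht => hxy _ t (ht.trans (Finset.le_sup (Finset.mem_univ i)))

lemma IsFinitary.post {K L L' : CosimplicialObject (Dg k)} {n : ℕ} {r : ℤ} (f : L ⟶ L')
    {φ : MultiOp (fun _ : Fin n => totN.obj K) (totN.obj L) r} (hφ : IsFinitary φ) :
    IsFinitary (MultiOp.post (totN.map f) φ) := by
  intro d e N
  obtain ⟨M, hM⟩ := hφ d e N
  refine ⟨M, fun x y hxy t ht => ?_⟩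
  exact congrArg (normMap (rowMap f t.1.2) t.1.1) (hM x y hxy t ht)

lemma IsFinitary.pre {K K' L : CosimplicialObject (Dg k)} {n : ℕ} {r : ℤ} (f : K ⟶ K')
    {φ : MultiOp (fun _ : Fin n => totN.obj K') (totN.obj L) r} (hφ : IsFinitary φ) :
    IsFinitary (MultiOp.pre φ fun _ => totN.map f) := by
  intro d e N
  obtain ⟨M, hM⟩ := hφ d e N
  refine ⟨M, fun x y hxy t ht => hM _ _ (fun i t ht => ?_) t ht⟩
  exact congrArg (normMap (rowMap f t.1.2) t.1.1) (hxy i t ht)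

lemma isFinitary_one (K : CosimplicialObject (Dg k)) :
    IsFinitary (MultiOp.one (fun _ => totN.obj K)) :=
  fun _ _ N => ⟨N, fun _ _ hxy => (hxy 0).idMap⟩

lemma ezOp_apply {K : CosimplicialObject (Dg k)} (A : CosCDGA K) {n : ℕ} {r : ℤ}
    (z : EZ k n r) (d : Fin n → ℤ) (e : {e : ℤ // ∑ i, d i + r = e}) (x : (i : Fin n) → TotX K (d i))
    (s : Bideg e.1) : (ezOp A z d e x : TotX K e.1) s =
      ∑ p ∈ Fintype.piFinset fun _ : Fin n => Finset.range ((s.1.1 - r).toNat + 1),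
        (if h : ∑ i, (p i : ℤ) + r = s.1.1 then ezTerm A z d e s p h else 0) x := by
  change (∑ p ∈ Fintype.piFinset fun _ : Fin n => Finset.range ((s.1.1 - r).toNat + 1),
    if h : ∑ i, (p i : ℤ) + r = s.1.1 then ezTerm A z d e s p h else 0 :
      MultilinearMap k (fun i => TotX K (d i)) _) x = _
  rw [sum_apply]

lemma isFinitary_ezOp {K : CosimplicialObject (Dg k)} (A : CosCDGA K) {n : ℕ} {r : ℤ}
    (z : EZ k n r) : IsFinitary (ezOp A z) := by
  refine isFinitary_of_component _ fun d e s => ⟨(s.1.1 - r).toNat, fun x y hxy => ?_⟩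
  refine (ezOp_apply A z d e x s).trans (Eq.trans ?_ (ezOp_apply A z d e y s).symm)
  refine Finset.sum_congr rfl fun p hp => ?_
  split_ifs with hr
  · refine congrArg (Int.negOnePow _ • ·) (congrArg (ezPiece A z d e s p hr) (funext fun i => ?_))
    refine hxy i _ ?_
    have := Fintype.mem_piFinset.1 hp i
    simpa [Nat.lt_succ_iff] using this
  · rfl

/-- Bihomogeneous arguments select one summand of `ezOp`. This is the formula for the action given
in the theorem, and the form in which all axioms are verified. -/
lemma ezOp_totHom {K : CosimplicialObject (Dg k)} (A : CosCDGA K) {n : ℕ} {r : ℤ} (z : EZ k n r)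
    (p q d : Fin n → ℤ) (hd : ∀ i, p i + q i = d i) (e : {e : ℤ // ∑ i, d i + r = e})
    (a : (i : Fin n) → (normCplx.obj (row K (q i))).X (p i)) (P Q : ℤ) (hPQ : P + Q = e.1)
    (hP : ∑ i, p i + r = P) (hQ : ∑ i, q i = Q) :
    ezOp A z d e (fun i => totHom K (p i) (q i) (d i) (hd i) (a i)) =
      totHom K P Q e.1 hPQ (shuffleSign p q • ((normCplx.map (A.prod q Q hQ)).f P).hom
        (z.1 (fun i => row K (q i)) p ⟨P, hP⟩ a)) := by
  classical
  -- In negative horizontal degrees the normalized complex is zero, so one argument, and with it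
  -- both sides, vanishes.
  by_cases hp : ∀ i, 0 ≤ p i
  swap
  · push Not at hp
    obtain ⟨i, hi⟩ := hp
    have := normCplx_subsingleton (row K (q i)) hi
    have ha : a i = 0 := Subsingleton.elim _ _
    rw [(ezOp A z d e).map_coord_zero (i := i) (by rw [ha, map_zero]),
      (z.1 (fun i => row K (q i)) p ⟨P, hP⟩).map_coord_zero (i := i) ha]
    simp
  obtain ⟨p, rfl⟩ : ∃ p' : Fin n → ℕ, p = fun i => (p' i : ℤ) :=
    ⟨fun i => (p i).toNat, funext fun i => (Int.toNat_of_nonneg (hp i)).symm⟩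
  obtain rfl : q = fun i => d i - p i := funext fun i => eq_sub_of_add_eq' (hd i)
  refine funext fun s => ?_
  refine (ezOp_apply A z d e _ s).trans ?_
  -- A summand with other horizontal degrees evaluates some argument at a component where it is
  -- zero.
  have h0 : ∀ p' : Fin n → ℕ, p' ≠ p →
      (if h : ∑ i, (p' i : ℤ) + r = s.1.1 then ezTerm A z d e s p' h else 0)
        (fun i => totHom K (p i) (d i - p i) (d i) (hd i) (a i)) = 0 := by
    intro p' hp'
    obtain ⟨i, hi⟩ := Function.ne_iff.1 hp'
    split_ifs with hr
    · refine (congrArg (Int.negOnePow _ • ·) ((ezPiece A z d e s p' hr).map_coord_zero i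
        (totHom_apply_of_ne K _ _ _ (hd i) (a i) _ (by simpa using hi)))).trans (smul_zero _)
    · rfl
  rw [Finset.sum_eq_single p (fun p' _ hp' => h0 p' hp')]
  · by_cases hs : (s.1.1 : ℤ) = P
    · obtain ⟨e, he⟩ := e
      obtain ⟨⟨s, t⟩, hst⟩ := s
      simp only at hs hst hPQ
      obtain rfl := hs
      obtain rfl : Q = t := by omega
      rw [dif_pos hP]
      refine Eq.trans ?_ (totHom_apply_self K s Q e hst _).symm
      refine congrArg (Int.negOnePow _ • ·) (congrArg (ezPiece A z d ⟨e, he⟩ ⟨(s, Q), hst⟩ p hP) ?_)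
      exact funext fun i => totHom_apply_self K (p i) _ _ _ (a i)
    · rw [dif_neg (fun h => hs (by rw [← hP, ← h]))]
      exact (totHom_apply_of_ne K P Q _ hPQ _ s hs).symm
  · intro hmem
    rw [dif_neg]
    · rfl
    -- The range of summation does contain `p`: natural numbers with sum `s - r` are each at most `s
    -- - r`.
    · intro hr
      refine hmem (Fintype.mem_piFinset.2 fun i => Finset.mem_range.2 ?_)
      have := Finset.single_le_sum (f := fun i => (p i : ℤ)) (fun _ _ => by positivity)
        (Finset.mem_univ i)
      omega

end TotHom

/-! ### Differential and functoriality on bihomogeneous elements -/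

section TotHomMaps
variable {k : Type w} [Field k]

/-- The total differential is split here into the differential of the normalized complex of a row
and the map of normalized complexes induced by `rowD`, to which the differential of `z` and its
naturality apply respectively. -/
lemma d_totHom (K : CosimplicialObject (Dg k)) (P Q n P' Q' n' : ℤ) (h : P + Q = n)
    (hP : P + 1 = P') (hQ : Q + 1 = Q') (h1 : P' + Q = n') (h2 : P + Q' = n')
    (a : (normCplx.obj (row K Q)).X P) :
    ((totN.obj K).d n n').hom (totHom K P Q n h a) =
      totHom K P' Q n' h1 (((normCplx.obj (row K Q)).d P P').hom a) +
        P.negOnePow • totHom K P Q' n' h2 (((normCplx.map (rowD K Q Q')).f P).hom a) := by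
  subst hP
  obtain rfl : Q = Q' - 1 := by omega
  have hn : n + 1 = n' := by omega
  have e : (totN.obj K).d n n' = ModuleCat.ofHom (totD K n n' hn) := dif_pos hn
  by_cases hP : P < 0
  · have := normCplx_subsingleton (row K (Q' - 1)) hP
    obtain rfl : a = 0 := Subsingleton.elim _ _
    simp
  obtain ⟨p, rfl⟩ : ∃ p : ℕ, P = p := ⟨P.toNat, (Int.toNat_of_nonneg (not_lt.1 hP)).symm⟩
  rw [e]
  refine funext fun s => ?_
  change totH K n n' hn (totHom K p (Q' - 1) n h a) s +
    (-1 : k) ^ s.1.1 • totV K n n' hn (totHom K p (Q' - 1) n h a) s =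
    (totHom K (p + 1 : ℕ) (Q' - 1) n' h1 (normDD (row K (Q' - 1)) p (p + 1) a) : TotX K n') s +
      (p : ℤ).negOnePow • (totHom K p Q' n' h2 (normMap (rowD K (Q' - 1) Q') p a) : TotX K n') s
  rw [normDD_succ]
  congr 1
  · obtain ⟨⟨_ | m, q⟩, hs⟩ := s
    · exact (totHom_apply_of_ne K _ _ _ _ _ _ (by simp; omega)).symm
    · simp only [totH]
      by_cases hm : m = p
      · subst hm
        obtain rfl : q = Q' - 1 := by simp only at hs; omega
        refine Eq.trans ?_ (totHom_apply_self K (m + 1) _ _ h1 _).symm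
        exact congrArg _ (totHom_apply_self K m _ _ h a)
      · refine Eq.trans ?_ (totHom_apply_of_ne K _ _ _ h1 _ ⟨(m + 1, q), hs⟩
          (by simp only; omega)).symm
        exact Eq.trans (congrArg _ (totHom_apply_of_ne K _ _ _ h a
          ⟨(m, q), by simp only [Nat.cast_add, Nat.cast_one] at hs ⊢; omega⟩ (by simp; omega)))
          (map_zero _)
  · obtain ⟨⟨m, q⟩, hs⟩ := s
    simp only [totV]
    by_cases hm : m = p
    · subst hm
      obtain rfl : q = Q' := by simp only at hs; omega
      -- The sign is a scalar of `k` in `totD` and a unit of `ℤ` in the statement.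
      have e1 : (-1 : k) ^ m = (((m : ℤ).negOnePow : ℤ) : k) := by simp [Int.negOnePow]
      have e2 := totHom_apply_self K m _ _ h a
      have e3 := totHom_apply_self K m _ _ h2 (normMap (rowD K (q - 1) q) m a)
      refine (congrArg (fun z => (-1 : k) ^ m • normMap (rowD K (q - 1) q) m z) e2).trans
        (Eq.trans ?_ (congrArg ((m : ℤ).negOnePow • ·) e3).symm)
      rw [e1, Int.cast_smul_eq_zsmul, Units.smul_def]
    · have e2 := totHom_apply_of_ne K _ _ _ h a ⟨(m, q - 1), by simp only at hs ⊢; omega⟩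
        (by simp; omega)
      have e3 := totHom_apply_of_ne K _ _ _ h2 (normMap (rowD K (Q' - 1) Q') p a) ⟨(m, q), hs⟩
        (by simp; omega)
      refine (congrArg (fun z => (-1 : k) ^ m • normMap (rowD K (q - 1) q) m z) e2).trans
        (Eq.trans ?_ (congrArg ((p : ℤ).negOnePow • ·) e3).symm)
      rw [map_zero, smul_zero, smul_zero]

lemma map_totHom {K L : CosimplicialObject (Dg k)} (f : K ⟶ L) (P Q n : ℤ) (h : P + Q = n)
    (a : (normCplx.obj (row K Q)).X P) : ((totN.map f).f n).hom (totHom K P Q n h a) =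
      totHom L P Q n h (((normCplx.map (rowMap f Q)).f P).hom a) := by
  by_cases hP : P < 0
  · rw [totHom_of_neg _ _ _ _ _ hP, totHom_of_neg _ _ _ _ _ hP, map_zero]
  obtain ⟨p, rfl⟩ : ∃ p : ℕ, P = p := ⟨P.toNat, (Int.toNat_of_nonneg (not_lt.1 hP)).symm⟩
  refine funext fun s => ?_
  change normMap (rowMap f s.1.2) s.1.1 ((totHom K p Q n h a : TotX K n) s) = _
  by_cases hs : (s.1.1 : ℤ) = p
  · obtain ⟨⟨m, q⟩, hs'⟩ := s
    simp only at hs hs'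
    obtain rfl : m = p := by omega
    obtain rfl : q = Q := by omega
    exact (congrArg _ (totHom_apply_self K m _ _ h a)).trans (totHom_apply_self L m _ _ h _).symm
  · exact (congrArg _ (totHom_apply_of_ne K _ _ _ h a s hs)).trans
      ((map_zero _).trans (totHom_apply_of_ne L _ _ _ h _ s hs).symm)

/-- Sums of maps of cosimplicial modules are needed to state the Leibniz rule `prod_rowD`. -/
instance : Preadditive (CosimplicialObject (ModuleCat.{w} k)) :=
  inferInstanceAs (Preadditive (SimplexCategory ⥤ ModuleCat.{w} k))

lemma cosimplicial_sum_app {ι : Type*} {A B : CosimplicialObject (ModuleCat.{w} k)} (s : Finset ι)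
    (f : ι → (A ⟶ B)) (c : SimplexCategory) : (∑ i ∈ s, f i).app c = ∑ i ∈ s, (f i).app c :=
  map_sum (⟨⟨fun f => f.app c, rfl⟩, fun _ _ => rfl⟩ : (A ⟶ B) →+ (A.obj c ⟶ B.obj c)) f s

lemma moduleCat_sum_apply {ι : Type*} {M N : ModuleCat.{w} k} (s : Finset ι) (f : ι → (M ⟶ N))
    (x : M) : (∑ i ∈ s, f i).hom x = ∑ i ∈ s, (f i).hom x := by
  rw [ModuleCat.hom_sum, LinearMap.sum_apply]

lemma cosimplicial_zsmul_app {A B : CosimplicialObject (ModuleCat.{w} k)} (m : ℤ) (f : A ⟶ B)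
    (c : SimplexCategory) : (m • f).app c = m • f.app c :=
  NatTrans.app_zsmul (C := SimplexCategory) (D := ModuleCat.{w} k) _ _ _

instance : (normCplx (k := k)).Additive where
  map_add {A B f g} := by
    ext (p | p) a <;> rfl

end TotHomMaps

/-! ### Iterated products as maps of cosimplicial modules -/

section CosProd
variable {k : Type w} [Field k]

/-- Graded commutativity in each cosimplicial degree. Only the vertical degrees contribute to this
sign; the horizontal ones enter through the action of permutations on the operad. -/
lemma tensorCosPerm_prod {K : CosimplicialObject (Dg k)} (A : CosCDGA K) {n : ℕ}
    (σ : Equiv.Perm (Fin n)) (q : Fin n → ℤ) (Q : ℤ) (h : ∑ i, q i = Q)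
    (h' : ∑ i, q (σ.symm i) = Q) :
    tensorCosPerm (fun i => row K (q i)) σ ≫ A.prod q Q h =
      (MultiOp.koszulSign σ q : ℤ) • A.prod (fun i => q (σ.symm i)) Q h' := by
  apply NatTrans.ext
  funext c
  rw [cosimplicial_zsmul_app]
  refine tObj_hom_ext fun y => ?_
  -- Every family indexed in the permuted order is the permutation of a family in the original
  -- order, which is the form required by `CDGA.prod_perm`.
  obtain ⟨x, rfl⟩ : ∃ x : (i : Fin n) → (K.obj c).X (q i), y = fun i => x (σ.symm i) :=
    ⟨(Equiv.piCongrLeft' (fun i => ((K.obj c).X (q i) : Type w)) σ).symm y,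
      (Equiv.apply_symm_apply (Equiv.piCongrLeft' (fun i => ((K.obj c).X (q i) : Type w)) σ) y).symm⟩
  have e : (tPerm (fun i => (row K (q i)).obj c) σ).hom
      (PiTensorProduct.tprod k fun i => x (σ.symm i)) = PiTensorProduct.tprod k x :=
    (LinearEquiv.symm_apply_eq _).2 (PiTensorProduct.reindex_tprod (R := k) σ x).symm
  refine (congrArg ((A.prod q Q h).app c).hom e).trans ?_
  refine (PiTensorProduct.lift.tprod (φ := (A.alg c).prod n q Q h) x).trans ?_
  refine ((A.alg c).prod_perm σ q Q h h' x).trans ?_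
  rw [Units.smul_def]
  exact congrArg _ (PiTensorProduct.lift.tprod (φ := (A.alg c).prod n _ Q h') _).symm

/-- Tensors of pure tensors span, so the associativity `CDGA.prod_flatten` in each cosimplicial
degree is enough. -/
lemma tensorCosFlatten_prod {K : CosimplicialObject (Dg k)} (A : CosCDGA K) {n : ℕ} {m : Fin n → ℕ}
    (q : Fin (∑ i, m i) → ℤ) (Q : ℤ) (h : ∑ i, q i = Q)
    (h' : ∑ i, ∑ j, q (finSigmaFinEquiv ⟨i, j⟩) = Q) :
    tensorCosFlatten (fun i => row K (q i)) ≫ A.prod q Q h =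
      tensorCosMap (fun i => A.prod (fun j => q (finSigmaFinEquiv ⟨i, j⟩)) _ rfl) ≫
        A.prod (fun i => ∑ j, q (finSigmaFinEquiv ⟨i, j⟩)) Q h' := by
  apply NatTrans.ext
  funext c
  refine ModuleCat.hom_ext (PiTensorProduct.ext_of_span_eq_top
    (g := fun i (y : (j : Fin (m i)) → (K.obj c).X (q (finSigmaFinEquiv ⟨i, j⟩))) =>
      PiTensorProduct.tprod k y)
    (fun i => PiTensorProduct.span_tprod_eq_top) fun y => ?_)
  obtain ⟨x, rfl⟩ : ∃ x : (l : Fin (∑ i, m i)) → (K.obj c).X (q l),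
      y = fun i j => x (finSigmaFinEquiv ⟨i, j⟩) :=
    ⟨finSigmaFinEquiv.piCongrLeft (fun l => ((K.obj c).X (q l) : Type w)) (fun s => y s.1 s.2), by
      funext i j
      exact (Equiv.piCongrLeft_apply_apply (fun l => ((K.obj c).X (q l) : Type w)) finSigmaFinEquiv
        (fun s => y s.1 s.2) ⟨i, j⟩).symm⟩
  refine (congrArg ((A.prod q Q h).app c).hom (flatten_tprod
    (fun l => (K.obj c).X (q l)) x)).trans ?_
  refine (PiTensorProduct.lift.tprod (φ := (A.alg c).prod _ q Q h) x).trans ?_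
  refine ((A.alg c).prod_flatten q Q h h' x).symm.trans ?_
  refine Eq.symm ((congrArg ((A.prod _ Q h').app c).hom (PiTensorProduct.map_tprod _ _)).trans ?_)
  refine (PiTensorProduct.lift.tprod (φ := (A.alg c).prod n _ Q h') _).trans ?_
  exact congrArg _ (funext fun i => PiTensorProduct.lift.tprod (φ := (A.alg c).prod (m i) _ _ rfl) _)

lemma tensorCosOne_prod {K : CosimplicialObject (Dg k)} (A : CosCDGA K) (q : Fin 1 → ℤ)
    (h : ∑ i, q i = q 0) :
    tensorCosOne (fun i => row K (q i)) ≫ A.prod q (q 0) h = 𝟙 _ := by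
  apply NatTrans.ext
  funext c
  ext (x : (K.obj c).X (q 0))
  refine (PiTensorProduct.lift.tprod (φ := (A.alg c).prod 1 q (q 0) h) _).trans ?_
  exact ((A.alg c).prod_one q _ h _).trans (idMap_self _ _ _)

lemma tensorCosMap_rowMap_prod {K L : CosimplicialObject (Dg k)} (A : CosCDGA K) (B : CosCDGA L)
    (f : K ⟶ L) (hf : ∀ c, IsCDGAHom (A.alg c) (B.alg c) (f.app c)) {n : ℕ} (q : Fin n → ℤ) (Q : ℤ)
    (h : ∑ i, q i = Q) :
    A.prod q Q h ≫ rowMap f Q = tensorCosMap (fun i => rowMap f (q i)) ≫ B.prod q Q h := by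
  apply NatTrans.ext
  funext c
  refine tObj_hom_ext fun x => ?_
  refine (congrArg ((f.app c).f Q).hom (PiTensorProduct.lift.tprod (φ := (A.alg c).prod n q Q h) x)).trans ?_
  refine ((hf c).map_prod n q Q h x).trans ?_
  refine Eq.symm ((congrArg ((B.prod q Q h).app c).hom (PiTensorProduct.map_tprod _ _)).trans ?_)
  exact PiTensorProduct.lift.tprod (φ := (B.alg c).prod n q Q h) _

/-- The identity between rows of a cosimplicial complex if their indices agree, and zero
otherwise. -/
def rowId (K : CosimplicialObject (Dg k)) (q q' : ℤ) : row K q ⟶ row K q' :=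
  if h : q = q' then eqToHom (by rw [h]) else 0

lemma rowId_self (K : CosimplicialObject (Dg k)) (q : ℤ) : rowId K q q = 𝟙 _ := by simp [rowId]

lemma rowId_app_apply (K : CosimplicialObject (Dg k)) {q q' : ℤ} (h : q = q') (c : SimplexCategory)
    (x : (K.obj c).X q) : ((rowId K q q').app c).hom x = idMap (K.obj c) q q' x := by
  subst h
  rw [idMap_self, rowId_self]
  rfl

/-- The morphisms of rows which apply the differential to the `i`-th member of a family. -/
def rowStep (K : CosimplicialObject (Dg k)) {n : ℕ} (q : Fin n → ℤ) (i l : Fin n) :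
    row K (q l) ⟶ row K (MultiOp.stepDeg q i l) :=
  if l = i then rowD K _ _ else rowId K _ _

/-- The Leibniz rule is stated as an identity of morphisms of cosimplicial modules, so that the
naturality of an operation can be applied to the maps `rowStep`. -/
lemma prod_rowD {K : CosimplicialObject (Dg k)} (A : CosCDGA K) {n : ℕ} (q : Fin n → ℤ) (Q Q' : ℤ)
    (h : ∑ i, q i = Q) (hQ : Q + 1 = Q') (h' : ∀ i, ∑ l, MultiOp.stepDeg q i l = Q') :
    A.prod q Q h ≫ rowD K Q Q' = ∑ i, ((∑ l ∈ Finset.Iio i, q l).negOnePow : ℤ) •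
      (tensorCosMap (rowStep K q i) ≫ A.prod (MultiOp.stepDeg q i) Q' (h' i)) := by
  apply NatTrans.ext
  funext c
  rw [cosimplicial_sum_app]
  simp only [cosimplicial_zsmul_app]
  refine tObj_hom_ext fun x => ?_
  refine (congrArg ((K.obj c).d Q Q').hom (PiTensorProduct.lift.tprod (φ := (A.alg c).prod n q Q h) x)).trans ?_
  refine ((A.alg c).d_prod q Q Q' h hQ h' x).trans ?_
  refine Eq.trans (Finset.sum_congr rfl fun i _ => ?_) (moduleCat_sum_apply _ _ _).symm
  rw [Units.smul_def]
  refine congrArg (((∑ l ∈ Finset.Iio i, q l).negOnePow : ℤ) • ·) ?_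
  refine Eq.symm ((congrArg ((A.prod _ Q' (h' i)).app c).hom (PiTensorProduct.map_tprod _ _)).trans ?_)
  refine (PiTensorProduct.lift.tprod (φ := (A.alg c).prod n _ Q' (h' i)) _).trans ?_
  refine congrArg _ (funext fun l => ?_)
  by_cases hl : l = i
  · simp only [rowStep, hl, if_true]
    rfl
  · simp only [rowStep, hl, if_false]
    exact rowId_app_apply K (by simp [MultiOp.stepDeg, hl]) c _

end CosProd

/-! ### Shuffle signs after raising one degree -/

section ShuffleSteps
variable {n : ℕ}

/-- One more horizontal degree in place `i` is crossed by the vertical degrees of the earlier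
places. -/
lemma shuffleSign_stepDeg_left (p q : Fin n → ℤ) (i : Fin n) :
    shuffleSign (MultiOp.stepDeg p i) q =
      shuffleSign p q * (∑ l ∈ Finset.Iio i, q l).negOnePow := by
  rw [shuffleSign, shuffleSign, ← Int.negOnePow_add]
  congr 1
  rw [← Finset.sum_add_sum_compl {i} (fun j => ∑ l ∈ Finset.Iio j, q l * MultiOp.stepDeg p i j),
    ← Finset.sum_add_sum_compl {i} (fun j => ∑ l ∈ Finset.Iio j, q l * p j)]
  rw [Finset.sum_singleton, Finset.sum_singleton]
  have h1 : ∀ j ∈ ({i} : Finset (Fin n))ᶜ, ∑ l ∈ Finset.Iio j, q l * MultiOp.stepDeg p i j =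
      ∑ l ∈ Finset.Iio j, q l * p j := by
    intro j hj
    have : j ≠ i := by simpa using hj
    simp [MultiOp.stepDeg, this]
  rw [Finset.sum_congr rfl h1]
  simp only [MultiOp.stepDeg, Pi.add_apply, Pi.single_eq_same, mul_add, mul_one,
    Finset.sum_add_distrib]
  ring

/-- One more vertical degree in place `i` crosses the horizontal degrees of the later places. -/
lemma shuffleSign_stepDeg_right (p q : Fin n → ℤ) (i : Fin n) :
    shuffleSign p (MultiOp.stepDeg q i) =
      shuffleSign p q * (∑ j ∈ Finset.Ioi i, p j).negOnePow := by
  rw [shuffleSign, shuffleSign, ← Int.negOnePow_add]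
  congr 1
  have h1 : ∀ j, ∑ l ∈ Finset.Iio j, MultiOp.stepDeg q i l * p j =
      ∑ l ∈ Finset.Iio j, q l * p j + if i < j then p j else 0 := by
    intro j
    simp only [MultiOp.stepDeg, Pi.add_apply, add_mul, Finset.sum_add_distrib, Pi.single_apply,
      ite_mul, one_mul, zero_mul]
    rw [Finset.sum_ite_eq']
    simp
  rw [Finset.sum_congr rfl fun j _ => h1 j, Finset.sum_add_distrib]
  congr 1
  rw [← Finset.sum_filter]
  congr 1
  ext j
  simp

end ShuffleSteps

/-! ### The operad axioms for the action -/

section Algebra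
variable {k : Type w} [Field k]

lemma EZ.apply_map {n : ℕ} {r : ℤ} (z : EZ k n r)
    {A B : Fin n → CosimplicialObject (ModuleCat.{w} k)} (f : (i : Fin n) → (A i ⟶ B i))
    (d : Fin n → ℤ) (e : {e : ℤ // ∑ i, d i + r = e}) (a : (i : Fin n) → (normCplx.obj (A i)).X (d i)) :
    z.1 B d e (fun i => ((normCplx.map (f i)).f (d i)).hom (a i)) =
      ((normCplx.map (tensorCosMap f)).f e.1).hom (z.1 A d e a) :=
  (congrArg (fun φ : MultiOp _ _ r => φ d e a) (z.2 A B f)).symm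

lemma norm_zsmul_apply {A B : CosimplicialObject (ModuleCat.{w} k)} (m : ℤ) (f : A ⟶ B) (P : ℤ)
    (x : (normCplx.obj A).X P) :
    ((normCplx.map (m • f)).f P).hom x = m • ((normCplx.map f).f P).hom x := by
  rw [Functor.map_zsmul]
  rfl

lemma norm_sum_apply {ι : Type*} {A B : CosimplicialObject (ModuleCat.{w} k)} (s : Finset ι)
    (f : ι → (A ⟶ B)) (P : ℤ) (x : (normCplx.obj A).X P) :
    ((normCplx.map (∑ i ∈ s, f i)).f P).hom x = ∑ i ∈ s, ((normCplx.map (f i)).f P).hom x := by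
  rw [Functor.map_sum]
  have h : ((∑ i ∈ s, normCplx.map (f i)).f P) = ∑ i ∈ s, (normCplx.map (f i)).f P :=
    map_sum (HomologicalComplex.Hom.fAddMonoidHom P) _ _
  rw [h, moduleCat_sum_apply]

lemma norm_comp_apply {A B C : CosimplicialObject (ModuleCat.{w} k)} (f : A ⟶ B) (g : B ⟶ C) (P : ℤ)
    (x : (normCplx.obj A).X P) :
    ((normCplx.map g).f P).hom (((normCplx.map f).f P).hom x) =
      ((normCplx.map (f ≫ g)).f P).hom x := by
  rw [Functor.map_comp]
  rfl

lemma multilinear_units_smul {n : ℕ} {M : Fin n → Type*} {N : Type*} [∀ i, AddCommGroup (M i)]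
    [∀ i, Module k (M i)] [AddCommGroup N] [Module k N] (φ : MultilinearMap k M N) (c : Fin n → ℤˣ)
    (x : (i : Fin n) → M i) : φ (fun i => c i • x i) = (∏ i, c i) • φ x := by
  rw [Units.smul_def, Units.coe_prod]
  exact (φ.restrictScalars ℤ).map_smul_univ (fun i => (c i : ℤ)) x

/-- Naturality of `z` moves the maps of rows out of `z`, multiplicativity of `f` moves them past the
product, and the signs depend on degrees alone. -/
lemma ezOp_hom {K L : CosimplicialObject (Dg k)} (A : CosCDGA K) (B : CosCDGA L)
    (f : K ⟶ L) (hf : ∀ c, IsCDGAHom (A.alg c) (B.alg c) (f.app c)) {n : ℕ} {r : ℤ} (z : EZ k n r) :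
    MultiOp.post (totN.map f) (ezOp A z) = MultiOp.pre (ezOp B z) (fun _ => totN.map f) := by
  refine ((isFinitary_ezOp A z).post f).ext ((isFinitary_ezOp B z).pre f) fun p q d hd e a => ?_
  have hPQ : ∑ i, p i + r + ∑ i, q i = e.1 := by
    rw [← e.2, Finset.sum_congr rfl fun i _ => (hd i).symm, Finset.sum_add_distrib]; ring
  change ((totN.map f).f e.1).hom (ezOp A z d e _) =
    ezOp B z d e (fun i => ((totN.map f).f (d i)).hom (totHom K (p i) (q i) (d i) (hd i) (a i)))
  simp only [map_totHom]
  rw [ezOp_totHom A z p q d hd e a _ _ hPQ rfl rfl, ezOp_totHom B z p q d hd e _ _ _ hPQ rfl rfl,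
    map_totHom]
  congr 1
  rw [Units.smul_def, Units.smul_def, map_zsmul]
  congr 1
  rw [norm_comp_apply, tensorCosMap_rowMap_prod A B f hf]
  refine (norm_comp_apply _ _ _ _).symm.trans (congrArg _ ?_)
  exact (EZ.apply_map z (fun i => rowMap f (q i)) p ⟨_, rfl⟩ a).symm

variable {K : CosimplicialObject (Dg k)} (A : CosCDGA K)

/-- The permuted `z` carries the Koszul sign of the horizontal degrees, commutativity of the product
that of the vertical degrees, and the permuted operation on total complexes that of the total
degrees. `shuffleSign_mul_koszulSign` relates the three. -/
lemma ezOp_perm {n : ℕ} {r : ℤ} (σ : Equiv.Perm (Fin n)) (z : EZ k n r) :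
    ezOp A (EZ.perm σ z) = MultiOp.perm (K := fun _ => totN.obj K) σ (ezOp A z) := by
  refine (isFinitary_ezOp A _).ext ((isFinitary_ezOp A z).perm σ) fun p q d hd e a => ?_
  have hPQ : ∑ i, p i + r + ∑ i, q i = e.1 := by
    rw [← e.2, Finset.sum_congr rfl fun i _ => (hd i).symm, Finset.sum_add_distrib]; ring
  have hP : ∑ i, p (σ.symm i) + r = ∑ i, p i + r := by rw [Equiv.sum_comp σ.symm p]
  have hQ : ∑ i, q (σ.symm i) = ∑ i, q i := Equiv.sum_comp σ.symm q
  rw [ezOp_totHom A _ p q d hd e a _ _ hPQ rfl rfl]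
  have e1 : MultiOp.perm (K := fun _ => totN.obj K) σ (ezOp A z) d e
      (fun i => totHom K (p i) (q i) (d i) (hd i) (a i)) = MultiOp.koszulSign σ d •
        ezOp A z (fun i => d (σ.symm i)) ⟨e.1, by rw [Equiv.sum_comp σ.symm d]; exact e.2⟩
          (fun i => totHom K (p (σ.symm i)) (q (σ.symm i)) (d (σ.symm i)) (hd _) (a (σ.symm i))) :=
    rfl
  have e2 : (EZ.perm σ z).1 (fun i => row K (q i)) p ⟨∑ i, p i + r, rfl⟩ a =
      MultiOp.koszulSign σ p • ((normCplx.map (tensorCosPerm (fun i => row K (q i)) σ)).f (∑ i, p i + r)).hom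
        (z.1 (fun i => row K (q (σ.symm i))) (fun i => p (σ.symm i)) ⟨∑ i, p i + r, hP⟩
          (fun i => a (σ.symm i))) := rfl
  rw [e1, e2, ezOp_totHom A z (fun i => p (σ.symm i)) (fun i => q (σ.symm i)) _ (fun i => hd _) _ _
    _ _ hPQ hP hQ, Units.smul_def, Units.smul_def, Units.smul_def, Units.smul_def]
  refine Eq.trans (congrArg _ ?_) (map_zsmul (totHom K _ _ _ hPQ) _ _)
  rw [map_zsmul, norm_comp_apply, tensorCosPerm_prod A σ q _ rfl hQ, norm_zsmul_apply, smul_smul,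
    smul_smul, smul_smul, ← Units.val_mul, ← Units.val_mul, ← Units.val_mul, mul_assoc,
    shuffleSign_mul_koszulSign]
  simp only [hd]

lemma ezOp_one : ezOp A (EZ.one k) = MultiOp.one (fun _ => totN.obj K) := by
  refine (isFinitary_ezOp A _).ext (isFinitary_one K) fun p q d hd e a => ?_
  have hP : ∑ i, p i + 0 = p 0 := by simp
  have hQ : ∑ i, q i = q 0 := by simp
  have he : d 0 = e.1 := by rw [← e.2]; simp
  rw [ezOp_totHom A _ p q d hd e a _ _ ((hd 0).trans he) hP hQ]
  have e1 : (EZ.one k).1 (fun i => row K (q i)) p ⟨p 0, hP⟩ a =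
      ((normCplx.map (tensorCosOne fun i => row K (q i))).f (p 0)).hom
        (idMap (normCplx.obj (row K (q 0))) (p 0) (p 0) (a 0)) := rfl
  have e2 : MultiOp.one (fun _ => totN.obj K) d e
      (fun i => totHom K (p i) (q i) (d i) (hd i) (a i)) =
        idMap (totN.obj K) (d 0) e.1 (totHom K (p 0) (q 0) (d 0) (hd 0) (a 0)) := rfl
  rw [e1, e2, idMap_totHom _ _ _ _ _ _ he, norm_comp_apply, tensorCosOne_prod A q hQ, idMap_self]
  have e3 : shuffleSign p q = 1 := by
    rw [shuffleSign, Fin.sum_univ_one, Finset.sum_eq_zero fun i hi => by simp at hi]; simp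
  rw [e3, one_smul, CategoryTheory.Functor.map_id]
  rfl

lemma finSigmaFinEquiv_lt {n : ℕ} {m : Fin n → ℕ} {i i' : Fin n} (j : Fin (m i)) (j' : Fin (m i'))
    (h : i' < i) : (finSigmaFinEquiv ⟨i', j'⟩ : Fin (∑ i, m i)) < finSigmaFinEquiv ⟨i, j⟩ := by
  have e : ∀ (i : Fin n), ∑ l : Fin i, m (Fin.castLE i.2.le l) = ∑ l ∈ Finset.Iio i, m l := by
    intro i
    refine Finset.sum_bij (fun l _ => Fin.castLE i.2.le l) (fun l _ => by
      simp [Fin.lt_def]) (fun l _ l' _ h => by simpa using h) (fun l hl => ?_) fun _ _ => rfl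
    simp only [Finset.mem_Iio, Fin.lt_def] at hl
    exact ⟨⟨l, hl⟩, Finset.mem_univ _, rfl⟩
  rw [Fin.lt_def, finSigmaFinEquiv_apply, finSigmaFinEquiv_apply]
  dsimp only
  rw [e, e]
  have h1 : ∑ l ∈ Finset.Iio i', m l + m i' ≤ ∑ l ∈ Finset.Iio i, m l := by
    rw [add_comm, ← Finset.sum_insert (by simp)]
    refine Finset.sum_le_sum_of_subset fun l hl => ?_
    simp only [Finset.mem_insert, Finset.mem_Iio] at hl ⊢
    rcases hl with rfl | hl
    · exact h
    · exact hl.trans h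
  have := j'.2
  omega

/-- The order on the flattened index set is lexicographic: an increasing pair consists of arbitrary
members of two different blocks in increasing order, or of an increasing pair inside one block. -/
lemma sum_lt_flatten {n : ℕ} {m : Fin n → ℕ} (t : Fin (∑ i, m i) → Fin (∑ i, m i) → ℤ) :
    ∑ l, ∑ l' ∈ Finset.Iio l, t l' l =
      ∑ i, ∑ i' ∈ Finset.Iio i, ∑ j, ∑ j',
        t (finSigmaFinEquiv ⟨i', j'⟩) (finSigmaFinEquiv ⟨i, j⟩) +
      ∑ i, ∑ j, ∑ j' ∈ Finset.Iio j,
        t (finSigmaFinEquiv ⟨i, j'⟩) (finSigmaFinEquiv ⟨i, j⟩) := by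
  have e0 : ∀ {N : ℕ} (l : Fin N) (f : Fin N → ℤ),
      ∑ l' ∈ Finset.Iio l, f l' = ∑ l', if l' < l then f l' else 0 := fun l f => by
    rw [← Finset.sum_filter]
    congr 1
    ext; simp
  simp only [e0]
  rw [← MultiOp.sum_sigma]
  simp only [← MultiOp.sum_sigma fun l' => if l' < _ then t l' _ else 0]
  rw [← Finset.sum_add_distrib]
  refine Finset.sum_congr rfl fun i _ => ?_
  have e1 : ∀ i' : Fin n, (if i' < i then ∑ j, ∑ j',
      t (finSigmaFinEquiv ⟨i', j'⟩) (finSigmaFinEquiv ⟨i, j⟩) else 0) = ∑ j, ∑ j',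
        if i' < i then t (finSigmaFinEquiv ⟨i', j'⟩) (finSigmaFinEquiv ⟨i, j⟩) else 0 := by
    intro i'
    split_ifs <;> simp
  simp only [e1]
  refine Eq.trans ?_ (congrArg (· + _) Finset.sum_comm)
  rw [← Finset.sum_add_distrib]
  refine Finset.sum_congr rfl fun j _ => ?_
  rw [← Finset.sum_erase_add _ _ (Finset.mem_univ i),
    ← Finset.sum_erase_add (f := fun i' => ∑ j', if i' < i then
      t (finSigmaFinEquiv ⟨i', j'⟩) (finSigmaFinEquiv ⟨i, j⟩) else 0) _ (Finset.mem_univ i)]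
  simp only [lt_self_iff_false, if_false, Finset.sum_const_zero, add_zero]
  congr 1
  · refine Finset.sum_congr rfl fun i' hi' => Finset.sum_congr rfl fun j' _ => ?_
    rcases lt_or_gt_of_ne (Finset.ne_of_mem_erase hi') with h | h
    · rw [if_pos h, if_pos (finSigmaFinEquiv_lt j j' h)]
    · rw [if_neg h.not_gt, if_neg (finSigmaFinEquiv_lt j' j h).not_gt]
  · refine Finset.sum_congr rfl fun j' _ => ?_
    congr 1
    rw [Fin.lt_def, Fin.lt_def, finSigmaFinEquiv_apply, finSigmaFinEquiv_apply]
    simp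

/-- Separating all degrees at once is compared with separating them inside the blocks and then
between the outputs of the blocks. On the right the vertical degrees of an earlier block are moved
past the degree `s j` twice, once in the composition sign and once in the outer shuffle, and these
contributions cancel. -/
lemma shuffleSign_flatten {n : ℕ} {m : Fin n → ℕ} (p q : Fin (∑ i, m i) → ℤ) (s : Fin n → ℤ) :
    shuffleSign p q * (∑ j, ∑ i ∈ Finset.Iio j, s j * ∑ l, p (finSigmaFinEquiv ⟨i, l⟩)).negOnePow =
      (∑ j, ∑ i ∈ Finset.Iio j, s j * ∑ l, (p (finSigmaFinEquiv ⟨i, l⟩) +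
        q (finSigmaFinEquiv ⟨i, l⟩))).negOnePow *
      (shuffleSign (fun i => ∑ j, p (finSigmaFinEquiv ⟨i, j⟩) + s i)
        (fun i => ∑ j, q (finSigmaFinEquiv ⟨i, j⟩)) *
      ∏ i, shuffleSign (fun j => p (finSigmaFinEquiv ⟨i, j⟩))
        (fun j => q (finSigmaFinEquiv ⟨i, j⟩))) := by
  simp only [shuffleSign]
  rw [← negOnePow_sum, sum_lt_flatten fun l' l => q l' * p l, ← Int.negOnePow_add,
    ← Int.negOnePow_add, ← Int.negOnePow_add, Int.negOnePow_eq_iff]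
  simp only [Finset.sum_add_distrib, mul_add, ← Finset.mul_sum, ← Finset.sum_mul]
  refine ⟨-∑ j, (∑ i ∈ Finset.Iio j, ∑ l, q (finSigmaFinEquiv ⟨i, l⟩)) * s j, ?_⟩
  simp only [mul_comm (s _)]
  ring

/-- The composite multiplies within the blocks before `z` is applied. Naturality of `z` postpones
these products, and associativity merges them with the outer product into a single one. -/
lemma ezOp_comp {n : ℕ} {m : Fin n → ℕ} {r : ℤ} {s : Fin n → ℤ} (z : EZ k n r)
    (y : (i : Fin n) → EZ k (m i) (s i)) :
    ezOp A (EZ.comp z y) =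
      MultiOp.comp (K := fun _ => totN.obj K) (ezOp A z) fun i => ezOp A (y i) := by
  refine (isFinitary_ezOp A _).ext ((isFinitary_ezOp A z).comp fun i => isFinitary_ezOp A (y i))
    fun p q d hd e a => ?_
  obtain rfl : d = fun i => p i + q i := funext fun i => (hd i).symm
  have hPQ : ∑ i, p i + (r + ∑ i, s i) + ∑ i, q i = e.1 := by
    rw [← e.2, Finset.sum_add_distrib]; ring
  have hP : ∑ i, (∑ j, p (finSigmaFinEquiv ⟨i, j⟩) + s i) + r = ∑ i, p i + (r + ∑ i, s i) := by
    rw [Finset.sum_add_distrib, MultiOp.sum_sigma]; ring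
  have hQ : ∑ i, ∑ j, q (finSigmaFinEquiv ⟨i, j⟩) = ∑ i, q i := MultiOp.sum_sigma q
  have hd' : ∀ i, ∑ j, p (finSigmaFinEquiv ⟨i, j⟩) + s i + ∑ j, q (finSigmaFinEquiv ⟨i, j⟩) =
      ∑ j, (p (finSigmaFinEquiv ⟨i, j⟩) + q (finSigmaFinEquiv ⟨i, j⟩)) + s i := fun i => by
    rw [Finset.sum_add_distrib]; ring
  rw [ezOp_totHom A _ p q _ hd e a _ _ hPQ rfl rfl]
  have e1 : MultiOp.comp (K := fun _ => totN.obj K) (ezOp A z) (fun i => ezOp A (y i))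
      (fun i => p i + q i) e (fun i => totHom K (p i) (q i) (p i + q i) (hd i) (a i)) =
      (∑ j, ∑ i ∈ Finset.Iio j, s j * ∑ l, (p (finSigmaFinEquiv ⟨i, l⟩) +
        q (finSigmaFinEquiv ⟨i, l⟩))).negOnePow •
      ezOp A z (fun i => ∑ j, (p (finSigmaFinEquiv ⟨i, j⟩) + q (finSigmaFinEquiv ⟨i, j⟩)) + s i)
        ⟨e.1, by
          rw [Finset.sum_add_distrib, MultiOp.sum_sigma fun l => p l + q l, add_assoc, add_comm _ r]
          exact e.2⟩
        fun i => ezOp A (y i)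
          (fun j => p (finSigmaFinEquiv ⟨i, j⟩) + q (finSigmaFinEquiv ⟨i, j⟩)) ⟨_, rfl⟩ fun j =>
            totHom K (p (finSigmaFinEquiv ⟨i, j⟩)) (q (finSigmaFinEquiv ⟨i, j⟩)) _ rfl
              (a (finSigmaFinEquiv ⟨i, j⟩)) := rfl
  have e2 : (EZ.comp z y).1 (fun i => row K (q i)) p ⟨∑ i, p i + (r + ∑ i, s i), rfl⟩ a =
      (∑ j, ∑ i ∈ Finset.Iio j, s j * ∑ l, p (finSigmaFinEquiv ⟨i, l⟩)).negOnePow •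
      ((normCplx.map (tensorCosFlatten fun i => row K (q i))).f
        (∑ i, p i + (r + ∑ i, s i))).hom
        (z.1 (fun i => tensorCos fun j => row K (q (finSigmaFinEquiv ⟨i, j⟩)))
          (fun i => ∑ j, p (finSigmaFinEquiv ⟨i, j⟩) + s i) ⟨∑ i, p i + (r + ∑ i, s i), hP⟩
          fun i => (y i).1 (fun j => row K (q (finSigmaFinEquiv ⟨i, j⟩)))
            (fun j => p (finSigmaFinEquiv ⟨i, j⟩)) ⟨_, rfl⟩
            fun j => a (finSigmaFinEquiv ⟨i, j⟩)) := rfl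
  have e3 : ∀ i, ezOp A (y i) (fun j => p (finSigmaFinEquiv ⟨i, j⟩) + q (finSigmaFinEquiv ⟨i, j⟩))
      ⟨_, rfl⟩ (fun j => totHom K (p (finSigmaFinEquiv ⟨i, j⟩)) (q (finSigmaFinEquiv ⟨i, j⟩)) _ rfl
        (a (finSigmaFinEquiv ⟨i, j⟩))) = _ := fun i =>
    ezOp_totHom A (y i) (fun j => p (finSigmaFinEquiv ⟨i, j⟩)) (fun j => q (finSigmaFinEquiv ⟨i, j⟩))
      _ (fun _ => rfl) ⟨_, rfl⟩ (fun j => a (finSigmaFinEquiv ⟨i, j⟩)) _ _ (hd' i) rfl rfl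
  rw [e1, e2]
  simp only [e3]
  rw [ezOp_totHom A z _ _ _ hd' _ _ _ _ hPQ hP hQ]
  -- The signs of the inner operations are pulled out of `z` by multilinearity; then naturality
  -- moves `z` inside the products of the blocks.
  rw [multilinear_units_smul, EZ.apply_map z
    (fun i => A.prod (fun j => q (finSigmaFinEquiv ⟨i, j⟩)) _ rfl)]
  simp only [Units.smul_def]
  refine Eq.trans (congrArg _ ?_) (map_zsmul (totHom K _ _ _ hPQ) _ _)
  rw [map_zsmul, map_zsmul, norm_comp_apply, norm_comp_apply, tensorCosFlatten_prod A q _ rfl hQ,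
    smul_smul, smul_smul, smul_smul, ← Units.val_mul, ← Units.val_mul, ← Units.val_mul,
    shuffleSign_flatten, mul_assoc]

/-- The family obtained from `x` by applying the differential to its `i`-th member. -/
def stepArg {n : ℕ} {M : Fin n → Dg k} (p : Fin n → ℤ) (x : (l : Fin n) → (M l).X (p l))
    (i l : Fin n) : (M l).X (MultiOp.stepDeg p i l) :=
  if l = i then ((M l).d (p l) (MultiOp.stepDeg p i l)).hom (x l)
    else idMap (M l) (p l) (MultiOp.stepDeg p i l) (x l)

lemma bdTerm_apply {n : ℕ} {M : Fin n → Dg k} {L : Dg k} {r : ℤ} (φ : MultiOp M L r)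
    (d : Fin n → ℤ) (e : {e : ℤ // ∑ i, d i + (r + 1) = e}) (i : Fin n)
    (x : (l : Fin n) → (M l).X (d l)) : MultiOp.bdTerm φ d e i x =
      φ (MultiOp.stepDeg d i) ⟨e.1, by rw [MultiOp.sum_stepDeg]; have := e.2; omega⟩
        (stepArg d x i) := by
  rw [MultiOp.bdTerm, MultilinearMap.compLinearMap_apply]
  congr 1
  funext l
  rw [stepArg]
  split_ifs <;> rfl

lemma bd_apply {n : ℕ} {M : Fin n → Dg k} {L : Dg k} {r : ℤ} (φ : MultiOp M L r)
    (d : Fin n → ℤ) (e : {e : ℤ // ∑ i, d i + (r + 1) = e})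
    (x : (l : Fin n) → (M l).X (d l)) : MultiOp.bd φ d e x =
      (L.d (∑ i, d i + r) e.1).hom (φ d ⟨_, rfl⟩ x) - r.negOnePow •
        ∑ i, (∑ l ∈ Finset.Iio i, d l).negOnePow •
          φ (MultiOp.stepDeg d i) ⟨e.1, by rw [MultiOp.sum_stepDeg]; have := e.2; omega⟩
            (stepArg d x i) := by
  simp only [MultiOp.bd, Units.smul_def, sub_apply, smul_apply, sum_apply, bdTerm_apply]
  rfl

lemma normCplx_map_rowId (K : CosimplicialObject (Dg k)) {q q' : ℤ} (h : q = q') (P n n' : ℤ)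
    (hn : P + q = n) (hn' : P + q' = n') (hnn : n = n') (a : (normCplx.obj (row K q)).X P) :
    totHom K P q' n' hn' (((normCplx.map (rowId K q q')).f P).hom a) =
      idMap (totN.obj K) n n' (totHom K P q n hn a) := by
  subst h hnn
  rw [rowId_self, CategoryTheory.Functor.map_id, idMap_self]
  rfl

lemma totHom_idMap (K : CosimplicialObject (Dg k)) {P P' : ℤ} (h : P = P') (q n n' : ℤ)
    (hn : P + q = n) (hn' : P' + q = n') (hnn : n = n') (a : (normCplx.obj (row K q)).X P) :
    totHom K P' q n' hn' (idMap (normCplx.obj (row K q)) P P' a) =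
      idMap (totN.obj K) n n' (totHom K P q n hn a) := by
  subst h hnn
  rw [idMap_self, idMap_self]

lemma stepDeg_self {n : ℕ} (d : Fin n → ℤ) (i : Fin n) : MultiOp.stepDeg d i i = d i + 1 := by
  simp [MultiOp.stepDeg]

lemma stepDeg_of_ne {n : ℕ} (d : Fin n → ℤ) {i l : Fin n} (h : l ≠ i) :
    MultiOp.stepDeg d i l = d l := by
  simp [MultiOp.stepDeg, h]

lemma stepDeg_add {n : ℕ} {p q d : Fin n → ℤ} (hd : ∀ i, p i + q i = d i) (i l : Fin n) :
    MultiOp.stepDeg p i l + q l = MultiOp.stepDeg d i l := by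
  simp only [MultiOp.stepDeg, Pi.add_apply, ← hd]; ring

lemma stepDeg_add' {n : ℕ} {p q d : Fin n → ℤ} (hd : ∀ i, p i + q i = d i) (i l : Fin n) :
    p l + MultiOp.stepDeg q i l = MultiOp.stepDeg d i l := by
  simp only [MultiOp.stepDeg, Pi.add_apply, ← hd]; ring

/-- The differential of the `i`-th argument is a sum of a horizontal and a vertical term, and a
multilinear map splits accordingly. The statement is needed with families whose members are all
written by `totHom`, since only those can be inserted in `ezOp_totHom`. -/
lemma multilinear_stepArg_totHom {n : ℕ} (p q d : Fin n → ℤ) (hd : ∀ i, p i + q i = d i)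
    (a : (i : Fin n) → (normCplx.obj (row K (q i))).X (p i)) (i : Fin n) {N : Type w}
    [AddCommGroup N] [Module k N]
    (φ : MultilinearMap k (fun l => (totN.obj K).X (MultiOp.stepDeg d i l)) N) :
    φ (stepArg (M := fun _ => totN.obj K) d
        (fun l => totHom K (p l) (q l) (d l) (hd l) (a l)) i) =
      φ (fun l => totHom K (MultiOp.stepDeg p i l) (q l) _ (stepDeg_add hd i l)
        (stepArg (M := fun l => normCplx.obj (row K (q l))) p a i l)) +
      (p i).negOnePow • φ (fun l => totHom K (p l) (MultiOp.stepDeg q i l) _ (stepDeg_add' hd i l)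
        (((normCplx.map (rowStep K q i l)).f (p l)).hom (a l))) := by
  set xH : (l : Fin n) → (totN.obj K).X (MultiOp.stepDeg d i l) :=
    fun l => totHom K (MultiOp.stepDeg p i l) (q l) _ (stepDeg_add hd i l)
        (stepArg (M := fun l => normCplx.obj (row K (q l))) p a i l) with hxH
  set xV : (l : Fin n) → (totN.obj K).X (MultiOp.stepDeg d i l) :=
    fun l => totHom K (p l) (MultiOp.stepDeg q i l) _ (stepDeg_add' hd i l)
        (((normCplx.map (rowStep K q i l)).f (p l)).hom (a l)) with hxV
  have e1 : stepArg (M := fun _ => totN.obj K) d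
      (fun l => totHom K (p l) (q l) (d l) (hd l) (a l)) i =
      Function.update xH i (xH i + ((p i).negOnePow : ℤ) • xV i) := by
    funext l
    by_cases hl : l = i
    · subst hl
      rw [Function.update_self, stepArg, if_pos rfl, hxH, hxV]
      dsimp only
      rw [d_totHom K (p l) (q l) (d l) (MultiOp.stepDeg p l l) (MultiOp.stepDeg q l l) _ (hd l)
        (stepDeg_self p l).symm (stepDeg_self q l).symm (stepDeg_add hd l l) (stepDeg_add' hd l l),
        stepArg, if_pos rfl, rowStep, if_pos rfl, Units.smul_def]
    · rw [Function.update_of_ne hl, hxH, stepArg, if_neg hl]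
      dsimp only
      rw [stepArg, if_neg hl]
      exact (totHom_idMap K (stepDeg_of_ne p hl).symm _ _ _ (hd l) _ (stepDeg_of_ne d hl).symm _).symm
  -- Away from `i`, both families consist of the original arguments with renamed degrees.
  have e2 : Function.update xH i (xV i) = xV := by
    funext l
    by_cases hl : l = i
    · subst hl; rw [Function.update_self]
    · rw [Function.update_of_ne hl, hxH, hxV]
      dsimp only
      rw [stepArg, if_neg hl, rowStep, if_neg hl,
        totHom_idMap K (stepDeg_of_ne p hl).symm _ _ _ (hd l) _ (stepDeg_of_ne d hl).symm,
        normCplx_map_rowId K (stepDeg_of_ne q hl).symm _ _ _ (hd l) _ (stepDeg_of_ne d hl).symm]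
  rw [e1, φ.map_update_add, Function.update_eq_self, Units.smul_def]
  congr 1
  refine ((φ.restrictScalars ℤ).map_update_smul xH i _ (xV i)).trans ?_
  exact congrArg _ (congrArg φ e2)

/-- The horizontal terms on the right give the differential of `z`. The vertical terms have to
cancel: by naturality `z` commutes with vertical differentials of its arguments, and by the Leibniz
rule their sum is the vertical differential of the product. `B i` and `Cc i` below are the
horizontal and the vertical contribution of the `i`-th argument. -/
lemma ezOp_bd {n : ℕ} {r : ℤ} (z : EZ k n r) :
    ezOp A (EZ.bd z) = MultiOp.bd (ezOp A z) := by
  refine (isFinitary_ezOp A _).ext (isFinitary_ezOp A z).bd fun p q d hd e a => ?_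
  have hd' : ∑ i, d i = ∑ i, p i + ∑ i, q i := by
    rw [← Finset.sum_add_distrib]; exact Finset.sum_congr rfl fun i _ => (hd i).symm
  have hPQ : ∑ i, p i + (r + 1) + ∑ i, q i = e.1 := by rw [← e.2, hd']; ring
  have hPQ' : ∑ i, p i + r + (∑ i, q i + 1) = e.1 := by rw [← e.2, hd']; ring
  have hPQ0 : ∑ i, p i + r + ∑ i, q i = ∑ i, d i + r := by rw [hd']; ring
  have hp' : ∀ i, ∑ l, MultiOp.stepDeg p i l + r = ∑ i, p i + (r + 1) := fun i => by
    rw [MultiOp.sum_stepDeg]; ring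
  have hq' : ∀ i, ∑ l, MultiOp.stepDeg q i l = ∑ i, q i + 1 := fun i => MultiOp.sum_stepDeg q i
  set W := z.1 (fun i => row K (q i)) p ⟨∑ i, p i + r, rfl⟩ a with hW
  set B := fun i => ((normCplx.map (A.prod q _ rfl)).f (∑ i, p i + (r + 1))).hom
    (z.1 (fun i => row K (q i)) (MultiOp.stepDeg p i) ⟨∑ i, p i + (r + 1), hp' i⟩
      (stepArg (M := fun l => normCplx.obj (row K (q l))) p a i)) with hB
  set Cc := fun i => ((normCplx.map (tensorCosMap (rowStep K q i) ≫
    A.prod (MultiOp.stepDeg q i) _ (hq' i))).f (∑ i, p i + r)).hom W with hC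
  have e2 : ∀ i, z.1 (fun l => row K (MultiOp.stepDeg q i l)) p ⟨∑ i, p i + r, rfl⟩
      (fun l => ((normCplx.map (rowStep K q i l)).f (p l)).hom (a l)) =
        ((normCplx.map (tensorCosMap (rowStep K q i))).f (∑ i, p i + r)).hom W := fun i =>
    EZ.apply_map z (rowStep K q i) p ⟨_, rfl⟩ a
  have e1 : ∀ i, ezOp A z (MultiOp.stepDeg d i)
      ⟨e.1, by rw [MultiOp.sum_stepDeg]; have := e.2; omega⟩
      (stepArg (M := fun _ => totN.obj K) d
        (fun l => totHom K (p l) (q l) (d l) (hd l) (a l)) i) =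
      totHom K _ _ e.1 hPQ (shuffleSign (MultiOp.stepDeg p i) q • B i) + (p i).negOnePow •
        totHom K _ _ e.1 hPQ' (shuffleSign p (MultiOp.stepDeg q i) • Cc i) := fun i => by
    refine (multilinear_stepArg_totHom p q d hd a i (ezOp A z (MultiOp.stepDeg d i) _)).trans ?_
    refine congrArg₂ (fun x y => x + (p i).negOnePow • y) ?_ ?_
    · exact ezOp_totHom A z _ q _ (stepDeg_add hd i) _ _ _ _ hPQ (hp' i) rfl
    · refine (ezOp_totHom A z p _ _ (stepDeg_add' hd i) _ _ _ _ hPQ' rfl (hq' i)).trans ?_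
      rw [hC]
      dsimp only
      rw [← norm_comp_apply, ← e2]
  -- The product induces a map of complexes on normalizations, so the horizontal differential may be
  -- taken after it.
  have e3 : ((normCplx.map (A.prod q _ rfl)).f (∑ i, p i + (r + 1))).hom
      ((EZ.bd z).1 (fun i => row K (q i)) p ⟨∑ i, p i + (r + 1), rfl⟩ a) =
      ((normCplx.obj (row K (∑ i, q i))).d (∑ i, p i + r) (∑ i, p i + (r + 1))).hom
        (((normCplx.map (A.prod q _ rfl)).f (∑ i, p i + r)).hom W) -
      r.negOnePow • ∑ i, (∑ l ∈ Finset.Iio i, p l).negOnePow • B i := by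
    refine (congrArg _ (bd_apply (z.1 fun i => row K (q i)) p _ a)).trans ?_
    simp only [Units.smul_def, map_sub, map_zsmul, map_sum]
    refine congrArg (· - _) ?_
    exact (ConcreteCategory.congr_hom
      ((normCplx.map (A.prod q _ rfl)).comm (∑ i, p i + r) (∑ i, p i + (r + 1))) W).symm
  -- The vertical differential of the value, expanded by the Leibniz rule.
  have e4 : ((normCplx.map (rowD K (∑ i, q i) (∑ i, q i + 1))).f (∑ i, p i + r)).hom
      (((normCplx.map (A.prod q _ rfl)).f (∑ i, p i + r)).hom W) =
        ∑ i, ((∑ l ∈ Finset.Iio i, q l).negOnePow : ℤ) • Cc i := by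
    rw [norm_comp_apply, prod_rowD A q _ _ rfl rfl hq', norm_sum_apply]
    exact Finset.sum_congr rfl fun i _ => norm_zsmul_apply _ _ _ _
  rw [bd_apply, ezOp_totHom A _ p q d hd e a _ _ hPQ rfl rfl,
    ezOp_totHom A z p q d hd _ a _ _ hPQ0 rfl rfl]
  rw [e3, d_totHom K _ _ _ _ _ _ hPQ0 (add_assoc _ _ _) rfl hPQ hPQ']
  simp only [e1, shuffleSign_stepDeg_left, shuffleSign_stepDeg_right]
  have e5 : ∀ i, (∑ l ∈ Finset.Iio i, d l).negOnePow = (∑ l ∈ Finset.Iio i, p l).negOnePow *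
      (∑ l ∈ Finset.Iio i, q l).negOnePow := fun i => by
    rw [← Int.negOnePow_add, ← Finset.sum_add_distrib]
    simp only [hd]
  -- The sign of the vertical differential of the value is distributed over the places before `i`,
  -- `i` itself, the places after `i` and `z`, which are the sources of signs in the `i`-th vertical
  -- term.
  have e6 : ∀ i, (∑ i, p i + r).negOnePow = (∑ l ∈ Finset.Iio i, p l).negOnePow *
      (p i).negOnePow * (∑ l ∈ Finset.Ioi i, p l).negOnePow * r.negOnePow := fun i => by
    rw [← Int.negOnePow_add, ← Int.negOnePow_add, ← Int.negOnePow_add]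
    congr 2
    rw [← Finset.sum_filter_add_sum_filter_not Finset.univ (fun l => l < i), add_assoc]
    have e7 : Finset.univ.filter (fun l => l < i) = Finset.Iio i := by ext; simp
    have e8 : Finset.univ.filter (fun l => ¬ l < i) = insert i (Finset.Ioi i) := by
      ext l; simp [le_iff_eq_or_lt]
    rw [e7, e8, Finset.sum_insert (by simp)]
  simp only [Units.smul_def, map_sub, map_zsmul, map_sum, smul_add, smul_sub, Finset.smul_sum,
    Finset.sum_add_distrib, smul_smul, e5]
  rw [sub_eq_add_neg, sub_eq_add_neg, add_assoc]
  congr 1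
  -- In the horizontal terms the vertical degrees before `i` occur twice: in the Koszul sign of the
  -- differential and in the changed shuffle sign.
  have e9 : ∀ (u : ℤˣ) (v : ℤ), (u : ℤ) * (u * v) = v := fun u v => by
    rw [← mul_assoc, ← Units.val_mul, Int.units_mul_self, Units.val_one, one_mul]
  have e10 : ∀ {M : Type w} [AddCommGroup M] {x y s t : M}, x = y → s = t →
      -x = s + -(y + t) := by
    rintro M _ x _ s _ rfl rfl
    abel
  rw [← hW, e4, map_sum, Finset.smul_sum]
  refine e10 ?_ ?_
  · refine Finset.sum_congr rfl fun i _ => ?_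
    congr 1
    push_cast
    linear_combination -((r.negOnePow : ℤ) * (∑ l ∈ Finset.Iio i, p l).negOnePow *
      e9 (∑ l ∈ Finset.Iio i, q l).negOnePow (shuffleSign p q))
  · refine Finset.sum_congr rfl fun i _ => ?_
    rw [map_zsmul, smul_smul, e6 i]
    congr 1
    push_cast
    ring

lemma isEZAlgebra_ezAct : IsEZAlgebra (totN.obj K) (ezAct A) where
  act_bd _ _ z := ezOp_bd A z
  act_perm _ _ σ z := ezOp_perm A σ z
  act_comp _ _ _ _ z y := ezOp_comp A z y
  act_one := ezOp_one A

lemma isEZHom_totN_map {L : CosimplicialObject (Dg k)} (B : CosCDGA L) (f : K ⟶ L)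
    (hf : ∀ c, IsCDGAHom (A.alg c) (B.alg c) (f.app c)) :
    IsEZHom (ezAct A) (ezAct B) (totN.map f) :=
  fun _ _ z => ezOp_hom A B f hf z

end Algebra

/-! ### Stalks of presheaves of commutative differential graded algebras -/

section Germ
variable {k : Type w} [Field k] {C : Type w} [SmallCategory C] {J : GrothendieckTopology C}
  (Φ : GrothendieckTopology.Point.{w} J)

/-- The underlying set of the degree `n` part of a complex. -/
abbrev evalForget (k : Type w) [Field k] (n : ℤ) : Dg k ⥤ Type w :=
  HomologicalComplex.eval (ModuleCat.{w} k) (ComplexShape.up ℤ) n ⋙ forget (ModuleCat.{w} k)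

/-- The germ at a point of a section of a presheaf of complexes. -/
def germ (P : Cᵒᵖ ⥤ Dg k) (U : C) (x : Φ.fiber.obj U) (n : ℤ) :
    (P.obj (op U)).X n →ₗ[k] (Φ.presheafFiber.obj P).X n :=
  ((Φ.toPresheafFiber U x P).f n).hom

variable (P : Cᵒᵖ ⥤ Dg k)

lemma germ_res {U V : C} (f : U ⟶ V) (x : Φ.fiber.obj U) (n : ℤ) (a : (P.obj (op V)).X n) :
    germ Φ P U x n (((P.map f.op).f n).hom a) = germ Φ P V (Φ.fiber.map f x) n a :=
  ConcreteCategory.congr_hom (HomologicalComplex.congr_hom (Φ.toPresheafFiber_w f x P) n) a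

lemma germ_d {U : C} (x : Φ.fiber.obj U) (n n' : ℤ) (a : (P.obj (op U)).X n) :
    ((Φ.presheafFiber.obj P).d n n').hom (germ Φ P U x n a) =
      germ Φ P U x n' (((P.obj (op U)).d n n').hom a) :=
  ConcreteCategory.congr_hom ((Φ.toPresheafFiber U x P).comm n n') a

lemma presheafFiber_map_germ {P Q : Cᵒᵖ ⥤ Dg k} (f : P ⟶ Q) {U : C} (x : Φ.fiber.obj U) (n : ℤ)
    (a : (P.obj (op U)).X n) : ((Φ.presheafFiber.map f).f n).hom (germ Φ P U x n a) =
      germ Φ Q U x n (((f.app (op U)).f n).hom a) :=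
  ConcreteCategory.congr_hom
    (HomologicalComplex.congr_hom (Φ.toPresheafFiber_naturality f U x) n) a

/-- The stalk is a filtered colimit, which is preserved by evaluation in degree `n` and by the
forgetful functor to sets. So elements of the stalk, and by `germ_eq_iff` equalities between them,
are represented on neighbourhoods. -/
lemma germ_surjective (n : ℤ) (y : (Φ.presheafFiber.obj P).X n) :
    ∃ (U : C) (x : Φ.fiber.obj U) (a : (P.obj (op U)).X n), germ Φ P U x n a = y := by
  obtain ⟨⟨U, x⟩, z, h⟩ := Types.jointly_surjective_of_isColimit
    (isColimitOfPreserves (evalForget k n) (Φ.isColimitPresheafFiberCocone P)) y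
  exact ⟨U, x, z, h⟩

lemma germ_eq_iff (n : ℤ) {U : C} (x : Φ.fiber.obj U) (a b : (P.obj (op U)).X n) :
    germ Φ P U x n a = germ Φ P U x n b ↔ ∃ (V : C) (f : V ⟶ U) (y : Φ.fiber.obj V),
      Φ.fiber.map f y = x ∧ ((P.map f.op).f n).hom a = ((P.map f.op).f n).hom b := by
  constructor
  · intro h
    obtain ⟨⟨V, y⟩, ⟨f, hf⟩, h'⟩ := (Types.FilteredColimit.isColimit_eq_iff'
      (isColimitOfPreserves (evalForget k n) (Φ.isColimitPresheafFiberCocone P))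
      (i := op ⟨U, x⟩) a b).1 h
    exact ⟨V, f, y, hf, h'⟩
  · rintro ⟨V, f, y, rfl, h⟩
    rw [← germ_res, ← germ_res, h]

lemma fiber_common {U V : C} (x : Φ.fiber.obj U) (y : Φ.fiber.obj V) :
    ∃ (W : C) (f : W ⟶ U) (g : W ⟶ V) (z : Φ.fiber.obj W),
      Φ.fiber.map f z = x ∧ Φ.fiber.map g z = y :=
  ⟨_, (IsCofiltered.minToLeft (Φ.fiber.elementsMk U x) (Φ.fiber.elementsMk V y)).1,
    (IsCofiltered.minToRight (Φ.fiber.elementsMk U x) (Φ.fiber.elementsMk V y)).1, _,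
    (IsCofiltered.minToLeft (Φ.fiber.elementsMk U x) (Φ.fiber.elementsMk V y)).2,
    (IsCofiltered.minToRight (Φ.fiber.elementsMk U x) (Φ.fiber.elementsMk V y)).2⟩

lemma germ_surjective₂ {n m : ℤ} (y : (Φ.presheafFiber.obj P).X n)
    (y' : (Φ.presheafFiber.obj P).X m) :
    ∃ (U : C) (x : Φ.fiber.obj U) (a : (P.obj (op U)).X n) (a' : (P.obj (op U)).X m),
      germ Φ P U x n a = y ∧ germ Φ P U x m a' = y' := by
  obtain ⟨U, x, a, rfl⟩ := germ_surjective Φ P n y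
  obtain ⟨V, x', a', rfl⟩ := germ_surjective Φ P m y'
  obtain ⟨W, f, g, z, rfl, rfl⟩ := fiber_common Φ x x'
  exact ⟨W, z, _, _, germ_res Φ P f z n a, germ_res Φ P g z m a'⟩

lemma germ_surjective₃ {n m l : ℤ} (y : (Φ.presheafFiber.obj P).X n)
    (y' : (Φ.presheafFiber.obj P).X m) (y'' : (Φ.presheafFiber.obj P).X l) :
    ∃ (U : C) (x : Φ.fiber.obj U) (a : (P.obj (op U)).X n) (a' : (P.obj (op U)).X m)
      (a'' : (P.obj (op U)).X l),
      germ Φ P U x n a = y ∧ germ Φ P U x m a' = y' ∧ germ Φ P U x l a'' = y'' := by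
  obtain ⟨U, x, a, a', rfl, rfl⟩ := germ_surjective₂ Φ P y y'
  obtain ⟨V, x', a'', rfl⟩ := germ_surjective Φ P l y''
  obtain ⟨W, f, g, z, rfl, rfl⟩ := fiber_common Φ x x'
  exact ⟨W, z, _, _, _, germ_res Φ P f z n a, germ_res Φ P f z m a', germ_res Φ P g z l a''⟩

variable {P} (A : PreCDGA P)

/-- After two refinements of a common neighbourhood, one for each factor, the representatives
coincide; restriction is multiplicative. Hence the product of germs is well defined. -/
lemma germ_mul_eq {p q r : ℤ} (h : p + q = r) {U V : C} (x : Φ.fiber.obj U) (y : Φ.fiber.obj V)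
    {a : (P.obj (op U)).X p} {b : (P.obj (op U)).X q} {a' : (P.obj (op V)).X p}
    {b' : (P.obj (op V)).X q} (ha : germ Φ P U x p a = germ Φ P V y p a')
    (hb : germ Φ P U x q b = germ Φ P V y q b') :
    germ Φ P U x r ((A.alg (op U)).mul h a b) = germ Φ P V y r ((A.alg (op V)).mul h a' b') := by
  obtain ⟨W, f, g, z, rfl, rfl⟩ := fiber_common Φ x y
  rw [← germ_res, ← germ_res] at ha hb
  obtain ⟨W₁, f₁, z₁, rfl, h₁⟩ := (germ_eq_iff Φ P p z _ _).1 ha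
  rw [← germ_res, ← germ_res] at hb
  obtain ⟨W₂, f₂, z₂, rfl, h₂⟩ := (germ_eq_iff Φ P q z₁ _ _).1 hb
  simp only [← germ_res, (A.map_isHom _).map_mul, h₁, h₂]

lemma exists_stalkMul {p q r : ℤ} (h : p + q = r) :
    ∃ m : (Φ.presheafFiber.obj P).X p →ₗ[k] (Φ.presheafFiber.obj P).X q →ₗ[k]
      (Φ.presheafFiber.obj P).X r, ∀ (U : C) (x : Φ.fiber.obj U) (a : (P.obj (op U)).X p)
        (b : (P.obj (op U)).X q), m (germ Φ P U x p a) (germ Φ P U x q b) =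
          germ Φ P U x r ((A.alg (op U)).mul h a b) := by
  -- The product is defined by arbitrary representatives; `hm` records that the choice does not
  -- matter, and bilinearity is then checked on a common neighbourhood.
  choose U x a b ha hb using
    fun (y : (Φ.presheafFiber.obj P).X p) (y' : (Φ.presheafFiber.obj P).X q) =>
      germ_surjective₂ Φ P y y'
  let m := fun y y' => germ Φ P (U y y') (x y y') r ((A.alg (op (U y y'))).mul h (a y y') (b y y'))
  have hm : ∀ (V : C) (z : Φ.fiber.obj V) (c : (P.obj (op V)).X p) (c' : (P.obj (op V)).X q),
      m (germ Φ P V z p c) (germ Φ P V z q c') =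
        germ Φ P V z r ((A.alg (op V)).mul h c c') := fun V z c c' =>
    germ_mul_eq Φ A h _ _ (ha _ _) (hb _ _)
  refine ⟨LinearMap.mk₂ k m ?_ ?_ ?_ ?_, hm⟩
  · intro y₁ y₂ y₃
    obtain ⟨V, z, c₁, c₂, c₃, rfl, rfl, rfl⟩ := germ_surjective₃ Φ P y₁ y₂ y₃
    rw [← map_add, hm, hm, hm, map_add, LinearMap.add_apply, map_add]
  · intro c y₁ y₂
    obtain ⟨V, z, c₁, c₂, rfl, rfl⟩ := germ_surjective₂ Φ P y₁ y₂
    rw [← map_smul, hm, hm, map_smul, LinearMap.smul_apply, map_smul]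
  · intro y₁ y₂ y₃
    obtain ⟨V, z, c₁, c₂, c₃, rfl, rfl, rfl⟩ := germ_surjective₃ Φ P y₁ y₂ y₃
    rw [← map_add, hm, hm, hm, map_add, map_add]
  · intro c y₁ y₂
    obtain ⟨V, z, c₁, c₂, rfl, rfl⟩ := germ_surjective₂ Φ P y₁ y₂
    rw [← map_smul, hm, hm, map_smul, map_smul]

/-- The multiplication on the stalk of a presheaf of algebras. -/
def stalkMul {p q r : ℤ} (h : p + q = r) : (Φ.presheafFiber.obj P).X p →ₗ[k]
    (Φ.presheafFiber.obj P).X q →ₗ[k] (Φ.presheafFiber.obj P).X r :=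
  (exists_stalkMul Φ A h).choose

lemma stalkMul_germ {p q r : ℤ} (h : p + q = r) {U : C} (x : Φ.fiber.obj U)
    (a : (P.obj (op U)).X p) (b : (P.obj (op U)).X q) :
    stalkMul Φ A h (germ Φ P U x p a) (germ Φ P U x q b) =
      germ Φ P U x r ((A.alg (op U)).mul h a b) :=
  (exists_stalkMul Φ A h).choose_spec U x a b

lemma exists_stalkOne : ∃ e : (Φ.presheafFiber.obj P).X 0, ∀ (U : C) (x : Φ.fiber.obj U),
    germ Φ P U x 0 (A.alg (op U)).one = e := by
  obtain ⟨⟨U, x⟩⟩ : Nonempty Φ.fiber.Elements := IsCofiltered.nonempty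
  refine ⟨germ Φ P U x 0 (A.alg (op U)).one, fun V y => ?_⟩
  obtain ⟨W, f, g, z, rfl, rfl⟩ := fiber_common Φ x y
  rw [← germ_res, ← germ_res, (A.map_isHom f.op).map_one, (A.map_isHom g.op).map_one]

/-- The unit of the stalk of a presheaf of algebras. -/
def stalkOne : (Φ.presheafFiber.obj P).X 0 := (exists_stalkOne Φ A).choose

lemma stalkOne_eq {U : C} (x : Φ.fiber.obj U) :
    stalkOne Φ A = germ Φ P U x 0 (A.alg (op U)).one :=
  ((exists_stalkOne Φ A).choose_spec U x).symm

/-- The algebra structure on the stalk of a presheaf of commutative differential graded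
algebras. -/
def stalkCDGA : CDGA (Φ.presheafFiber.obj P) where
  mul h := stalkMul Φ A h
  one := stalkOne Φ A
  mul_assoc h₁ h₂ h₃ h₄ a b c := by
    obtain ⟨U, x, a, b, c, rfl, rfl, rfl⟩ := germ_surjective₃ Φ P a b c
    simp only [stalkMul_germ, (A.alg (op U)).mul_assoc h₁ h₂ h₃ h₄]
  one_mul a := by
    obtain ⟨U, x, a, rfl⟩ := germ_surjective Φ P _ a
    rw [stalkOne_eq Φ A x, stalkMul_germ, CDGA.one_mul]
  mul_comm h h' a b := by
    obtain ⟨U, x, a, b, rfl, rfl⟩ := germ_surjective₂ Φ P a b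
    rw [stalkMul_germ, stalkMul_germ, (A.alg (op U)).mul_comm h h', Units.smul_def, map_zsmul]
    rfl
  d_one := by
    obtain ⟨⟨U, x⟩⟩ : Nonempty Φ.fiber.Elements := IsCofiltered.nonempty
    rw [stalkOne_eq Φ A x, germ_d, CDGA.d_one, map_zero]
  d_mul h hp hq h₁ h₂ a b := by
    obtain ⟨U, x, a, b, rfl, rfl⟩ := germ_surjective₂ Φ P a b
    rw [stalkMul_germ, germ_d, (A.alg (op U)).d_mul h hp hq h₁ h₂, germ_d, germ_d, stalkMul_germ,
      stalkMul_germ, Units.smul_def, map_add, map_zsmul]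
    rfl

lemma isCDGAHom_toPresheafFiber (U : C) (x : Φ.fiber.obj U) :
    IsCDGAHom (A.alg (op U)) (stalkCDGA Φ A) (Φ.toPresheafFiber U x P) where
  map_one := (stalkOne_eq Φ A x).symm
  map_mul h a b := (stalkMul_germ Φ A h x a b).symm

lemma isCDGAHom_of_toPresheafFiber {L : Dg k} (B : CDGA L) (f : Φ.presheafFiber.obj P ⟶ L)
    (hf : ∀ (U : C) (x : Φ.fiber.obj U),
      IsCDGAHom (A.alg (op U)) B (Φ.toPresheafFiber U x P ≫ f)) :
    IsCDGAHom (stalkCDGA Φ A) B f where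
  map_one := by
    obtain ⟨⟨U, x⟩⟩ : Nonempty Φ.fiber.Elements := IsCofiltered.nonempty
    exact (congrArg (f.f 0).hom (stalkOne_eq Φ A x)).trans (hf U x).map_one
  map_mul h a b := by
    obtain ⟨U, x, a, b, rfl, rfl⟩ := germ_surjective₂ Φ P a b
    exact (congrArg (f.f _).hom (stalkMul_germ Φ A h x a b)).trans ((hf U x).map_mul h a b)

lemma IsCDGAHom.comp {K L M : Dg k} {A : CDGA K} {B : CDGA L} {D : CDGA M} {f : K ⟶ L}
    {g : L ⟶ M} (hf : IsCDGAHom A B f) (hg : IsCDGAHom B D g) : IsCDGAHom A D (f ≫ g) where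
  map_one := (congrArg (g.f 0).hom hf.map_one).trans hg.map_one
  map_mul h a b := (congrArg (g.f _).hom (hf.map_mul h a b)).trans (hg.map_mul h _ _)

lemma IsCDGAHom.id {K : Dg k} (A : CDGA K) : IsCDGAHom A A (𝟙 K) where
  map_one := rfl
  map_mul _ _ _ := rfl

lemma isCDGAHom_presheafFiber_map {Q : Cᵒᵖ ⥤ Dg k} (B : PreCDGA Q) (f : P ⟶ Q)
    (hf : ∀ U, IsCDGAHom (A.alg U) (B.alg U) (f.app U)) :
    IsCDGAHom (stalkCDGA Φ A) (stalkCDGA Φ B) (Φ.presheafFiber.map f) := by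
  refine isCDGAHom_of_toPresheafFiber Φ A _ _ fun U x => ?_
  rw [Φ.toPresheafFiber_naturality]
  exact (hf _).comp (isCDGAHom_toPresheafFiber Φ B U x)

end Germ

/-! ### Degreewise products of algebras -/

section Jointly
variable {k : Type w} [Field k] {ι : Type*} {K : Dg k} {E : ι → Dg k}

/-- The complex `K` is, in each degree, the product of the complexes `E i` by the maps `f i`. -/
def IsDegreewiseProduct (f : (i : ι) → (K ⟶ E i)) : Prop :=
  ∀ n, Function.Bijective fun (x : K.X n) i => ((f i).f n).hom x

variable {f : (i : ι) → (K ⟶ E i)} (hf : IsDegreewiseProduct f) (A : (i : ι) → CDGA (E i))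

/-- The element of a product with prescribed components. -/
def IsDegreewiseProduct.lift {n : ℤ} (y : (i : ι) → (E i).X n) : K.X n :=
  ((hf n).2 y).choose

lemma IsDegreewiseProduct.lift_apply {n : ℤ} (y : (i : ι) → (E i).X n) (i : ι) :
    ((f i).f n).hom (hf.lift y) = y i :=
  congrFun ((hf n).2 y).choose_spec i

lemma IsDegreewiseProduct.ext (hf : IsDegreewiseProduct f) {n : ℤ} {x y : K.X n}
    (h : ∀ i, ((f i).f n).hom x = ((f i).f n).hom y) : x = y :=
  (hf n).1 (funext h)

/-- The product of commutative differential graded algebras. -/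
def IsDegreewiseProduct.cdga : CDGA K where
  mul {p q r} h := LinearMap.mk₂ k
    (fun a b => hf.lift fun i => (A i).mul h (((f i).f p).hom a) (((f i).f q).hom b))
    (fun a b c => hf.ext fun i => by
      simp only [map_add, LinearMap.add_apply, hf.lift_apply])
    (fun c a b => hf.ext fun i => by
      simp only [map_smul, LinearMap.smul_apply, hf.lift_apply])
    (fun a b c => hf.ext fun i => by
      simp only [map_add, hf.lift_apply])
    (fun c a b => hf.ext fun i => by
      simp only [map_smul, hf.lift_apply])
  one := hf.lift fun i => (A i).one
  mul_assoc h₁ h₂ h₃ h₄ a b c := hf.ext fun i => by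
    simp only [LinearMap.mk₂_apply, hf.lift_apply, (A i).mul_assoc h₁ h₂ h₃ h₄]
  one_mul a := hf.ext fun i => by
    simp only [LinearMap.mk₂_apply, hf.lift_apply, (A i).one_mul]
  mul_comm h h' a b := hf.ext fun i => by
    simp only [LinearMap.mk₂_apply, hf.lift_apply, Units.smul_def, map_zsmul]
    exact (A i).mul_comm h h' _ _
  d_one := hf.ext fun i => by
    have h := ConcreteCategory.congr_hom ((f i).comm 0 1) (hf.lift fun i => (A i).one)
    refine h.symm.trans ?_
    change ((E i).d 0 1).hom (((f i).f 0).hom _) = _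
    rw [hf.lift_apply, (A i).d_one, map_zero]
  d_mul {p q p' q' r s} h hp hq h₁ h₂ a b := hf.ext fun i => by
    have hc : ∀ n n' (x : K.X n), ((f i).f n').hom ((K.d n n').hom x) =
        ((E i).d n n').hom (((f i).f n).hom x) := fun n n' x =>
      (ConcreteCategory.congr_hom ((f i).comm n n') x).symm
    simp only [LinearMap.mk₂_apply, hf.lift_apply, Units.smul_def, map_add, map_zsmul, hc]
    exact (A i).d_mul h hp hq h₁ h₂ _ _

lemma IsDegreewiseProduct.isCDGAHom_proj (i : ι) : IsCDGAHom (hf.cdga A) (A i) (f i) where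
  map_one := hf.lift_apply _ i
  map_mul _ _ _ := hf.lift_apply _ i

/-- The projections are jointly injective and multiplicative. All maps into `G F` are shown to be
algebra morphisms by this criterion. -/
lemma IsDegreewiseProduct.isCDGAHom_of_comp {L : Dg k} (B : CDGA L) (g : L ⟶ K)
    (hg : ∀ i, IsCDGAHom B (A i) (g ≫ f i)) : IsCDGAHom B (hf.cdga A) g where
  map_one := hf.ext fun i =>
    (hg i).map_one.trans (hf.isCDGAHom_proj A i).map_one.symm
  map_mul h a b := hf.ext fun i =>
    ((hg i).map_mul h a b).trans ((hf.isCDGAHom_proj A i).map_mul h _ _).symm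

end Jointly

/-- The functor `F` preserves the product, and products of sets are sets of families. -/
lemma bijective_map_pi {A : Type*} [Category* A] {ι : Type w} (X : ι → A) [HasProduct X]
    (F : A ⥤ Type w) [PreservesLimit (Discrete.functor X) F] :
    Function.Bijective fun (x : F.obj (∏ᶜ X)) i => F.map (Pi.π X i) x := by
  have h := ((PreservesProduct.iso F X) ≪≫ Types.productIso fun j => F.obj (X j)).toEquiv.bijective
  convert! h using 1
  funext x i
  have h' := ConcreteCategory.congr_hom (piComparison_comp_π F X i) x
  simpa only [Iso.toEquiv_fun, Iso.trans_hom, ConcreteCategory.comp_apply,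
    Types.productIso_hom_comp_eval_apply, PreservesProduct.iso_hom] using h'.symm

/-! ### Algebra structures on the Godement resolution -/

section GodementProj
variable {k : Type w} [Field k] {C : Type w} [SmallCategory C] {J : GrothendieckTopology C}
  {S : Type w} (pt : S → GrothendieckTopology.Point.{w} J)

/-- Two products are combined: over the points `s`, and, in the sections of each skyscraper sheaf
over `U`, over the elements of the fibre of `s` at `U`. Both are preserved by evaluation in degree
`n`. -/
lemma isDegreewiseProduct_godementProj (F : Sheaf J (Dg k)) (U : C) :
    IsDegreewiseProduct fun t : (Σ s, (pt s).fiber.obj U) => godementProj pt F t.1 U t.2 := by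
  intro n
  have h1 := bijective_map_pi (fun s => (pt s).skyscraperSheafFunctor.obj ((stalks k pt).obj F s))
    (sheafToPresheaf J (Dg k) ⋙ (evaluation _ _).obj (op U) ⋙ evalForget k n)
  have h2 := fun s => bijective_map_pi
    (fun _ : (pt s).fiber.obj U => (pt s).presheafFiber.obj F.obj) (evalForget k n)
  constructor
  · intro x y h
    refine h1.1 (funext fun s => (h2 s).1 (funext fun u => ?_))
    exact congrFun h ⟨s, u⟩
  · intro y
    choose z hz using fun s => (h2 s).2 fun u => y ⟨s, u⟩
    obtain ⟨x, hx⟩ := h1.2 z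
    refine ⟨x, funext fun t => ?_⟩
    refine Eq.trans ?_ (congrFun (hz t.1) t.2)
    exact congrArg (fun z => (evalForget k n).map (Pi.π (fun _ : (pt t.1).fiber.obj U =>
      (pt t.1).presheafFiber.obj F.obj) t.2) z) (congrFun hx t.1)

lemma map_godementProj (F : Sheaf J (Dg k)) (s : S) {U V : C} (f : U ⟶ V)
    (u : (pt s).fiber.obj U) :
    ((godement k pt).obj F).obj.map f.op ≫ godementProj pt F s U u =
      godementProj pt F s V ((pt s).fiber.map f u) := by
  refine (Category.assoc _ _ _).symm.trans ?_
  refine (congrArg (· ≫ Limits.Pi.π (fun _ : (pt s).fiber.obj U => (pt s).presheafFiber.obj F.obj) u)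
    ((skyscrapersπ k pt ((stalks k pt).obj F) s).hom.naturality f.op)).trans ?_
  refine (Category.assoc _ _ _).trans ?_
  refine congrArg ((skyscrapersπ k pt ((stalks k pt).obj F) s).hom.app (op V) ≫ ·) ?_
  exact Pi.map'_comp_π _ _ _

lemma godement_map_godementProj {F F' : Sheaf J (Dg k)} (g : F ⟶ F') (s : S) (U : C)
    (u : (pt s).fiber.obj U) :
    ((godement k pt).map g).hom.app (op U) ≫ godementProj pt F' s U u =
      godementProj pt F s U u ≫ (pt s).presheafFiber.map g.hom := by
  have h := congrArg (fun φ => φ.hom.app (op U)) (skyscrapers_map_π k pt ((stalks k pt).map g) s)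
  refine (Category.assoc _ _ _).symm.trans ?_
  refine (congrArg (· ≫ Limits.Pi.π (fun _ : (pt s).fiber.obj U =>
    (pt s).presheafFiber.obj F'.obj) u) h).trans ?_
  refine Eq.trans ?_ (Category.assoc _ _ _).symm
  exact (Category.assoc _ _ _).trans
    (congrArg ((skyscrapersπ k pt ((stalks k pt).obj F) s).hom.app (op U) ≫ ·)
      (Limits.Pi.map_π (fun _ : (pt s).fiber.obj U => (pt s).presheafFiber.map g.hom) u))

/-- The unit is adjoint to the identity of the stalks, so its components are the maps taking germs.
-/
lemma unit_godementProj (F : Sheaf J (Dg k)) (s : S) (U : C) (u : (pt s).fiber.obj U) :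
    ((godement k pt).η.app F).hom.app (op U) ≫ godementProj pt F s U u =
      (pt s).toPresheafFiber U u F.obj := by
  have h : (godement k pt).η.app F ≫ skyscrapersπ k pt ((stalks k pt).obj F) s =
      (pt s).skyscraperSheafAdjunction.homEquiv F _ (𝟙 _) := by
    exact skyscrapersLift_π k pt _ s
  have h' := congrArg (fun φ => φ.hom.app (op U)) h
  refine (Category.assoc _ _ _).symm.trans ?_
  refine (congrArg (· ≫ Limits.Pi.π (fun _ : (pt s).fiber.obj U =>
    (pt s).presheafFiber.obj F.obj) u) h').trans ?_
  have h2 := (pt s).skyscraperSheafAdjunction_homEquiv_apply_hom (F := F) (𝟙 ((pt s).presheafFiber.obj F.obj))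
  refine (congrArg (fun φ => φ.app (op U) ≫ Limits.Pi.π (fun _ : (pt s).fiber.obj U =>
    (pt s).presheafFiber.obj F.obj) u) h2).trans ?_
  exact ((pt s).skyscraperPresheafHomEquiv_app_π _ U u).trans (Category.comp_id _)

/-- The map `(G F)_s ⟶ F_s` given by the counit of the adjunction. -/
def stalkCounit (F : Sheaf J (Dg k)) (s : S) :
    (pt s).presheafFiber.obj ((godement k pt).obj F).obj ⟶ (pt s).presheafFiber.obj F.obj :=
  (stalksAdj k pt).counit.app ((stalks k pt).obj F) s

/-- The counit is adjoint to the identity of the product, whose component at `s` is the projection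
to the skyscraper sheaf. -/
lemma toPresheafFiber_stalkCounit (F : Sheaf J (Dg k)) (s : S) (U : C) (u : (pt s).fiber.obj U) :
    (pt s).toPresheafFiber U u ((godement k pt).obj F).obj ≫ stalkCounit pt F s =
      godementProj pt F s U u := by
  have h : stalkCounit pt F s = ((pt s).skyscraperSheafAdjunction.homEquiv _ _).symm
      (skyscrapersπ k pt ((stalks k pt).obj F) s) := by
    refine congrArg ((pt s).skyscraperSheafAdjunction.homEquiv _ _).symm ?_
    exact Category.id_comp _
  rw [h]
  refine (congrArg ((pt s).toPresheafFiber U u ((godement k pt).obj F).obj ≫ ·)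
    ((pt s).skyscraperSheafAdjunction_homEquiv_symm_apply _)).trans ?_
  exact (pt s).toPresheafFiber_skyscraperPresheafHomEquiv_symm _ U u

/-- The multiplication of the monad is `p_*` applied to the counit. -/
lemma mu_godementProj (F : Sheaf J (Dg k)) (s : S) (U : C) (u : (pt s).fiber.obj U) :
    ((godement k pt).μ.app F).hom.app (op U) ≫ godementProj pt F s U u =
      godementProj pt ((godement k pt).obj F) s U u ≫ stalkCounit pt F s := by
  have h := congrArg (fun φ => φ.hom.app (op U))
    (skyscrapers_map_π k pt ((stalksAdj k pt).counit.app ((stalks k pt).obj F)) s)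
  refine (Category.assoc _ _ _).symm.trans ?_
  refine (congrArg (· ≫ Limits.Pi.π (fun _ : (pt s).fiber.obj U =>
    (pt s).presheafFiber.obj F.obj) u) h).trans ?_
  refine Eq.trans ?_ (Category.assoc _ _ _).symm
  exact (Category.assoc _ _ _).trans
    (congrArg ((skyscrapersπ k pt _ s).hom.app (op U) ≫ ·)
      (Limits.Pi.map_π (fun _ : (pt s).fiber.obj U => stalkCounit pt F s) u))

/-- The algebra structure on `G F` induced by an algebra structure on `F`. -/
def godementPre {F : Sheaf J (Dg k)} (A : PreCDGA F.obj) : PreCDGA ((godement k pt).obj F).obj where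
  alg U := (isDegreewiseProduct_godementProj pt F U.unop).cdga fun t => stalkCDGA (pt t.1) A
  map_isHom {U V} f := by
    refine (isDegreewiseProduct_godementProj pt F V.unop).isCDGAHom_of_comp _ _ _ fun t => ?_
    have h := (isDegreewiseProduct_godementProj pt F U.unop).isCDGAHom_proj
      (fun t => stalkCDGA (pt t.1) A) ⟨t.1, (pt t.1).fiber.map f.unop t.2⟩
    dsimp only at h
    rw [← map_godementProj] at h
    exact h

lemma isCDGAHom_godementProj {F : Sheaf J (Dg k)} (A : PreCDGA F.obj) (s : S) (U : C)
    (u : (pt s).fiber.obj U) :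
    IsCDGAHom ((godementPre pt A).alg (op U)) (stalkCDGA (pt s) A) (godementProj pt F s U u) :=
  (isDegreewiseProduct_godementProj pt F U).isCDGAHom_proj (fun t => stalkCDGA (pt t.1) A) ⟨s, u⟩

lemma isCDGAHom_godementPre {F : Sheaf J (Dg k)} (A : PreCDGA F.obj) {U : C} {L : Dg k}
    {B : CDGA L} {g : L ⟶ ((godement k pt).obj F).obj.obj (op U)}
    (h : ∀ s u, IsCDGAHom B (stalkCDGA (pt s) A) (g ≫ godementProj pt F s U u)) :
    IsCDGAHom B ((godementPre pt A).alg (op U)) g :=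
  (isDegreewiseProduct_godementProj pt F U).isCDGAHom_of_comp _ _ _ fun t => h t.1 t.2

lemma isGodementAlg_godementPre {F : Sheaf J (Dg k)} (A : PreCDGA F.obj) :
    IsGodementAlg pt A (godementPre pt A) :=
  ⟨fun s => stalkCDGA (pt s) A, fun s V v => isCDGAHom_toPresheafFiber (pt s) A V v,
    fun s U u => isCDGAHom_godementProj pt A s U u⟩

/-- Morphisms of sheaves which are compatible with algebra structures. -/
def IsPreHom {F F' : Sheaf J (Dg k)} (A : PreCDGA F.obj) (B : PreCDGA F'.obj) (g : F ⟶ F') : Prop :=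
  ∀ U, IsCDGAHom (A.alg U) (B.alg U) (g.hom.app U)

lemma IsPreHom.comp {F F' F'' : Sheaf J (Dg k)} {A : PreCDGA F.obj} {B : PreCDGA F'.obj}
    {D : PreCDGA F''.obj} {g : F ⟶ F'} {g' : F' ⟶ F''} (h : IsPreHom A B g) (h' : IsPreHom B D g') :
    IsPreHom A D (g ≫ g') :=
  fun U => (h U).comp (h' U)

lemma isPreHom_unit {F : Sheaf J (Dg k)} (A : PreCDGA F.obj) :
    IsPreHom A (godementPre pt A) ((godement k pt).η.app F) := fun U =>
  isCDGAHom_godementPre pt A (U := U.unop) fun s u => by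
    rw [unit_godementProj]
    exact isCDGAHom_toPresheafFiber (pt s) A _ u

lemma isPreHom_map {F F' : Sheaf J (Dg k)} {A : PreCDGA F.obj} {B : PreCDGA F'.obj} {g : F ⟶ F'}
    (h : IsPreHom A B g) : IsPreHom (godementPre pt A) (godementPre pt B) ((godement k pt).map g) :=
  fun U => isCDGAHom_godementPre pt B (U := U.unop) fun s u => by
    rw [godement_map_godementProj]
    exact (isCDGAHom_godementProj pt A s _ u).comp (isCDGAHom_presheafFiber_map (pt s) A B _ h)

lemma isCDGAHom_stalkCounit {F : Sheaf J (Dg k)} (A : PreCDGA F.obj) (s : S) :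
    IsCDGAHom (stalkCDGA (pt s) (godementPre pt A)) (stalkCDGA (pt s) A) (stalkCounit pt F s) :=
  isCDGAHom_of_toPresheafFiber (pt s) _ _ _ fun U u => by
    rw [toPresheafFiber_stalkCounit]
    exact isCDGAHom_godementProj pt A s U u

lemma isPreHom_mu {F : Sheaf J (Dg k)} (A : PreCDGA F.obj) :
    IsPreHom (godementPre pt (godementPre pt A)) (godementPre pt A) ((godement k pt).μ.app F) :=
  fun U => isCDGAHom_godementPre pt A (U := U.unop) fun s u => by
    refine (congrArg (IsCDGAHom _ _) (mu_godementProj pt F s U.unop u)).mpr ?_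
    exact (isCDGAHom_godementProj pt (godementPre pt A) s _ u).comp (isCDGAHom_stalkCounit pt A s)

/-- The algebra structures on the iterates `G^n F`. -/
def iterPre {F : Sheaf J (Dg k)} (A : PreCDGA F.obj) :
    (n : ℕ) → PreCDGA ((monadIter (godement k pt) n).obj F).obj
  | 0 => A
  | n + 1 => godementPre pt (iterPre A n)

/-- By its recursive definition, `monadMap` is composed of units, multiplications and images under
`G`, and each of these preserves algebra structures. -/
lemma isPreHom_monadMap {F : Sheaf J (Dg k)} (A : PreCDGA F.obj) :
    ∀ (m n : ℕ) (f : Fin m →o Fin n),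
      IsPreHom (iterPre pt A m) (iterPre pt A n) (monadMap (godement k pt) F m n f)
  | 0, 0, f => by
    rw [monadMap.eq_1]
    exact fun U => IsCDGAHom.id _
  | 0, n + 1, f => by
    rw [monadMap.eq_2]
    exact (isPreHom_monadMap A 0 n _).comp (isPreHom_unit pt _)
  | m + 1, 0, f => (f 0).elim0
  | m + 1, n + 1, f => by
    rw [monadMap.eq_4]
    split_ifs with h
    · exact (isPreHom_map pt (isPreHom_monadMap A m (n + 1) _)).comp (isPreHom_mu pt _)
    · exact (isPreHom_monadMap A (m + 1) n _).comp (isPreHom_unit pt _)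
termination_by m n => m + n

lemma isPreHom_monadIter_map {F F' : Sheaf J (Dg k)} {A : PreCDGA F.obj} {B : PreCDGA F'.obj}
    {g : F ⟶ F'} (h : IsPreHom A B g) : ∀ n : ℕ,
      IsPreHom (iterPre pt A n) (iterPre pt B n) ((monadIter (godement k pt) n).map g)
  | 0 => h
  | n + 1 => isPreHom_map pt (isPreHom_monadIter_map h n)

/-- The structure of cosimplicial presheaf of commutative differential graded algebras on the
cosimplicial Godement resolution of a sheaf of commutative differential graded algebras. -/
def godementAlg (F : CDGASheaf k J) : GodementAlg pt F where
  iter := iterPre pt F.alg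
  iter_zero := rfl
  iter_succ _ := isGodementAlg_godementPre pt _
  map_isHom f U := isPreHom_monadMap pt F.alg _ _ f.toOrderHom U

lemma isEZHom_NG_restriction (F : CDGASheaf k J) {U V : Cᵒᵖ} (f : U ⟶ V) :
    IsEZHom (ezAct ((godementAlg pt F).sections pt U)) (ezAct ((godementAlg pt F).sections pt V))
      (((NG k pt).obj F.sheaf).map f) :=
  isEZHom_totN_map ((godementAlg pt F).sections pt U) ((godementAlg pt F).sections pt V) _
    fun c => (iterPre pt F.alg (c.len + 1)).map_isHom f

lemma isEZHom_NG_map (F F' : CDGASheaf k J) (g : F.sheaf ⟶ F'.sheaf) (hg : IsCDGASheafHom F F' g)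
    (U : Cᵒᵖ) : IsEZHom (ezAct ((godementAlg pt F).sections pt U))
      (ezAct ((godementAlg pt F').sections pt U)) (((NG k pt).map g).app U) :=
  isEZHom_totN_map ((godementAlg pt F).sections pt U) ((godementAlg pt F').sections pt U) _
    fun c => isPreHom_monadIter_map pt hg (c.len + 1) U

end GodementProj

/-! ### The normalized Godement resolution is a sheaf -/

section IsSheafNG
variable {k : Type w} [Field k] {C : Type w} [SmallCategory C] {J : GrothendieckTopology C}

/-- Limits of complexes are formed degreewise, and for modules the sheaf condition is that of the
underlying sets. -/
lemma isSheaf_of_eval (P : Cᵒᵖ ⥤ Dg k) (h : ∀ n, Presieve.IsSheaf J (P ⋙ evalForget k n)) :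
    Presheaf.IsSheaf J P := by
  have h' : ∀ n, Presheaf.IsSheaf J (P ⋙ HomologicalComplex.eval _ _ n) := fun n =>
    (Presheaf.isSheaf_iff_isSheaf_forget J _ (forget (ModuleCat.{w} k))).2
      ((isSheaf_iff_isSheaf_of_type J _).2 (h n))
  rw [Presheaf.isSheaf_iff_isLimit]
  intro X R hR
  exact ⟨HomologicalComplex.isLimitOfEval _ _ fun n =>
    ((Presheaf.isSheaf_iff_isLimit J _).1 (h' n) R hR).some⟩

lemma isSheaf_evalForget (F : Sheaf J (Dg k)) (q : ℤ) :
    Presieve.IsSheaf J (F.obj ⋙ evalForget k q) :=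
  (isSheaf_iff_isSheaf_of_type J _).1 ((sheafCompose J (evalForget k q)).obj F).2

lemma sheaf_eq_of_locally (F : Sheaf J (Dg k)) (q : ℤ) {U : C} (R : Sieve U) (hR : R ∈ J U)
    {x y : (F.obj.obj (op U)).X q} (h : ∀ ⦃V : C⦄ (f : V ⟶ U), R f →
      ((F.obj.map f.op).f q).hom x = ((F.obj.map f.op).f q).hom y) : x = y :=
  (isSheaf_evalForget F q R hR).isSeparatedFor.ext h

variable {S : Type w} (pt : S → GrothendieckTopology.Point.{w} J)

/-- An element is a family of normalized sections of the sheaves `G^{p+1} F`. The components are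
glued separately. -/
lemma isSheaf_NG (F : Sheaf J (Dg k)) : Presheaf.IsSheaf J ((NG k pt).obj F) := by
  refine isSheaf_of_eval _ fun n U R hR x hx => ?_
  have hc : ∀ s : Bideg n, ∃ y : ((((monadIter (godement k pt) (s.1.1 + 1)).obj F).obj.obj
      (op U)).X s.1.2), ∀ (V : C) (f : V ⟶ U) (hf : R f),
        ((((monadIter (godement k pt) (s.1.1 + 1)).obj F).obj.map f.op).f s.1.2).hom y =
          ((x f hf : TotX (godementSections k pt F (op V)) n) s).1 := by
    intro s
    have hs := isSheaf_evalForget ((monadIter (godement k pt) (s.1.1 + 1)).obj F) s.1.2 R hR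
      (fun V f hf => ((x f hf : TotX (godementSections k pt F (op V)) n) s).1) (by
        intro V₁ V₂ W g₁ g₂ f₁ f₂ h₁ h₂ hg
        exact congrArg (fun z : TotX (godementSections k pt F (op W)) n => (z s).1)
          (hx g₁ g₂ h₁ h₂ hg))
    obtain ⟨y, hy, -⟩ := hs
    exact ⟨y, fun V f hf => hy f hf⟩
  choose y hy using hc
  -- A glued component is normalized because its codegeneracies vanish locally.
  have hmem : ∀ s, y s ∈ normSub (row (godementSections k pt F (op U)) s.1.2) s.1.1 := by
    rintro ⟨⟨_ | p, q⟩, hs⟩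
    · trivial
    · refine mem_normSub_succ.2 fun j => ?_
      refine sheaf_eq_of_locally ((monadIter (godement k pt) (p + 1)).obj F) q R hR
        fun V f hf => ?_
      have e1 := ConcreteCategory.congr_hom (HomologicalComplex.congr_hom
        ((((godementCos k pt).obj F).σ j).hom.naturality f.op) q) (y ⟨(p + 1, q), hs⟩)
      refine e1.symm.trans ?_
      refine (congrArg ((((((godementCos k pt).obj F).σ j).hom.app (op V)).f q).hom)
        (hy ⟨(p + 1, q), hs⟩ V f hf)).trans ?_
      refine (mem_normSub_succ.1 ((x f hf : TotX (godementSections k pt F (op V)) n)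
        ⟨(p + 1, q), hs⟩).2 j).trans (map_zero _).symm
  refine ⟨(fun s => ⟨y s, hmem s⟩ : TotX (godementSections k pt F (op U)) n), fun V f hf => ?_,
    fun z hz => ?_⟩
  · exact funext fun s => Subtype.ext (hy s V f hf)
  · refine funext fun s => Subtype.ext ?_
    refine sheaf_eq_of_locally ((monadIter (godement k pt) (s.1.1 + 1)).obj F) s.1.2 R hR
      fun V f hf => ?_
    refine Eq.trans ?_ (hy s V f hf).symm
    exact congrArg (fun z : TotX (godementSections k pt F (op V)) n => (z s).1) (hz f hf)

/-- The normalized Godement resolution, as a functor to sheaves. -/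
def sheafNG : Sheaf J (Dg k) ⥤ Sheaf J (Dg k) where
  obj F := ⟨(NG k pt).obj F, isSheaf_NG pt F⟩
  map f := ⟨(NG k pt).map f⟩
  map_id F := by
    apply ObjectProperty.hom_ext
    exact (NG k pt).map_id F
  map_comp f g := by
    apply ObjectProperty.hom_ext
    exact (NG k pt).map_comp f g

lemma totAug_naturality {M M' : Dg k} {K K' : CosimplicialObject (Dg k)}
    (f : M ⟶ K.obj (SimplexCategory.mk 0)) (hf : f ≫ K.δ (0 : Fin 2) = f ≫ K.δ 1)
    (f' : M' ⟶ K'.obj (SimplexCategory.mk 0)) (hf' : f' ≫ K'.δ (0 : Fin 2) = f' ≫ K'.δ 1)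
    (g : M ⟶ M') (h : K ⟶ K') (w : f ≫ h.app _ = g ≫ f') :
    totAug f hf ≫ totN.map h = g ≫ totAug f' hf' := by
  ext n (a : M.X n)
  funext s
  obtain ⟨⟨_ | p, q⟩, hs⟩ := s
  · apply Subtype.ext
    have e := ConcreteCategory.congr_hom (HomologicalComplex.congr_hom w q) (idMap M n q a)
    refine e.trans ?_
    exact congrArg (f'.f q).hom (MultiOp.idMap_naturality g n q a).symm
  · exact map_zero (normMap (rowMap h q) (p + 1))

lemma godementUnit_app_coface (F : Sheaf J (Dg k)) (U : Cᵒᵖ) :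
    (godementUnit k pt F).hom.app U ≫ (godementSections k pt F U).δ (0 : Fin 2) =
      (godementUnit k pt F).hom.app U ≫ (godementSections k pt F U).δ 1 :=
  congrArg (fun g => g.hom.app U)
    ((godementUnit_coface k pt F 0).trans (godementUnit_coface k pt F 1).symm)

/-- The natural transformation to the normalized Godement resolution. -/
def toSheafNG : 𝟭 (Sheaf J (Dg k)) ⟶ sheafNG pt where
  app F := ⟨{ app := toNG k pt F
              naturality := fun U V f =>
                (totAug_naturality _ (godementUnit_app_coface pt F U) _
                  (godementUnit_app_coface pt F V) _ _
                  ((godementUnit k pt F).hom.naturality f).symm).symm }⟩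
  naturality F F' g := by
    apply ObjectProperty.hom_ext
    ext U : 2
    refine (totAug_naturality _ (godementUnit_app_coface pt F U) _
      (godementUnit_app_coface pt F' U) _ _ ?_).symm
    exact (congrArg (fun φ => φ.hom.app U) ((godement k pt).η.naturality g)).symm

end IsSheafNG

/-! ### A natural projection onto the normalization -/

section NormProj
variable {k : Type w} [Field k]

/-- The composition of the maps `1 - δ^{j+1} σ^j` for `j < m`, in order of increasing `j`. -/
def normProjAux (A : CosimplicialObject (ModuleCat.{w} k)) (p : ℕ) :
    ℕ → (A.obj (SimplexCategory.mk (p + 1)) →ₗ[k] A.obj (SimplexCategory.mk (p + 1)))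
  | 0 => LinearMap.id
  | m + 1 => if h : m < p + 1 then
      (LinearMap.id - (A.δ (⟨m, h⟩ : Fin (p + 1)).succ).hom ∘ₗ (A.σ ⟨m, h⟩).hom) ∘ₗ
        normProjAux A p m
    else normProjAux A p m

/-- The `m`-th correction kills `σ^m`, because `σ^m δ^{m+1} = 1`. For `j < m` it preserves the
vanishing of `σ^j`, because `σ^j δ^{m+1} σ^m = δ^m σ^{m-1} σ^j`. -/
lemma codeg_normProjAux (A : CosimplicialObject (ModuleCat.{w} k)) (p : ℕ)
    (x : A.obj (SimplexCategory.mk (p + 1))) : ∀ (m : ℕ), m ≤ p + 1 → ∀ j : Fin (p + 1),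
      (j : ℕ) < m → (A.σ j).hom (normProjAux A p m x) = 0
  | 0, _, j, hj => absurd hj (Nat.not_lt_zero _)
  | m + 1, hm, j, hj => by
    have h : m < p + 1 := hm
    rw [normProjAux, dif_pos h]
    set y := normProjAux A p m x with hy
    change (A.σ j).hom (y - (A.δ (⟨m, h⟩ : Fin (p + 1)).succ).hom ((A.σ ⟨m, h⟩).hom y)) = 0
    rw [map_sub]
    rcases lt_or_eq_of_le (Nat.lt_succ_iff.1 hj) with hlt | rfl
    · have h0 : (A.σ j).hom y = 0 := codeg_normProjAux A p x m h.le j hlt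
      rw [h0, zero_sub, neg_eq_zero]
      obtain ⟨p, rfl⟩ : ∃ p', p = p' + 1 := ⟨p - 1, by omega⟩
      obtain ⟨j', rfl⟩ : ∃ j' : Fin (p + 1), j = j'.castSucc := ⟨⟨j, by omega⟩, rfl⟩
      have e1 := ConcreteCategory.congr_hom
        (A.δ_comp_σ_of_gt (i := ⟨m, h⟩) (j := j') hlt) ((A.σ ⟨m, h⟩).hom y)
      refine e1.trans ?_
      have e2 := ConcreteCategory.congr_hom (A.σ_comp_σ (i := j') (j := ⟨m - 1, by omega⟩) (by
        simp only [Fin.le_def, Fin.val_castSucc] at hlt ⊢; omega)) y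
      have e3 : (⟨m - 1, by omega⟩ : Fin (p + 1)).succ = ⟨m, h⟩ := by
        ext; simp only [Fin.val_castSucc, Fin.val_succ] at hlt ⊢; omega
      rw [e3] at e2
      have e4 : (A.σ j').hom ((A.σ ⟨m, h⟩).hom y) = 0 :=
        e2.symm.trans ((congrArg (A.σ (⟨m - 1, by omega⟩ : Fin (p + 1))).hom h0).trans (map_zero _))
      exact (congrArg (A.δ _).hom e4).trans (map_zero _)
    · have e1 := ConcreteCategory.congr_hom (A.δ_comp_σ_succ (i := ⟨j, h⟩)) ((A.σ j).hom y)
      rw [sub_eq_zero]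
      exact e1.symm

/-- Every correction term begins with a codegeneracy, which vanishes on normalized elements. -/
lemma normProjAux_of_mem (A : CosimplicialObject (ModuleCat.{w} k)) (p : ℕ)
    {x : A.obj (SimplexCategory.mk (p + 1))} (hx : x ∈ normSub A (p + 1)) :
    ∀ m, normProjAux A p m x = x
  | 0 => rfl
  | m + 1 => by
    rw [normProjAux]
    split_ifs with h
    · rw [LinearMap.comp_apply, normProjAux_of_mem A p hx m, LinearMap.sub_apply,
        LinearMap.comp_apply, mem_normSub_succ.1 hx, map_zero, sub_zero]
      rfl
    · exact normProjAux_of_mem A p hx m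

lemma normProjAux_naturality {A B : CosimplicialObject (ModuleCat.{w} k)} (f : A ⟶ B) (p : ℕ)
    (x : A.obj (SimplexCategory.mk (p + 1))) : ∀ m,
      (f.app (SimplexCategory.mk (p + 1))).hom (normProjAux A p m x) =
        normProjAux B p m ((f.app (SimplexCategory.mk (p + 1))).hom x)
  | 0 => rfl
  | m + 1 => by
    rw [normProjAux, normProjAux]
    split_ifs with h
    · rw [LinearMap.comp_apply, LinearMap.comp_apply, ← normProjAux_naturality f p x m]
      set y := normProjAux A p m x
      have e1 := ConcreteCategory.congr_hom (f.naturality (SimplexCategory.σ ⟨m, h⟩)) y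
      have e2 := ConcreteCategory.congr_hom
        (f.naturality (SimplexCategory.δ (⟨m, h⟩ : Fin (p + 1)).succ)) ((A.σ ⟨m, h⟩).hom y)
      change (f.app _).hom (y - (A.δ (⟨m, h⟩ : Fin (p + 1)).succ).hom ((A.σ ⟨m, h⟩).hom y)) =
        (f.app _).hom y - (B.δ (⟨m, h⟩ : Fin (p + 1)).succ).hom
          ((B.σ ⟨m, h⟩).hom ((f.app _).hom y))
      rw [map_sub]
      refine congrArg ((f.app _).hom y - ·) (e2.trans ?_)
      exact congrArg (B.δ (⟨m, h⟩ : Fin (p + 1)).succ).hom e1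
    · exact normProjAux_naturality f p x m

/-- The natural projection of a cosimplicial module to its normalization. -/
def normProj (A : CosimplicialObject (ModuleCat.{w} k)) : (p : ℕ) →
    (A.obj (SimplexCategory.mk p) →ₗ[k] normSub A p)
  | 0 => LinearMap.id.codRestrict _ fun _ => Submodule.mem_top
  | p + 1 => (normProjAux A p (p + 1)).codRestrict _ fun x =>
      mem_normSub_succ.2 fun j => codeg_normProjAux A p x (p + 1) le_rfl j j.2

lemma normProj_coe (A : CosimplicialObject (ModuleCat.{w} k)) :
    (p : ℕ) → (x : normSub A p) → normProj A p x.1 = x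
  | 0, _ => rfl
  | p + 1, x => Subtype.ext (normProjAux_of_mem A p x.2 (p + 1))

lemma normProj_naturality {A B : CosimplicialObject (ModuleCat.{w} k)} (f : A ⟶ B) :
    (p : ℕ) → (x : A.obj (SimplexCategory.mk p)) →
      normMap f p (normProj A p x) = normProj B p ((f.app (SimplexCategory.mk p)).hom x)
  | 0, _ => rfl
  | p + 1, x => Subtype.ext (normProjAux_naturality f p x (p + 1))

end NormProj

/-! ### Injectivity of the terms of the normalized resolution -/

section Injective
variable {k : Type w} [Field k] {C : Type w} [SmallCategory C] {J : GrothendieckTopology C}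
  {S : Type w} (pt : S → GrothendieckTopology.Point.{w} J)

/-- The hypotheses say that `Q` is a product of skyscraper sheaves of modules `E s`, so a map to `Q`
amounts to a family of maps from stalks to the `E s`. Such maps extend along monomorphisms because
`k` is a field. -/
lemma injective_of_family (Q : Sheaf J (ModuleCat.{w} k)) (E : S → ModuleCat.{w} k)
    (π : (s : S) → (U : C) → (pt s).fiber.obj U → (Q.obj.obj (op U) ⟶ E s))
    (hπ : ∀ (s : S) ⦃U V : C⦄ (f : U ⟶ V) (u : (pt s).fiber.obj U),
      Q.obj.map f.op ≫ π s U u = π s V ((pt s).fiber.map f u))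
    (hb : ∀ U, Function.Bijective fun (x : Q.obj.obj (op U)) (t : Σ s, (pt s).fiber.obj U) =>
      (π t.1 U t.2).hom x) : Injective Q where
  factors {A B} g i _ := by
    -- Stalks preserve monomorphisms, and a monomorphism of vector spaces has a retraction.
    have hi : ∀ s, ∃ r : (pt s).sheafFiber.obj B ⟶ (pt s).sheafFiber.obj A,
        (pt s).sheafFiber.map i ≫ r = 𝟙 _ := fun s => by
      have : Mono ((pt s).sheafFiber.map i) := inferInstance
      obtain ⟨l, hl⟩ := LinearMap.exists_leftInverse_of_injective ((pt s).sheafFiber.map i).hom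
        ((ModuleCat.ker_eq_bot_of_mono _))
      exact ⟨ModuleCat.ofHom l, ModuleCat.hom_ext hl⟩
    choose r hr using hi
    let gs : (s : S) → ((pt s).sheafFiber.obj A ⟶ E s) := fun s =>
      (pt s).presheafFiberDesc (P := A.obj) (fun U u => g.hom.app (op U) ≫ π s U u)
        (fun U V f u => by rw [← Category.assoc, g.hom.naturality, Category.assoc, hπ])
    let Λ : (U : C) → (Q.obj.obj (op U) ≃ₗ[k] ((t : Σ s, (pt s).fiber.obj U) → E t.1)) :=
      fun U => LinearEquiv.ofBijective (LinearMap.pi (M₂ := Q.obj.obj (op U))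
        (φ := fun t : Σ s, (pt s).fiber.obj U => E t.1) fun t => (π t.1 U t.2).hom) (hb U)
    let G : (U : C) → (B.obj.obj (op U) →ₗ[k] ((t : Σ s, (pt s).fiber.obj U) → E t.1)) :=
      fun U => LinearMap.pi (M₂ := B.obj.obj (op U)) (φ := fun t : Σ s, (pt s).fiber.obj U => E t.1)
        fun t => ((pt t.1).toPresheafFiber U t.2 B.obj ≫ r t.1 ≫ gs t.1).hom
    have hG : ∀ U b (t : Σ s, (pt s).fiber.obj U), (π t.1 U t.2).hom ((Λ U).symm (G U b)) =
        ((pt t.1).toPresheafFiber U t.2 B.obj ≫ r t.1 ≫ gs t.1).hom b := fun U b t =>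
      congrFun ((Λ U).apply_symm_apply (G U b)) t
    refine ⟨⟨{ app := fun U => ModuleCat.ofHom ((Λ U.unop).symm.toLinearMap ∘ₗ G U.unop)
               naturality := fun U V f => ?_ }⟩, ?_⟩
    · ext b
      refine (hb V.unop).1 (funext fun t => ?_)
      refine (hG V.unop _ t).trans ?_
      have e1 := ConcreteCategory.congr_hom (hπ t.1 f.unop t.2) ((Λ U.unop).symm (G U.unop b))
      refine Eq.trans ?_ e1.symm
      refine Eq.trans ?_ (hG U.unop b ⟨t.1, (pt t.1).fiber.map f.unop t.2⟩).symm
      rw [← (pt t.1).toPresheafFiber_w f.unop t.2 B.obj]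
      rfl
    · apply ObjectProperty.hom_ext
      ext U a
      refine (hb U.unop).1 (funext fun t => ?_)
      refine (hG U.unop _ t).trans ?_
      have e1 := (pt t.1).toPresheafFiber_naturality i.hom U.unop t.2
      have e2 : (pt t.1).toPresheafFiber U.unop t.2 A.obj ≫ gs t.1 =
        g.hom.app U ≫ π t.1 U.unop t.2 := (pt t.1).toPresheafFiber_presheafFiberDesc _ _ _ _
      have e3 : i.hom.app U ≫ (pt t.1).toPresheafFiber U.unop t.2 B.obj ≫ r t.1 ≫ gs t.1 =
          g.hom.app U ≫ π t.1 U.unop t.2 := by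
        rw [← e2]
        refine (Category.assoc _ _ _).symm.trans ?_
        refine (congrArg (· ≫ r t.1 ≫ gs t.1) e1.symm).trans ?_
        refine (Category.assoc _ _ _).trans ?_
        refine congrArg (_ ≫ ·) ?_
        refine (Category.assoc _ _ _).symm.trans ?_
        exact (congrArg (· ≫ gs t.1) (hr t.1)).trans (Category.id_comp _)
      exact ConcreteCategory.congr_hom e3 a

/-- Here `Q` is a retract of a product of injective sheaves: the components of a map are extended
separately and then assembled by `b`. The product appears only through its sections, so it is not
needed as a sheaf. -/
lemma injective_of_retract_pi {ι : Type*} (Q : Sheaf J (ModuleCat.{w} k))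
    (R : ι → Sheaf J (ModuleCat.{w} k)) [∀ i, Injective (R i)] (a : (i : ι) → (Q ⟶ R i))
    (b : (U : Cᵒᵖ) → (((i : ι) → (R i).obj.obj U) →ₗ[k] Q.obj.obj U))
    (hb : ∀ ⦃U V : Cᵒᵖ⦄ (f : U ⟶ V) (x : (i : ι) → (R i).obj.obj U),
      (Q.obj.map f).hom (b U x) = b V fun i => ((R i).obj.map f).hom (x i))
    (hab : ∀ (U : Cᵒᵖ) (x : Q.obj.obj U), b U (fun i => ((a i).hom.app U).hom x) = x) :
    Injective Q where
  factors {A B} g i _ := by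
    let e : (j : ι) → (B ⟶ R j) := fun j => Injective.factorThru (g ≫ a j) i
    refine ⟨⟨{ app := fun U => ModuleCat.ofHom (b U ∘ₗ LinearMap.pi fun j => ((e j).hom.app U).hom)
               naturality := fun U V f => ?_ }⟩, ?_⟩
    · ext x
      refine Eq.trans ?_ (hb f _).symm
      exact congrArg (b V) (funext fun j =>
        ConcreteCategory.congr_hom ((e j).hom.naturality f) x)
    · apply ObjectProperty.hom_ext
      ext U x
      refine Eq.trans ?_ (hab U ((g.hom.app U).hom x))
      refine congrArg (b U) (funext fun j => ?_)
      exact ConcreteCategory.congr_hom (congrArg (fun φ => φ.hom.app U)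
        (Injective.comp_factorThru (g ≫ a j) i)) x

instance injective_godement (F : Sheaf J (Dg k)) (q : ℤ) :
    Injective ((sheafCompose J (HomologicalComplex.eval (ModuleCat.{w} k) (ComplexShape.up ℤ) q)).obj
      ((godement k pt).obj F)) :=
  injective_of_family pt _ (fun s => ((pt s).presheafFiber.obj F.obj).X q)
    (fun s U u => (godementProj pt F s U u).f q)
    (fun s _ _ f u => HomologicalComplex.congr_hom (map_godementProj pt F s f u) q)
    (fun U => isDegreewiseProduct_godementProj pt F U q)

/-- The piece of bidegree `(p, q)` lies in the degree `q` part of `G (G^p F)`, which is injective,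
and `normProj` is a retraction onto it that is compatible with restriction. -/
instance injective_sheafNG (F : Sheaf J (Dg k)) (n : ℤ) :
    Injective (((sheafComplex k J).obj ((sheafNG pt).obj F)).X n) := by
  refine injective_of_retract_pi (ι := Bideg n) _
    (fun s => (sheafCompose J (HomologicalComplex.eval (ModuleCat.{w} k) _ s.1.2)).obj
      ((godement k pt).obj ((monadIter (godement k pt) s.1.1).obj F)))
    (fun s => ⟨{ app := fun U => ModuleCat.ofHom ((normSub (row (godementSections k pt F U) s.1.2)
                  s.1.1).subtype ∘ₗ LinearMap.proj (R := k)
                  (φ := fun s : Bideg n => normSub (row (godementSections k pt F U) s.1.2) s.1.1) s)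
                 naturality := fun U V f => rfl }⟩)
    (fun U => LinearMap.pi (M₂ := (s : Bideg n) → (row (godementSections k pt F U) s.1.2).obj
        (SimplexCategory.mk s.1.1))
      (φ := fun s : Bideg n => normSub (row (godementSections k pt F U) s.1.2) s.1.1) fun s =>
      normProj (row (godementSections k pt F U) s.1.2) s.1.1 ∘ₗ LinearMap.proj s) ?_ ?_
  · intro U V f x
    funext s
    exact normProj_naturality (A := row (godementSections k pt F U) s.1.2)
      (B := row (godementSections k pt F V) s.1.2)
      (rowMap ((((CosimplicialObject.whiskering _ _).obj (sheafToPresheaf J (Dg k))).obj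
        ((godementCos k pt).obj F)).flip.map f) s.1.2) s.1.1 (x s)
  · intro U x
    funext s
    exact normProj_coe (row (godementSections k pt F U) s.1.2) s.1.1 _

end Injective

/-! ### Quasi-isomorphisms are detected on stalks -/

section Stalkwise
variable {k : Type w} [Field k] {C : Type w} [SmallCategory C] {J : GrothendieckTopology C}
  (Φ : GrothendieckTopology.Point.{w} J)

/-- Stalks commute with the forgetful functor to sets, and that functor reflects isomorphisms of
sheaves of modules. -/
lemma jointlyReflectIsomorphisms_sheafFiber {S : Type w}
    {pt : S → GrothendieckTopology.Point.{w} J}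
    (hpt : JointlyReflectIsomorphisms fun s => (pt s).sheafFiber (A := Type w)) :
    JointlyReflectIsomorphisms fun s => (pt s).sheafFiber (A := ModuleCat.{w} k) where
  isIso {K L} f _ := by
    rw [← isIso_iff_of_reflects_iso _ (sheafCompose J (forget (ModuleCat.{w} k))), hpt.isIso_iff]
    exact fun s => ((MorphismProperty.isomorphisms _).arrow_mk_iso_iff
      (((Functor.mapArrowFunctor _ _).mapIso
        ((pt s).sheafFiberCompIso (forget (ModuleCat.{w} k)))).app (Arrow.mk f))).2
          (inferInstanceAs (IsIso ((forget (ModuleCat.{w} k)).map ((pt s).sheafFiber.map f))))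

instance preservesFiniteColimits_sheafFiber :
    PreservesFiniteColimits (Φ.sheafFiber (A := ModuleCat.{w} k)) :=
  have : PreservesColimitsOfSize.{0, 0} (Φ.sheafFiber (A := ModuleCat.{w} k)) :=
    Φ.skyscraperSheafAdjunction.leftAdjoint_preservesColimits
  PreservesColimitsOfSize.preservesFiniteColimits _

instance preservesZeroMorphisms_sheafFiber :
    (Φ.sheafFiber (A := ModuleCat.{w} k)).PreservesZeroMorphisms :=
  have := Φ.skyscraperSheafAdjunction (A := ModuleCat.{w} k) |>.isLeftAdjoint
  inferInstance

instance preservesFilteredColimits_eval (n : ℤ) : PreservesFilteredColimitsOfSize.{w, w}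
    (HomologicalComplex.eval (ModuleCat.{w} k) (ComplexShape.up ℤ) n) :=
  ⟨fun _ _ _ => inferInstance⟩

/-- The stalk of a complex of sheaves is computed degreewise. -/
def stalkComplexIso (F : Sheaf J (Dg k)) :
    (Φ.sheafFiber.mapHomologicalComplex _).obj ((sheafComplex k J).obj F) ≅
      Φ.presheafFiber.obj F.obj :=
  HomologicalComplex.Hom.isoOfComponents
    (fun n => (Φ.presheafFiberCompIso (HomologicalComplex.eval (ModuleCat.{w} k) _ n)).app F.obj)
    (fun n n' _ => by
      refine Φ.presheafFiber_hom_ext fun U u => ?_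
      have e := fun m => Φ.toPresheafFiber_presheafFiberCompIso_hom_app
        (HomologicalComplex.eval (ModuleCat.{w} k) (ComplexShape.up ℤ) m) U u F.obj
      have e1 := Φ.toPresheafFiber_naturality
        (Functor.whiskerLeft F.obj (HomologicalComplex.dNatTrans (ModuleCat.{w} k)
          (ComplexShape.up ℤ) n n')) U u
      refine (Category.assoc _ _ _).symm.trans ?_
      refine (congrArg (· ≫ _) (e n)).trans ?_
      refine ((Φ.toPresheafFiber U u F.obj).comm n n').trans ?_
      refine Eq.trans ?_ (Category.assoc _ _ _)
      refine Eq.trans ?_ (congrArg (· ≫ _) e1).symm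
      refine Eq.trans ?_ (Category.assoc _ _ _).symm
      exact congrArg (_ ≫ ·) (e n').symm)

lemma stalkComplexIso_naturality {F F' : Sheaf J (Dg k)} (f : F ⟶ F') :
    (Φ.sheafFiber.mapHomologicalComplex _).map ((sheafComplex k J).map f) ≫
      (stalkComplexIso Φ F').hom = (stalkComplexIso Φ F).hom ≫ Φ.presheafFiber.map f.hom := by
  ext n : 1
  exact (Φ.presheafFiberCompIso (HomologicalComplex.eval (ModuleCat.{w} k) _ n)).hom.naturality f.hom

/-- Stalks of sheaves of modules are exact and jointly reflect isomorphisms, so homology may be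
tested on them; `stalkComplexIso` identifies the stalk of the complex of sheaves with the stalk of
the sheaf of complexes. -/
lemma quasiIso_sheafComplex_map {S : Type w} {pt : S → GrothendieckTopology.Point.{w} J}
    (hpt : JointlyReflectIsomorphisms fun s => (pt s).sheafFiber (A := Type w))
    {F F' : Sheaf J (Dg k)} (f : F ⟶ F') (hf : ∀ s, QuasiIso ((pt s).presheafFiber.map f.hom)) :
    QuasiIso ((sheafComplex k J).map f) := by
  rw [(jointlyReflectIsomorphisms_sheafFiber hpt).quasiIso_iff]
  intro s
  have := hf s
  refine (quasiIso_iff_comp_right _ (stalkComplexIso (pt s) F').hom).1 ?_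
  rw [stalkComplexIso_naturality]
  infer_instance

end Stalkwise

/-! ### Contraction of the total complex by an extra codegeneracy -/

section ExtraCodegeneracy
variable {k : Type w} [Field k]

/-- An extra codegeneracy of a coaugmented cosimplicial complex. -/
structure ExtraCodegeneracy {M : Dg k} {K : CosimplicialObject (Dg k)}
    (f : M ⟶ K.obj (SimplexCategory.mk 0)) where
  /-- the map to the coaugmentation object -/
  aug : K.obj (SimplexCategory.mk 0) ⟶ M
  /-- the maps in positive degrees -/
  codeg : (p : ℕ) → (K.obj (SimplexCategory.mk (p + 1)) ⟶ K.obj (SimplexCategory.mk p))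
  f_aug : f ≫ aug = 𝟙 M
  coface_zero_codeg : ∀ p, K.δ (0 : Fin (p + 2)) ≫ codeg p = 𝟙 _
  coface_one_codeg : K.δ (1 : Fin 2) ≫ codeg 0 = aug ≫ f
  coface_succ_codeg : ∀ p (i : Fin (p + 2)), K.δ i.succ ≫ codeg (p + 1) = codeg p ≫ K.δ i
  codeg_codeg : ∀ p (j : Fin (p + 1)), K.σ j.succ ≫ codeg p = codeg (p + 1) ≫ K.σ j

lemma totV_apply (K : CosimplicialObject (Dg k)) {n n' : ℤ} (h : n + 1 = n') (a : TotX K n) {p : ℕ}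
    {q q' : ℤ} (hq : q' + 1 = q) (hs : (p : ℤ) + q = n') :
    totV K n n' h a ⟨(p, q), hs⟩ = normMap (rowD K q' q) p (a ⟨(p, q'), by simp only; omega⟩) := by
  obtain rfl : q' = q - 1 := by omega
  rfl

namespace ExtraCodegeneracy
variable {M : Dg k} {K : CosimplicialObject (Dg k)} {f : M ⟶ K.obj (SimplexCategory.mk 0)}
  (h : ExtraCodegeneracy f)

/-- The extra codegeneracy on normalizations. -/
def norm (q : ℤ) (p : ℕ) : normSub (row K q) (p + 1) →ₗ[k] normSub (row K q) p :=
  ((h.codeg p).f q).hom.restrict (by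
    intro a ha
    cases p with
    | zero => trivial
    | succ p =>
      refine mem_normSub_succ.2 fun j => ?_
      have e := ConcreteCategory.congr_hom (HomologicalComplex.congr_hom (h.codeg_codeg p j) q) a
      refine e.symm.trans ?_
      exact (congrArg ((h.codeg p).f q).hom (mem_normSub_succ.1 ha j.succ)).trans (map_zero _))

lemma norm_rowD (q q' : ℤ) (p : ℕ) (a : normSub (row K q) (p + 1)) :
    h.norm q' p (normMap (rowD K q q') (p + 1) a) = normMap (rowD K q q') p (h.norm q p a) :=
  Subtype.ext (ConcreteCategory.congr_hom ((h.codeg p).comm q q') a.1).symm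

/-- In horizontal degree zero `δ^0` gives the identity, while `δ^1` gives the projection through the
coaugmentation. -/
lemma norm_normD_zero (q : ℤ) (a : normSub (row K q) 0) :
    h.norm q 0 (normD (row K q) 0 a) + ⟨(f.f q).hom ((h.aug.f q).hom a.1), Submodule.mem_top⟩ =
      a := by
  have e0 := ConcreteCategory.congr_hom (HomologicalComplex.congr_hom (h.coface_zero_codeg 0) q) a.1
  have e1 := ConcreteCategory.congr_hom (HomologicalComplex.congr_hom h.coface_one_codeg q) a.1
  let φ : (row K q).obj (SimplexCategory.mk 1) →ₗ[k] (row K q).obj (SimplexCategory.mk 0) :=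
    ((h.codeg 0).f q).hom
  apply Subtype.ext
  let ψ : (row K q).obj (SimplexCategory.mk 0) →ₗ[k] (row K q).obj (SimplexCategory.mk 0) :=
    (f.f q).hom ∘ₗ (h.aug.f q).hom
  change φ (altCoface (row K q) 0 a.1) + ψ a.1 = a.1
  rw [altCoface_zero_apply, map_sub]
  refine (congrArg (· + _) (congrArg₂ (· - ·) e0 e1)).trans ?_
  exact sub_add_cancel _ _

/-- The extra codegeneracy cancels `δ^0` and turns `δ^{i+1}` into `δ^i` after itself. The shift of
the index by one changes the sign, so the remaining sum is minus the differential of the lower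
degree. -/
lemma norm_normD_succ (q : ℤ) (p : ℕ) (a : normSub (row K q) (p + 1)) :
    h.norm q (p + 1) (normD (row K q) (p + 1) a) + normD (row K q) p (h.norm q p a) = a := by
  have e0 := ConcreteCategory.congr_hom
    (HomologicalComplex.congr_hom (h.coface_zero_codeg (p + 1)) q) a.1
  have e1 := fun i : Fin (p + 2) => ConcreteCategory.congr_hom
    (HomologicalComplex.congr_hom (h.coface_succ_codeg p i) q) a.1
  let φ : (row K q).obj (SimplexCategory.mk (p + 2)) →ₗ[k]
    (row K q).obj (SimplexCategory.mk (p + 1)) := ((h.codeg (p + 1)).f q).hom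
  let ψ : (row K q).obj (SimplexCategory.mk (p + 1)) →ₗ[k]
    (row K q).obj (SimplexCategory.mk p) := ((h.codeg p).f q).hom
  have e0' : φ (((row K q).δ (0 : Fin (p + 3))).hom a.1) = a.1 := e0
  have e1' : ∀ i : Fin (p + 2), φ (((row K q).δ i.succ).hom a.1) =
    ((row K q).δ i).hom (ψ a.1) := e1
  apply Subtype.ext
  change φ (altCoface (row K q) (p + 1) a.1) + altCoface (row K q) p (ψ a.1) = a.1
  have e2 : altCoface (row K q) (p + 1) a.1 = ((row K q).δ (0 : Fin (p + 3))).hom a.1 -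
      ∑ i : Fin (p + 2), (-1 : k) ^ (i : ℕ) • ((row K q).δ i.succ).hom a.1 := by
    simp only [altCoface, LinearMap.sum_apply, LinearMap.smul_apply]
    rw [Fin.sum_univ_succ]
    simp [pow_succ, sub_eq_add_neg]
  rw [e2, map_sub, map_sum, e0']
  simp only [altCoface, LinearMap.sum_apply, LinearMap.smul_apply, map_smul, e1', sub_add_cancel]

/-- The retraction of the coaugmentation. -/
def retraction : totN.obj K ⟶ M where
  f n := ModuleCat.ofHom ((h.aug.f n).hom ∘ₗ (normSub (row K n) 0).subtype ∘ₗ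
    LinearMap.proj (R := k) (φ := fun s : Bideg n => normSub (row K s.1.2) s.1.1)
      ⟨(0, n), by simp⟩)
  comm' n n' hn := by
    simp only [ComplexShape.up_Rel] at hn
    have e : (totN.obj K).d n n' = ModuleCat.ofHom (totD K n n' hn) := dif_pos hn
    rw [e]
    ext a : 2
    change (M.d n n').hom ((h.aug.f n).hom (a ⟨(0, n), _⟩).1) =
      (h.aug.f n').hom (0 + (-1 : k) ^ 0 • totV K n n' hn a ⟨(0, n'), _⟩).1
    have e1 : ∀ y : normSub (row K n') 0, 0 + (-1 : k) ^ 0 • y = y := fun y => by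
      rw [pow_zero, one_smul, zero_add]
    have e2 := (e1 _).trans (totV_apply K hn a (p := 0) hn (by simp))
    refine Eq.trans ?_ (congrArg (fun y : normSub (row K n') 0 => (h.aug.f n').hom y.1) e2).symm
    exact ConcreteCategory.congr_hom (h.aug.comm n n') _

/-- The contracting homotopy. -/
def htpy (n n' : ℤ) (hn : n' + 1 = n) : TotX K n →ₗ[k] TotX K n' where
  toFun a := fun s => h.norm s.1.2 s.1.1
    (a ⟨(s.1.1 + 1, s.1.2), by have := s.2; simp only [Nat.cast_add, Nat.cast_one]; omega⟩)
  map_add' a b := by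
    funext s
    exact map_add (h.norm s.1.2 s.1.1) _ _
  map_smul' c a := by
    funext s
    exact map_smul (h.norm s.1.2 s.1.1) _ _

lemma totD_htpy (n₀ n n₁ : ℤ) (h₀ : n₀ + 1 = n)
    (h₁ : n + 1 = n₁) (a : TotX K n) :
    htpy h n₁ n h₁ (totD K n n₁ h₁ a) + totD K n₀ n h₀ (htpy h n n₀ h₀ a) +
      totAugX f n ((h.aug.f n).hom (a ⟨(0, n), by simp⟩).1) = a := by
  -- The homotopy commutes with vertical differentials. These carry opposite signs in horizontal
  -- degrees `p` and `p + 1`, so the vertical terms cancel and the two horizontal lemmas remain.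
  have hv : ∀ (q : ℤ) (p : ℕ) (hs : (p : ℤ) + q = n),
      totV K n₀ n h₀ (htpy h n n₀ h₀ a) ⟨(p, q), hs⟩ =
        h.norm q p (totV K n n₁ h₁ a
          ⟨(p + 1, q), by simp only [Nat.cast_add, Nat.cast_one]; omega⟩) := by
    intro q p hs
    exact (h.norm_rowD _ _ _ _).symm
  funext s
  obtain ⟨⟨_ | p, q⟩, hs⟩ := s
  · obtain rfl : q = n := by simpa using hs
    change h.norm q 0 (normD (row K q) 0 (a ⟨(0, q), hs⟩) + (-1 : k) ^ 1 • totV K q n₁ h₁ a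
        ⟨(0 + 1, q), by simp only [Nat.cast_add, Nat.cast_one] at hs ⊢; omega⟩) +
      (0 + (-1 : k) ^ 0 • totV K n₀ q h₀ (htpy h q n₀ h₀ a) ⟨(0, q), hs⟩) +
      (⟨(f.f q).hom (idMap M q q ((h.aug.f q).hom (a ⟨(0, q), hs⟩).1)), _⟩ :
        normSub (row K q) 0) = a ⟨(0, q), hs⟩
    rw [hv, map_add, map_smul]
    refine Eq.trans ?_ (h.norm_normD_zero q (a ⟨(0, q), hs⟩))
    have e : idMap M q q ((h.aug.f q).hom (a ⟨(0, q), hs⟩).1) =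
      (h.aug.f q).hom (a ⟨(0, q), hs⟩).1 := idMap_self _ _ _
    refine congrArg₂ (· + ·) ?_ (Subtype.ext (congrArg (f.f q).hom e))
    module
  · change h.norm q (p + 1) (normD (row K q) (p + 1) (a ⟨(p + 1, q), hs⟩) +
        (-1 : k) ^ (p + 1 + 1) • totV K n n₁ h₁ a
          ⟨(p + 1 + 1, q), by simp only [Nat.cast_add, Nat.cast_one] at hs ⊢; omega⟩) +
      (normD (row K q) p (h.norm q p (a ⟨(p + 1, q), hs⟩)) +
        (-1 : k) ^ (p + 1) • totV K n₀ n h₀ (htpy h n n₀ h₀ a) ⟨(p + 1, q), hs⟩) + 0 =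
          a ⟨(p + 1, q), hs⟩
    rw [hv, map_add, map_smul, pow_succ _ (p + 1)]
    refine Eq.trans ?_ (h.norm_normD_succ q p (a ⟨(p + 1, q), hs⟩))
    module

/-- The components of the contracting homotopy. -/
def htpyHom (n n' : ℤ) : (totN.obj K).X n ⟶ (totN.obj K).X n' :=
  if hn : n' + 1 = n then ModuleCat.ofHom (htpy h n n' hn) else 0

lemma htpyHom_eq {n n' : ℤ} (hn : n' + 1 = n) :
    h.htpyHom n n' = ModuleCat.ofHom (htpy h n n' hn) := dif_pos hn

lemma totAug_retraction (hf : f ≫ K.δ (0 : Fin 2) = f ≫ K.δ 1) :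
    totAug f hf ≫ h.retraction = 𝟙 M := by
  ext n (a : M.X n)
  have e := ConcreteCategory.congr_hom (HomologicalComplex.congr_hom h.f_aug n) (idMap M n n a)
  exact e.trans (idMap_self M n a)

/-- The homotopy equivalence attached to an extra codegeneracy. -/
def homotopyEquiv (hf : f ≫ K.δ (0 : Fin 2) = f ≫ K.δ 1) : HomotopyEquiv M (totN.obj K) where
  hom := totAug f hf
  inv := h.retraction
  homotopyHomInvId := Homotopy.ofEq (h.totAug_retraction hf)
  homotopyInvHomId := Homotopy.symm
    { hom := h.htpyHom
      zero := fun n n' hn => dif_neg hn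
      comm := fun n => by
        rw [dNext_eq _ (show (ComplexShape.up ℤ).Rel n (n + 1) from rfl),
          prevD_eq _ (show (ComplexShape.up ℤ).Rel (n - 1) n from sub_add_cancel n 1),
          h.htpyHom_eq rfl, h.htpyHom_eq (sub_add_cancel n 1)]
        have e : (totN.obj K).d n (n + 1) = ModuleCat.ofHom (totD K n (n + 1) rfl) := dif_pos rfl
        have e' : (totN.obj K).d (n - 1) n =
          ModuleCat.ofHom (totD K (n - 1) n (sub_add_cancel n 1)) := dif_pos (sub_add_cancel n 1)
        rw [e, e']
        ext a : 2
        exact (h.totD_htpy (n - 1) n (n + 1) (sub_add_cancel n 1) rfl a).symm }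

lemma quasiIso_totAug (h : ExtraCodegeneracy f) (hf : f ≫ K.δ (0 : Fin 2) = f ≫ K.δ 1) : QuasiIso (totAug f hf) :=
  (h.homotopyEquiv hf).quasiIso_hom

end ExtraCodegeneracy
end ExtraCodegeneracy

/-! ### Stalks of total complexes in the bounded below case -/

section StalkTot
variable {k : Type w} [Field k] {C : Type w} [SmallCategory C] {J : GrothendieckTopology C}
  (Φ : GrothendieckTopology.Point.{w} J)

/-- The conditions persist under further refinement, so finitely many of them can be imposed one
after the other. It is here that products must be finite in order to commute with stalks. -/
lemma exists_refinement {ι : Type*} {U : C} (u : Φ.fiber.obj U)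
    (P : ι → (V : C) → (V ⟶ U) → Φ.fiber.obj V → Prop)
    (hP : ∀ i ⦃V W : C⦄ (f : V ⟶ U) (g : W ⟶ V) (z : Φ.fiber.obj W),
      P i V f (Φ.fiber.map g z) → P i W (g ≫ f) z) (t : Finset ι)
    (h : ∀ i ∈ t, ∀ (V : C) (f : V ⟶ U) (y : Φ.fiber.obj V), Φ.fiber.map f y = u →
      ∃ (W : C) (g : W ⟶ V) (z : Φ.fiber.obj W), Φ.fiber.map g z = y ∧ P i W (g ≫ f) z) :
    ∃ (V : C) (f : V ⟶ U) (y : Φ.fiber.obj V), Φ.fiber.map f y = u ∧ ∀ i ∈ t, P i V f y := by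
  classical
  induction t using Finset.induction_on with
  | empty => exact ⟨U, 𝟙 U, u, by simp, by simp⟩
  | insert i t _ ih =>
    obtain ⟨V, f, y, rfl, hy⟩ := ih fun j hj => h j (Finset.mem_insert_of_mem hj)
    obtain ⟨W, g, z, rfl, hz⟩ := h i (Finset.mem_insert_self i t) V f y rfl
    refine ⟨W, g ≫ f, z, by simp, fun j hj => ?_⟩
    rcases Finset.mem_insert.1 hj with rfl | hj
    · exact hz
    · exact hP j f g z (hy j hj)

variable (K : CosimplicialObject (Cᵒᵖ ⥤ Dg k))

/-- The stalk of a cosimplicial presheaf of complexes. -/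
abbrev stalkCos : CosimplicialObject (Dg k) :=
  ((CosimplicialObject.whiskering _ _).obj Φ.presheafFiber).obj K

/-- The normalized total complex of a cosimplicial presheaf of complexes. -/
abbrev totPre : Cᵒᵖ ⥤ Dg k := K.flip ⋙ totN

/-- The map from sections to stalks of a cosimplicial presheaf of complexes. -/
def toStalkCos (U : C) (u : Φ.fiber.obj U) :
    (show CosimplicialObject (Dg k) from K.flip.obj (op U)) ⟶ stalkCos Φ K where
  app m := Φ.toPresheafFiber U u (K.obj m)
  naturality _ _ g := (Φ.toPresheafFiber_naturality (K.map g) U u).symm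

/-- The map from the stalk of the total complex to the total complex of the stalk. -/
def stalkTotMap : Φ.presheafFiber.obj (totPre K) ⟶ totN.obj (stalkCos Φ K) :=
  Φ.presheafFiberDesc (P := totPre K) (fun U u => totN.map (toStalkCos Φ K U u))
    (fun U V f u => by
      refine (totN.map_comp _ _).symm.trans (congrArg totN.map ?_)
      refine NatTrans.ext (funext fun m => ?_)
      exact Φ.toPresheafFiber_w f u (K.obj m))

lemma stalkTotMap_germ {n : ℤ} {U : C} (u : Φ.fiber.obj U)
    (a : TotX (K.flip.obj (op U)) n) :
    (((stalkTotMap Φ K).f n).hom (germ Φ (totPre K) U u n a) : TotX (stalkCos Φ K) n) =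
      totMap (toStalkCos Φ K U u) n a :=
  ConcreteCategory.congr_hom (HomologicalComplex.congr_hom
    (Φ.toPresheafFiber_presheafFiberDesc (P := totPre K) (fun U u => totN.map (toStalkCos Φ K U u))
      _ U u) n) a

variable {K} {b : ℤ}

lemma stalk_eq_zero {P : Cᵒᵖ ⥤ Dg k} (hP : ∀ q < b, ∀ (U : C) (x : (P.obj (op U)).X q), x = 0) :
    ∀ q < b, ∀ x : (Φ.presheafFiber.obj P).X q, x = 0 := by
  intro q hq x
  obtain ⟨U, u, a, rfl⟩ := germ_surjective Φ P q x
  rw [hP q hq U a, map_zero]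

/-- A finite set which contains the bidegrees of total degree `n` with vertical degree at least `b`. -/
def bidegFinset (n b : ℤ) : Finset (Bideg n) :=
  (Finset.range ((n - b).toNat + 1)).image fun p => ⟨(p, n - p), by simp⟩

lemma mem_bidegFinset {n b : ℤ} (s : Bideg n) (hs : b ≤ s.1.2) : s ∈ bidegFinset n b := by
  have := s.2
  refine Finset.mem_image.2 ⟨s.1.1, Finset.mem_range.2 (by omega), ?_⟩
  exact Subtype.ext (Prod.ext rfl (by simp only; omega))

/-- If the image of a germ is zero, all components have zero germs. Components of vertical degree
below `b` vanish anyway, and one refinement kills the finitely many others. -/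
lemma stalkTotMap_injective
    (hK : ∀ m, ∀ q < b, ∀ (U : C) (x : (((K.obj m).obj (op U)).X q)), x = 0) (n : ℤ) :
    Function.Injective ((stalkTotMap Φ K).f n).hom := by
  rw [injective_iff_map_eq_zero]
  intro y hy
  obtain ⟨U, u, a, rfl⟩ := germ_surjective Φ (totPre K) n y
  have hy' := (stalkTotMap_germ Φ K u a).symm.trans hy
  have h0 : ∀ s : Bideg n, germ Φ (K.obj (SimplexCategory.mk s.1.1)) U u s.1.2 (a s).1 = 0 :=
    fun s => congrArg (fun z : TotX (stalkCos Φ K) n => (z s).1) hy'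
  obtain ⟨V, f, v, rfl, hv⟩ := exists_refinement Φ u
    (fun (s : Bideg n) V (f : V ⟶ U) _ =>
      (((K.obj (SimplexCategory.mk s.1.1)).map f.op).f s.1.2).hom (a s).1 = 0)
    (by
      intro s V W f g z h
      rw [op_comp, Functor.map_comp]
      exact (congrArg (((K.obj (SimplexCategory.mk s.1.1)).map g.op).f s.1.2).hom h).trans
        (map_zero _))
    (bidegFinset n b) (by
      rintro s _ V f y rfl
      have h1 := (germ_res Φ (K.obj (SimplexCategory.mk s.1.1)) f y s.1.2 (a s).1).trans (h0 s)
      rw [← map_zero (germ Φ _ V y s.1.2), germ_eq_iff] at h1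
      obtain ⟨W, g, z, rfl, hz⟩ := h1
      refine ⟨W, g, z, rfl, ?_⟩
      rw [op_comp, Functor.map_comp]
      exact hz.trans (map_zero _))
  rw [← germ_res]
  refine (congrArg (germ Φ (totPre K) V v n) ?_).trans (map_zero _)
  funext s
  apply Subtype.ext
  rcases lt_or_ge s.1.2 b with hs | hs
  · exact hK _ _ hs V _
  · exact hv s (mem_bidegFinset s hs)

/-- A representative of `y` need not be normalized, but its finitely many codegeneracies have zero
germs and so vanish after a refinement. -/
lemma exists_normSub_germ (p : ℕ) (q : ℤ) (y : normSub (row (stalkCos Φ K) q) p) {U : C}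
    (u : Φ.fiber.obj U) : ∃ (V : C) (f : V ⟶ U) (v : Φ.fiber.obj V)
      (a : normSub (row (K.flip.obj (op V)) q) p), Φ.fiber.map f v = u ∧
        germ Φ (K.obj (SimplexCategory.mk p)) V v q a.1 = y.1 := by
  obtain ⟨U', u', a, ha⟩ := germ_surjective Φ (K.obj (SimplexCategory.mk p)) q y.1
  obtain ⟨V, f, f', v, rfl, rfl⟩ := fiber_common Φ u u'
  rw [← germ_res] at ha
  set c := (((K.obj (SimplexCategory.mk p)).map f'.op).f q).hom a with hc
  cases p with
  | zero => exact ⟨V, f, v, ⟨c, Submodule.mem_top⟩, rfl, ha⟩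
  | succ p =>
    obtain ⟨W, g, z, rfl, hz⟩ := exists_refinement Φ v
      (fun (j : Fin (p + 1)) W (g : W ⟶ V) _ =>
        (((K.obj (SimplexCategory.mk p)).map g.op).f q).hom
          ((((K.σ j).app (op V)).f q).hom c) = 0)
      (by
        intro j V W f g z h
        rw [op_comp, Functor.map_comp]
        exact (congrArg (((K.obj (SimplexCategory.mk p)).map g.op).f q).hom h).trans
          (map_zero _))
      Finset.univ (by
        rintro j _ W g z rfl
        have h1 : germ Φ (K.obj (SimplexCategory.mk p)) V (Φ.fiber.map g z) q
            ((((K.σ j).app (op V)).f q).hom c) = 0 := by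
          rw [← presheafFiber_map_germ, ha]
          exact mem_normSub_succ.1 y.2 j
        rw [← germ_res, ← map_zero (germ Φ _ W z q), germ_eq_iff] at h1
        obtain ⟨W', g', z', rfl, hz⟩ := h1
        refine ⟨W', g', z', rfl, ?_⟩
        rw [op_comp, Functor.map_comp]
        exact hz.trans (map_zero _))
    refine ⟨W, g ≫ f, z, ⟨(((K.obj (SimplexCategory.mk (p + 1))).map g.op).f q).hom c, ?_⟩,
      by simp, ?_⟩
    · refine mem_normSub_succ.2 fun j => ?_
      refine Eq.trans ?_ (hz j (Finset.mem_univ j))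
      exact ConcreteCategory.congr_hom (HomologicalComplex.congr_hom
        ((K.σ j).naturality g.op) q) c
    · exact (germ_res _ _ _ _ _ _).trans ha

/-- Finitely many components have to be represented on one common neighbourhood; the others are zero
by boundedness. -/
lemma stalkTotMap_surjective
    (hK : ∀ m, ∀ q < b, ∀ (U : C) (x : (((K.obj m).obj (op U)).X q)), x = 0) (n : ℤ) :
    Function.Surjective ((stalkTotMap Φ K).f n).hom := by
  intro (y : TotX (stalkCos Φ K) n)
  obtain ⟨⟨U, u⟩⟩ : Nonempty Φ.fiber.Elements := IsCofiltered.nonempty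
  obtain ⟨V, f, v, rfl, hv⟩ := exists_refinement Φ u
    (fun (s : Bideg n) V _ v => ∃ a : normSub (row (K.flip.obj (op V)) s.1.2) s.1.1,
      germ Φ (K.obj (SimplexCategory.mk s.1.1)) V v s.1.2 a.1 = (y s).1)
    (by
      rintro s V W f g z ⟨a, ha⟩
      refine ⟨normMap (rowMap (K.flip.map g.op) s.1.2) s.1.1 a, ?_⟩
      exact (germ_res _ _ _ _ _ _).trans ha)
    (bidegFinset n b) (by
      rintro s _ V f v rfl
      obtain ⟨W, g, z, a, rfl, ha⟩ := exists_normSub_germ Φ s.1.1 s.1.2 (y s) v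
      exact ⟨W, g, z, rfl, a, ha⟩)
  have hv' : ∀ s : Bideg n, ∃ a : normSub (row (K.flip.obj (op V)) s.1.2) s.1.1,
      germ Φ (K.obj (SimplexCategory.mk s.1.1)) V v s.1.2 a.1 = (y s).1 := by
    intro s
    rcases lt_or_ge s.1.2 b with hs | hs
    · refine ⟨0, (map_zero _).trans ?_⟩
      exact (stalk_eq_zero Φ (hK (SimplexCategory.mk s.1.1)) _ hs _).symm
    · exact hv s (mem_bidegFinset s hs)
  choose a ha using hv'
  refine ⟨germ Φ (totPre K) V v n (a : TotX (K.flip.obj (op V)) n), ?_⟩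
  refine (stalkTotMap_germ Φ K v a).trans ?_
  exact funext fun s => Subtype.ext (ha s)

lemma isIso_stalkTotMap
    (hK : ∀ m, ∀ q < b, ∀ (U : C) (x : (((K.obj m).obj (op U)).X q)), x = 0) :
    IsIso (stalkTotMap Φ K) := by
  have : ∀ n, IsIso ((stalkTotMap Φ K).f n) := fun n =>
    (ConcreteCategory.isIso_iff_bijective _).2
      ⟨stalkTotMap_injective Φ hK n, stalkTotMap_surjective Φ hK n⟩
  exact HomologicalComplex.Hom.isIso_of_components _

end StalkTot

/-! ### Cofaces and codegeneracies in terms of the outermost functor -/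

section MonadCofaces
variable {E : Type*} [Category* E] (T : Monad E) (X : E)

lemma monadMap_zero_one (f : Fin 0 →o Fin 1) : monadMap T X 0 1 f = T.η.app X := by
  rw [monadMap.eq_2, monadMap.eq_1, Category.id_comp]
  rfl

/-- The element `0` stands for the outermost copy of `T`; a map missing only this element inserts a
unit there. -/
lemma monadMap_succ {n : ℕ} (f : Fin n →o Fin (n + 1)) (hf : ∀ i, f i = i.succ) :
    monadMap T X n (n + 1) f = etaAt T X n := by
  cases n with
  | zero => rw [monadMap_zero_one]; rfl
  | succ n =>
    have h : f 0 ≠ 0 := by rw [hf]; exact Fin.succ_ne_zero _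
    have e : predHom f h = OrderHom.id := by
      ext i
      exact congrArg Fin.val (Fin.succ_injective _ ((succ_predHom f h i).trans (hf i)))
    rw [monadMap.eq_4, dif_neg h, e, monadMap_id, Category.id_comp]

/-- If the fibre over `0` is `{0}`, the outermost copy of `T` is left alone and `monadMap` is `T` of
the map on the rest. In the recursion this appears as `T η` followed by `μ`, which cancel. -/
lemma monadMap_of_succ {m n : ℕ} (f : Fin (m + 1) →o Fin (n + 1)) (g : Fin m →o Fin n)
    (h0 : f 0 = 0) (hf : ∀ i, f (Fin.succ i) = (g i).succ) :
    monadMap T X (m + 1) (n + 1) f = upMap T (monadMap T X m n g) := by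
  let d : Fin n →o Fin (n + 1) := ⟨Fin.succ, fun _ _ h => Fin.succ_le_succ_iff.2 h⟩
  have e : tailHom f = d.comp g := by
    ext i
    exact congrArg Fin.val (hf i)
  rw [monadMap.eq_4, dif_pos h0, e, monadMap_comp, monadMap_succ T X d fun _ => rfl, upMap_comp,
    Category.assoc, upMap_etaAt_muAt, Category.comp_id]

end MonadCofaces

/-! ### The normalized Godement complex is a resolution -/

section StalkNG
variable {k : Type w} [Field k] {C : Type w} [SmallCategory C] {J : GrothendieckTopology C}
  {S : Type w} (pt : S → GrothendieckTopology.Point.{w} J)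

lemma stalkCounit_naturality {F F' : Sheaf J (Dg k)} (g : F ⟶ F') (s : S) :
    (pt s).presheafFiber.map ((godement k pt).map g).hom ≫ stalkCounit pt F' s =
      stalkCounit pt F s ≫ (pt s).presheafFiber.map g.hom := by
  refine (pt s).presheafFiber_hom_ext fun U u => ?_
  refine (Category.assoc _ _ _).symm.trans ?_
  refine (congrArg (· ≫ _) ((pt s).toPresheafFiber_naturality _ U u)).trans ?_
  refine (Category.assoc _ _ _).trans ?_
  refine (congrArg (_ ≫ ·) (toPresheafFiber_stalkCounit pt F' s U u)).trans ?_
  refine (godement_map_godementProj pt g s U u).trans ?_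
  refine Eq.trans ?_ (Category.assoc _ _ _)
  exact congrArg (· ≫ _) (toPresheafFiber_stalkCounit pt F s U u).symm

lemma unit_stalkCounit (F : Sheaf J (Dg k)) (s : S) :
    (pt s).presheafFiber.map ((godement k pt).η.app F).hom ≫ stalkCounit pt F s = 𝟙 _ := by
  refine (pt s).presheafFiber_hom_ext fun U u => ?_
  refine (Category.assoc _ _ _).symm.trans ?_
  refine (congrArg (· ≫ _) ((pt s).toPresheafFiber_naturality _ U u)).trans ?_
  refine (Category.assoc _ _ _).trans ?_
  refine (congrArg (_ ≫ ·) (toPresheafFiber_stalkCounit pt F s U u)).trans ?_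
  exact (unit_godementProj pt F s U u).trans (Category.comp_id _).symm

/-- The cosimplicial presheaf underlying the cosimplicial Godement resolution. -/
abbrev godementPreCos (F : Sheaf J (Dg k)) : CosimplicialObject (Cᵒᵖ ⥤ Dg k) :=
  ((CosimplicialObject.whiskering _ _).obj (sheafToPresheaf J (Dg k))).obj ((godementCos k pt).obj F)

lemma stalk_map_upMap_stalkCounit (F : Sheaf J (Dg k)) (s : S) {m n : ℕ}
    (g : (monadIter (godement k pt) m).obj F ⟶ (monadIter (godement k pt) n).obj F)
    (f : (monadIter (godement k pt) (m + 1)).obj F ⟶ (monadIter (godement k pt) (n + 1)).obj F)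
    (h : f = upMap (godement k pt) g) :
    (pt s).presheafFiber.map f.hom ≫ stalkCounit pt ((monadIter (godement k pt) n).obj F) s =
      stalkCounit pt ((monadIter (godement k pt) m).obj F) s ≫ (pt s).presheafFiber.map g.hom := by
  rw [h]
  exact stalkCounit_naturality pt g s

/-- The extra codegeneracy of the stalk of the cosimplicial Godement resolution. -/
def extraCodegeneracy (F : Sheaf J (Dg k)) (s : S) :
    ExtraCodegeneracy (K := stalkCos (pt s) (godementPreCos pt F))
      ((pt s).presheafFiber.map (godementUnit k pt F).hom) where
  aug := stalkCounit pt F s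
  codeg p := stalkCounit pt ((monadIter (godement k pt) (p + 1)).obj F) s
  f_aug := unit_stalkCounit pt F s
  -- The coface `δ^0` is the unit at the outermost `G`, so this is a triangle identity of the
  -- adjunction.
  coface_zero_codeg p := by
    have h : ((godementCos k pt).obj F).δ (0 : Fin (p + 2)) =
        (godement k pt).η.app ((monadIter (godement k pt) (p + 1)).obj F) :=
      monadMap_succ (godement k pt) F _ fun i => rfl
    refine Eq.trans ?_ (unit_stalkCounit pt ((monadIter (godement k pt) (p + 1)).obj F) s)
    exact congrArg (fun φ => (pt s).presheafFiber.map φ.hom ≫ _) h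
  -- This coface, and the operators in the remaining fields, are `G` applied to a map, so the
  -- identities are naturality of the counit.
  coface_one_codeg := stalk_map_upMap_stalkCounit pt F s _ _
    ((monadMap_of_succ (godement k pt) F _ (emptyHom 1) rfl fun i => i.elim0).trans
      (congrArg _ (monadMap_zero_one _ _ _)))
  coface_succ_codeg p i := stalk_map_upMap_stalkCounit pt F s _ _
    (monadMap_of_succ (godement k pt) F _ _ rfl fun j => (Fin.succ_succAbove_succ i j))
  codeg_codeg p j := stalk_map_upMap_stalkCounit pt F s _ _
    (monadMap_of_succ (godement k pt) F _ _ rfl fun i => (Fin.succ_predAbove_succ j i))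

/-- Vanishing of a sheaf of complexes in degrees smaller than `b`. -/
def VanishesBelow (F : Sheaf J (Dg k)) (b : ℤ) : Prop :=
  ∀ q < b, ∀ (U : C) (x : (F.obj.obj (op U)).X q), x = 0

lemma exists_vanishesBelow {F : Sheaf J (Dg k)} (hF : bddBelow k J F) : ∃ b, VanishesBelow F b := by
  obtain ⟨b, hb⟩ := hF
  refine ⟨b, fun q hq U x => ?_⟩
  have h := (((sheafComplex k J).obj F).isZero_of_isStrictlyGE b q hq).eq_of_src (𝟙 _) 0
  exact ConcreteCategory.congr_hom (congrArg (fun φ => φ.hom.app (op U)) h) x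

lemma bddBelow_of_vanishesBelow {F : Sheaf J (Dg k)} {b : ℤ} (hF : VanishesBelow F b) :
    bddBelow k J F := by
  refine ⟨b, (CochainComplex.isStrictlyGE_iff _ _).2 fun q hq => ?_⟩
  rw [IsZero.iff_id_eq_zero]
  apply ObjectProperty.hom_ext
  ext U : 2
  exact ModuleCat.hom_ext (LinearMap.ext fun x => hF q hq U.unop x)

lemma vanishesBelow_godement {F : Sheaf J (Dg k)} {b : ℤ} (hF : VanishesBelow F b) :
    VanishesBelow ((godement k pt).obj F) b := fun q hq U _ =>
  (isDegreewiseProduct_godementProj pt F U q).1 (funext fun t =>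
    (stalk_eq_zero (pt t.1) hF q hq _).trans (stalk_eq_zero (pt t.1) hF q hq _).symm)

lemma vanishesBelow_monadIter {F : Sheaf J (Dg k)} {b : ℤ} (hF : VanishesBelow F b) :
    ∀ n, VanishesBelow ((monadIter (godement k pt) n).obj F) b
  | 0 => hF
  | n + 1 => vanishesBelow_godement pt (vanishesBelow_monadIter hF n)

lemma vanishesBelow_sheafNG {F : Sheaf J (Dg k)} {b : ℤ} (hF : VanishesBelow F b) :
    VanishesBelow ((sheafNG pt).obj F) b := fun q hq U (_ : TotX (godementSections k pt F (op U)) q) =>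
  funext fun s => Subtype.ext (vanishesBelow_monadIter pt hF (s.1.1 + 1) s.1.2
    (by have := s.2; omega) U _)

lemma bddBelow_sheafNG {F : Sheaf J (Dg k)} (hF : bddBelow k J F) :
    bddBelow k J ((sheafNG pt).obj F) := by
  obtain ⟨b, hb⟩ := exists_vanishesBelow hF
  exact bddBelow_of_vanishesBelow (vanishesBelow_sheafNG pt hb)

/-- The stalk of the coaugmentation becomes the coaugmentation of the cosimplicial stalk, which has
an extra codegeneracy. -/
lemma stalk_toNG_stalkTotMap (F : Sheaf J (Dg k)) (s : S)
    (hf : (pt s).presheafFiber.map (godementUnit k pt F).hom ≫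
      (stalkCos (pt s) (godementPreCos pt F)).δ (0 : Fin 2) =
        (pt s).presheafFiber.map (godementUnit k pt F).hom ≫
          (stalkCos (pt s) (godementPreCos pt F)).δ 1) :
    (pt s).presheafFiber.map ((toSheafNG pt).app F).hom ≫
      stalkTotMap (pt s) (godementPreCos pt F) =
        totAug (K := stalkCos (pt s) (godementPreCos pt F))
          ((pt s).presheafFiber.map (godementUnit k pt F).hom) hf := by
  refine (pt s).presheafFiber_hom_ext fun U u => ?_
  refine (Category.assoc _ _ _).symm.trans ?_
  refine (congrArg (· ≫ _) ((pt s).toPresheafFiber_naturality _ U u)).trans ?_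
  refine (Category.assoc _ _ _).trans ?_
  refine (congrArg (_ ≫ ·) ((pt s).toPresheafFiber_presheafFiberDesc
    (P := totPre (godementPreCos pt F))
    (fun U u => totN.map (toStalkCos (pt s) (godementPreCos pt F) U u)) _ U u)).trans ?_
  exact totAug_naturality _ (godementUnit_app_coface pt F (op U)) _ hf _ _
    ((pt s).toPresheafFiber_naturality _ U u).symm

lemma map_comp_coface {E E' : Type*} [Category* E] [Category* E'] (Ψ : E ⥤ E')
    {L : CosimplicialObject E} {A : E} {f : A ⟶ L.obj (SimplexCategory.mk 0)}
    (h : f ≫ L.δ (0 : Fin 2) = f ≫ L.δ 1) :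
    Ψ.map f ≫ (((CosimplicialObject.whiskering _ _).obj Ψ).obj L).δ (0 : Fin 2) =
      Ψ.map f ≫ (((CosimplicialObject.whiskering _ _).obj Ψ).obj L).δ 1 :=
  (Ψ.map_comp _ _).symm.trans ((congrArg Ψ.map h).trans (Ψ.map_comp _ _))

lemma quasiIso_of_comp_eq {K L M : Dg k} {f : K ⟶ L} {g : L ⟶ M} {h : K ⟶ M}
    (hg : IsIso g) (e : f ≫ g = h) (hh : QuasiIso h) : QuasiIso f := by
  subst e
  exact (quasiIso_iff_comp_right f g).1 hh

/-- On each stalk the map is, up to the isomorphism `stalkTotMap`, a homotopy equivalence.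
Boundedness of `F` passes to all iterates of `G`, with the same bound, which makes `stalkTotMap`
invertible. -/
lemma quasiIso_toSheafNG
    (hpt : JointlyReflectIsomorphisms fun s => (pt s).sheafFiber (A := Type w))
    {F : Sheaf J (Dg k)} (hF : bddBelow k J F) :
    QuasiIso ((sheafComplex k J).map ((toSheafNG pt).app F)) := by
  obtain ⟨b, hb⟩ := exists_vanishesBelow hF
  refine quasiIso_sheafComplex_map hpt _ fun s => ?_
  have hf : (pt s).presheafFiber.map (godementUnit k pt F).hom ≫
      (stalkCos (pt s) (godementPreCos pt F)).δ (0 : Fin 2) =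
        (pt s).presheafFiber.map (godementUnit k pt F).hom ≫
          (stalkCos (pt s) (godementPreCos pt F)).δ 1 := by
    exact map_comp_coface (sheafToPresheaf J (Dg k) ⋙ (pt s).presheafFiber)
      ((godementUnit_coface k pt F 0).trans (godementUnit_coface k pt F 1).symm)
  have : IsIso (stalkTotMap (pt s) (godementPreCos pt F)) :=
    isIso_stalkTotMap (pt s) (K := godementPreCos pt F) (b := b) fun m => vanishesBelow_monadIter pt hb (m.len + 1)
  exact quasiIso_of_comp_eq this (stalk_toNG_stalkTotMap pt F s hf)
    ((extraCodegeneracy pt F s).quasiIso_totAug hf)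

end StalkNG

/-! ### Global sections and their derived functor -/

section Global
variable {k : Type w} [Field k] {C : Type w} [SmallCategory C] (J : GrothendieckTopology C)

/-- Global sections are the limit over the opposite category, in which a terminal object becomes
initial. -/
lemma isIso_globalRes (X : C) (hX : IsTerminal X) (F : Sheaf J (Dg k)) :
    IsIso (globalRes k J (op X) F) := by
  have : ∀ n, IsIso ((globalRes k J (op X) F).f n) := fun n =>
    (Sheaf.isLimitConeΓ _).isIso_π_app_of_isInitial (op X) (initialOpOfTerminal hX)
  exact HomologicalComplex.Hom.isIso_of_components _

lemma globalRes_naturality (U : Cᵒᵖ) {F F' : Sheaf J (Dg k)} (f : F ⟶ F') :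
    (globalComplex k J).map f ≫ globalRes k J U F' = globalRes k J U F ≫ f.hom.app U := by
  ext n : 1
  exact Sheaf.ΓRes_naturality ((sheafCompose J (HomologicalComplex.eval _ _ n)).map f) U

variable [HasDerivedCategory.{v} (Sheaf J (ModuleCat.{w} k))]
  [HasDerivedCategory.{u} (ModuleCat.{w} k)]

lemma toDerivedGlobal_naturality {F F' : (bddBelow k J).FullSubcategory} (f : F ⟶ F') :
    DerivedCategory.Q.map ((globalComplex k J).map f.hom) ≫ toDerivedGlobal k J F' =
      toDerivedGlobal k J F ≫ (derivedGlobal k J).map f := by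
  have h1 := DerivedCategory.quotientCompQhIso_inv_naturality ((globalComplex k J).map f.hom)
  have h2 := (Sheaf.Γ J (ModuleCat.{w} k)).rightDerivedFunctorPlusUnit.naturality
    ((HomotopyCategory.Plus.quotient _).map ((bddSheafComplex k J).map f))
  have h3 := congrArg DerivedCategory.Plus.ι.map h2
  rw [Functor.map_comp, Functor.map_comp] at h3
  refine (Category.assoc _ _ _).symm.trans ?_
  refine (congrArg (· ≫ _) h1).trans ?_
  refine (Category.assoc _ _ _).trans ?_
  refine Eq.trans ?_ (Category.assoc _ _ _).symm
  exact congrArg (_ ≫ ·) h3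

lemma isIso_derivedGlobal_map {F F' : (bddBelow k J).FullSubcategory} (f : F ⟶ F')
    (hf : QuasiIso ((sheafComplex k J).map f.hom)) : IsIso ((derivedGlobal k J).map f) := by
  have h : HomotopyCategory.Plus.quasiIso _
      ((HomotopyCategory.Plus.quotient _).map ((bddSheafComplex k J).map f)) :=
    (HomotopyCategory.quotient_map_mem_quasiIso_iff _).2 hf
  have : IsIso (DerivedCategory.Plus.Qh.map
      ((HomotopyCategory.Plus.quotient _).map ((bddSheafComplex k J).map f))) :=
    Localization.inverts DerivedCategory.Plus.Qh _ _ h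
  exact inferInstanceAs (IsIso (((Sheaf.Γ J (ModuleCat.{w} k)).rightDerivedFunctorPlus ⋙
    DerivedCategory.Plus.ι).map (DerivedCategory.Plus.Qh.map
      ((HomotopyCategory.Plus.quotient _).map ((bddSheafComplex k J).map f)))))

/-- Bounded below complexes of injectives compute the right derived functor. -/
lemma isIso_toDerivedGlobal (F : (bddBelow k J).FullSubcategory)
    [∀ n, Injective (((sheafComplex k J).obj F.obj).X n)] : IsIso (toDerivedGlobal k J F) := by
  have : ∀ n, Injective (((HomotopyCategory.Plus.quotient _).obj
    ((bddSheafComplex k J).obj F)).obj.as.X n) := fun n =>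
      inferInstanceAs (Injective (((sheafComplex k J).obj F.obj).X n))
  have : IsIso ((Sheaf.Γ J (ModuleCat.{w} k)).rightDerivedFunctorPlusUnit.app
      ((HomotopyCategory.Plus.quotient _).obj ((bddSheafComplex k J).obj F))) := inferInstance
  have : IsIso (DerivedCategory.Plus.ι.map
      ((Sheaf.Γ J (ModuleCat.{w} k)).rightDerivedFunctorPlusUnit.app
        ((HomotopyCategory.Plus.quotient _).obj ((bddSheafComplex k J).obj F)))) :=
    Functor.map_isIso _ _
  exact IsIso.comp_isIso' inferInstance this

end Global

/-! ### Comparison with derived global sections -/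

section Comparison
variable {k : Type w} [Field k] {C : Type w} [SmallCategory C] {J : GrothendieckTopology C}
  {S : Type w} (pt : S → GrothendieckTopology.Point.{w} J)

/-- The normalized Godement resolution of bounded below sheaves of complexes. -/
def bddNG : (bddBelow k J).FullSubcategory ⥤ (bddBelow k J).FullSubcategory :=
  ObjectProperty.lift _ ((bddBelow k J).ι ⋙ sheafNG pt) fun F => bddBelow_sheafNG pt F.property

/-- The coaugmentation of the normalized Godement resolution of bounded below sheaves. -/
def toBddNG (F : (bddBelow k J).FullSubcategory) : F ⟶ (bddNG pt).obj F :=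
  ObjectProperty.homMk ((toSheafNG pt).app F.obj)

lemma toBddNG_naturality {F F' : (bddBelow k J).FullSubcategory} (f : F ⟶ F') :
    f ≫ toBddNG pt F' = toBddNG pt F ≫ (bddNG pt).map f := by
  apply ObjectProperty.hom_ext
  exact (toSheafNG pt).naturality f.hom

/-- The restriction of global sections of the normalized Godement resolution. -/
def resNG (X : C) (F : (bddBelow k J).FullSubcategory) :
    (globalComplex k J).obj ((bddNG pt).obj F).obj ⟶ ((NG k pt).obj F.obj).obj (op X) :=
  globalRes k J (op X) ((sheafNG pt).obj F.obj)

lemma resNG_naturality (X : C) {F F' : (bddBelow k J).FullSubcategory} (f : F ⟶ F') :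
    (globalComplex k J).map ((bddNG pt).map f).hom ≫ resNG pt X F' =
      resNG pt X F ≫ ((NG k pt).map f.hom).app (op X) :=
  globalRes_naturality J (op X) ((sheafNG pt).map f.hom)

lemma map_toBddNG_resNG (X : C) (F : (bddBelow k J).FullSubcategory) :
    (globalComplex k J).map (toBddNG pt F).hom ≫ resNG pt X F =
      globalRes k J (op X) F.obj ≫ toNG k pt F.obj (op X) :=
  globalRes_naturality J (op X) ((toSheafNG pt).app F.obj)

variable [HasDerivedCategory.{u} (ModuleCat.{w} k)]

lemma isIso_Q_map_resNG {X : C} (hX : IsTerminal X) (F : (bddBelow k J).FullSubcategory) :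
    IsIso (DerivedCategory.Q.map (resNG pt X F)) :=
  have : IsIso (resNG pt X F) := isIso_globalRes J X hX _
  Functor.map_isIso _ _

variable [HasDerivedCategory.{v} (Sheaf J (ModuleCat.{w} k))]

lemma isIso_toDerivedGlobal_bddNG (F : (bddBelow k J).FullSubcategory) :
    IsIso (toDerivedGlobal k J ((bddNG pt).obj F)) :=
  have : ∀ n, Injective (((sheafComplex k J).obj ((bddNG pt).obj F).obj).X n) :=
    injective_sheafNG pt F.obj
  isIso_toDerivedGlobal J _

lemma isIso_derivedGlobal_map_toBddNG
    (hpt : JointlyReflectIsomorphisms fun s => (pt s).sheafFiber (A := Type w))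
    (F : (bddBelow k J).FullSubcategory) : IsIso ((derivedGlobal k J).map (toBddNG pt F)) :=
  isIso_derivedGlobal_map J _ (quasiIso_toSheafNG pt hpt F.property)

variable (hpt : JointlyReflectIsomorphisms fun s => (pt s).sheafFiber (A := Type w))
  {X : C} (hX : IsTerminal X)

/-- The comparison of the sections over the terminal object of the normalized Godement
resolution with derived global sections. -/
def comparison (F : (bddBelow k J).FullSubcategory) :
    DerivedCategory.Q.obj (((NG k pt).obj F.obj).obj (op X)) ≅ (derivedGlobal k J).obj F :=
  -- The zigzag of isomorphisms `NG(F)(X) ← Γ(NG F) → RΓ(NG F) ← RΓ(F)`.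
  (@asIso _ _ _ _ _ (isIso_Q_map_resNG pt hX F)).symm ≪≫
    @asIso _ _ _ _ _ (isIso_toDerivedGlobal_bddNG pt F) ≪≫
      (@asIso _ _ _ _ _ (isIso_derivedGlobal_map_toBddNG pt hpt F)).symm

lemma map_resNG_comparison_hom (F : (bddBelow k J).FullSubcategory) :
    DerivedCategory.Q.map (resNG pt X F) ≫ (comparison pt hpt hX F).hom ≫
      (derivedGlobal k J).map (toBddNG pt F) = toDerivedGlobal k J ((bddNG pt).obj F) := by
  have h1 := isIso_Q_map_resNG pt hX F
  have h2 := isIso_derivedGlobal_map_toBddNG pt hpt F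
  simp [comparison]

/-- The outer maps of the zigzag are invertible and natural, so after cancelling them the claim is
the naturality of `toDerivedGlobal` on the resolutions. -/
lemma comparison_naturality {F F' : (bddBelow k J).FullSubcategory} (f : F ⟶ F') :
    DerivedCategory.Q.map (((NG k pt).map f.hom).app (op X)) ≫ (comparison pt hpt hX F').hom =
      (comparison pt hpt hX F).hom ≫ (derivedGlobal k J).map f := by
  have h1 := isIso_Q_map_resNG pt hX F
  have h2 := isIso_derivedGlobal_map_toBddNG pt hpt F'
  have e2 := toDerivedGlobal_naturality J ((bddNG pt).map f)
  rw [← map_resNG_comparison_hom pt hpt hX F, ← map_resNG_comparison_hom pt hpt hX F',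
    ← Functor.map_comp_assoc, resNG_naturality, Functor.map_comp_assoc] at e2
  rw [← cancel_epi (DerivedCategory.Q.map (resNG pt X F)),
    ← cancel_mono ((derivedGlobal k J).map (toBddNG pt F'))]
  simp only [Category.assoc, ← Functor.map_comp (derivedGlobal k J), toBddNG_naturality] at e2 ⊢
  exact e2

/-- After composition with the isomorphism from `RΓ(F)` to `RΓ(NG F)`, this is the naturality of
`toDerivedGlobal` with respect to the coaugmentation. -/
lemma map_toNG_comparison_hom (F : (bddBelow k J).FullSubcategory) :
    DerivedCategory.Q.map (globalRes k J (op X) F.obj ≫ toNG k pt F.obj (op X)) ≫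
      (comparison pt hpt hX F).hom = toDerivedGlobal k J F := by
  have h2 := isIso_derivedGlobal_map_toBddNG pt hpt F
  rw [← cancel_mono ((derivedGlobal k J).map (toBddNG pt F)), ← toDerivedGlobal_naturality,
    ← map_resNG_comparison_hom pt hpt hX F, ← map_toBddNG_resNG, Functor.map_comp]
  simp only [Category.assoc]

/-- The comparison of the normalized Godement resolution with derived global sections, as an
isomorphism of functors. -/
def comparisonIso :
    (bddBelow k J).ι ⋙ NG k pt ⋙ (evaluation Cᵒᵖ (Dg k)).obj (op X) ⋙ DerivedCategory.Q ≅
      derivedGlobal k J :=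
  NatIso.ofComponents (comparison pt hpt hX) fun f => comparison_naturality pt hpt hX f

end Comparison

end GodementEZ

end

theorem mainTheorem6 {k : Type w} [Field k] {C : Type w} [SmallCategory C]
    (J : GrothendieckTopology C) {S : Type w} (pt : S → GrothendieckTopology.Point.{w} J)
    (hpt : JointlyReflectIsomorphisms fun s => (pt s).sheafFiber (A := Type w))
    (X : C) (hX : IsTerminal X)
    [HasDerivedCategory.{v} (Sheaf J (ModuleCat.{w} k))]
    [HasDerivedCategory.{u} (ModuleCat.{w} k)] :
    ∃ A : (F : CDGASheaf k J) → GodementAlg pt F,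
      (∀ (F : CDGASheaf k J) (U : Cᵒᵖ),
        IsEZAlgebra (((NG k pt).obj F.sheaf).obj U) (ezAct ((A F).sections pt U))) ∧
      (∀ (F : CDGASheaf k J) {U V : Cᵒᵖ} (f : U ⟶ V),
        IsEZHom (ezAct ((A F).sections pt U)) (ezAct ((A F).sections pt V))
          (((NG k pt).obj F.sheaf).map f)) ∧
      (∀ (F F' : CDGASheaf k J) (g : F.sheaf ⟶ F'.sheaf), IsCDGASheafHom F F' g → ∀ U : Cᵒᵖ,
        IsEZHom (ezAct ((A F).sections pt U)) (ezAct ((A F').sections pt U))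
          (((NG k pt).map g).app U)) ∧
      ∃ e : (bddBelow k J).ι ⋙ NG k pt ⋙ (evaluation Cᵒᵖ (Dg k)).obj (op X) ⋙ DerivedCategory.Q ≅
          derivedGlobal k J,
        ∀ F : (bddBelow k J).FullSubcategory,
          DerivedCategory.Q.map (globalRes k J (op X) F.obj ≫ toNG k pt F.obj (op X)) ≫
            e.hom.app F = toDerivedGlobal k J F := by
  exact ⟨godementAlg pt, fun F U => isEZAlgebra_ezAct _,
    fun F _ _ f => isEZHom_NG_restriction pt F f,
    fun F F' g hg U => isEZHom_NG_map pt F F' g hg U, comparisonIso pt hpt hX,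
    fun F => map_toNG_comparison_hom pt hpt hX F⟩
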